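/- **Setting.** Work in Heyting arithmetic (intuitionistic first-order arithmetic with symbols and defining equations for all primitive recursive functions), in the language extended by three unary predicates: $\mathcal V(x)$ ("$x$ is a v-set"), $\mathcal M(p)$ ("$p$ is a Meaningful condition") and $\mathcal T(p)$ ("$p$ is a True condition"). Induction is available for all formulas of this language. Let $\langle\cdot,\cdot\rangle$ be the Cantor pairing function with projections $(\cdot)_L,(\cdot)_R$, let $\mathbf T(e,i,o)$ be Kleene's predicate and $\mathbf U$ the output function; $ei\!\downarrow$ means $\exists o\,\mathbf T(e,i,o)$, and then $ei=\mathbf U(o)$. Put $c^x_n=(xn)_R$ and $x_n=(xn)_L$. Let $\Xi$ be a binary primitive recursive function symbol (for instance $\Xi(f,g)=2\langle f,g\rangle+1$). Let $\mathsf S$ be the theory with the following further axioms, the schemata being over all formulas $\phi,\psi$ of the language (with parameters). * $\forall x\,\big[\forall n\,(xn\!\downarrow\wedge\,\mathcal M(c^x_n)\wedge(\mathcal T(c^x_n)\to\mathcal V(x_n)))\to\mathcal V(x)\big]$. * $\forall x\,\big[\forall n\,(xn\!\downarrow\wedge\,\mathcal M(c^x_n)\wedge(\mathcal T(c^x_n)\to\phi(x_n)))\to\phi(x)\big]\to\forall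 x\,(\mathcal V(x)\to\phi(x))$. * $\forall f,g\;\big[\mathcal M(\Xi(f,g))\to\big(\mathcal T(\Xi(f,g))\leftrightarrow\forall n\,(fn\!\downarrow\wedge\,\mathcal T(fn)\to gn\!\downarrow\wedge\,\mathcal T(gn))\big)\big]$. * $\forall f,g\;\big[\forall n\,(fn\!\downarrow\,\to\mathcal M(fn))\wedge\forall n\,(fn\!\downarrow\wedge\,gn\!\downarrow\wedge\,\mathcal T(fn)\to\mathcal M(gn))\to\mathcal M(\Xi(f,g))\big]$. * Extended Church's Thesis $\mathsf{ECT}_V$: $\forall n\,(\phi(n)\to\exists m\,\psi(n,m))\to\exists e\,\forall n\,(\phi(n)\to en\!\downarrow\wedge\,\psi(n,en))$, for almost-negative $\phi$ and arbitrary $\psi$. Here the almost-negative formulas are those built by $\wedge$, $\to$ and $\forall$ from atomic formulas $\mathcal V(t),\mathcal M(t),\mathcal T(t)$ and from formulas consisting of existential quantifiers in front of a quantifier-free formula of primitive recursive arithmetic. **Interpretation of set theory.** Formulas of first-order set theory are built from $\bot$ and equations $x\simeq y$ by $\wedge,\vee,\to$, unbounded quantifiers $\forall x,\exists x$ and bounded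 quantifiers $\forall x\in y,\exists x\in y$; $x\in y$ abbreviates $\exists x'\in y\; x\simeq x'$. Given an arithmetical formula $E(x,y)$ as interpretation of $x\simeq y$, they are interpreted in the language of $\mathsf S$: unbounded quantifiers range over the $x$ with $\mathcal V(x)$, and quantifiers bounded by $y$ range over the numbers $y_n$ with $\mathcal T(c^y_n)$. Let $\mathrm{Eq}_E$ be the interpretation of the recursive characterisation of extensional equality $$\forall x,y\;\big(x\simeq y\leftrightarrow(\forall a\in x\;a\in y)\wedge(\forall b\in y\;b\in x)\big).$$ **Theorem (Bounded Separation).** There is a formula $E$ such that $\mathsf S$ proves $\mathrm{Eq}_E$. Moreover, for every formula $E(x,y)$ and every formula $\phi(x,y,p_1,\dots,p_n)$ of first-order set theory all of whose quantifiers are bounded, $\mathsf S$ proves that $\mathrm{Eq}_E$ implies the interpretation of $$\forall p_1,\dots,p_n\,\forall y\,\exists z\,\forall x\;\big(x\in z\leftrightarrow x\in y\wedge\phi(x,y,p_1,\dots,p_n)\big).$$ That is, under the assumptions above, for every v-set $y$ and every bounded formula there is a v-set containing all and only the elements of $y$ which satisfy the formula. -/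

import Mathlib

namespace VSet

open Matrix (vecCons)

/-! ### Primitive recursive function symbols -/

/-- Symbols (definitions) of primitive recursive functions, graded by arity. `prec f g` is the
function `h` with `h (0, x) = f x` and `h (t + 1, x) = g (t, h (t, x), x)`. -/
inductive PR : ℕ → Type
  | zero : PR 0
  | succ : PR 1
  | proj {k : ℕ} (i : Fin k) : PR k
  | comp {m k : ℕ} (f : PR m) (g : Fin m → PR k) : PR k
  | prec {k : ℕ} (f : PR k) (g : PR (k + 2)) : PR (k + 1)

namespace PR

/-- The constant function with value `c`. -/
def num {k : ℕ} : ℕ → PR k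
  | 0 => comp zero ![]
  | c + 1 => comp succ ![num c]

/-- Predecessor, with `pred 0 = 0`. -/
def pred : PR 1 := prec zero (proj 0)

/-- Addition. -/
def add : PR 2 := prec (proj 0) (comp succ ![proj 1])

/-- Truncated subtraction: `sub (x, y) = x - y`. -/
def sub : PR 2 := comp (prec (proj 0) (comp pred ![proj 1])) ![proj 1, proj 0]

/-- `ifz (c, a, b)` is `a` if `c = 0`, and `b` otherwise. -/
def ifz : PR 3 := prec (proj 0) (proj 3)

/-- Triangular numbers: `tri n = 0 + 1 + ⋯ + n`. -/
def tri : PR 1 := prec zero (comp succ ![comp add ![proj 0, proj 1]])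

/-- The Cantor pairing function `(a, b) ↦ (a + b) (a + b + 1) / 2 + b`. -/
def pair : PR 2 := comp add ![comp tri ![add], proj 1]

/-- `diag n` is the largest `w` with `tri w ≤ n`. -/
def diag : PR 1 :=
  prec zero
    (comp ifz ![comp sub ![comp tri ![comp succ ![proj 1]], comp succ ![proj 0]],
      comp succ ![proj 1], proj 1])

/-- The right projection of the Cantor pairing function. -/
def right : PR 1 := comp sub ![proj 0, comp tri ![diag]]

/-- The left projection of the Cantor pairing function. -/
def left : PR 1 := comp sub ![diag, right]

/-! Pointwise versions of these functions. -/

def S {k : ℕ} (a : PR k) : PR k := comp succ ![a]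
def P {k : ℕ} (a : PR k) : PR k := comp pred ![a]
def L {k : ℕ} (a : PR k) : PR k := comp left ![a]
def R {k : ℕ} (a : PR k) : PR k := comp right ![a]
def pr {k : ℕ} (a b : PR k) : PR k := comp pair ![a, b]
def ite {k : ℕ} (c a b : PR k) : PR k := comp ifz ![c, a, b]

/-- `switch t [a₀, …, aᵣ₋₁] d` is `aⱼ` where `t = j < r`, and `d` where `t ≥ r`. -/
def switch {k : ℕ} (t : PR k) : List (PR k) → PR k → PR k
  | [], d => d
  | a :: l, d => ite t a (switch (P t) l d)

/-! ### The universal machine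

Every natural number `e = ⟨t, a⟩` is a program for a unary partial recursive function `{e}`:

* `t = 0`: the constant `0`; `t = 1`: successor; `t = 2`, `t = 3`: left and right projection;
* `t = 4`, `a = ⟨f, g⟩`: `n ↦ ⟨{f} n, {g} n⟩`;
* `t = 5`, `a = ⟨f, g⟩`: `n ↦ {f} ({g} n)`;
* `t = 6`, `a = ⟨f, g⟩`: primitive recursion, `⟨x, 0⟩ ↦ {f} x` and
  `⟨x, m + 1⟩ ↦ {g} ⟨x, ⟨m, {e} ⟨x, m⟩⟩⟩`;
* `t ≥ 7`, `a = f`: minimisation, `⟨x, m⟩ ↦` the least `j ≥ m` with `{f} ⟨x, j⟩ = 0`, all the values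
  `{f} ⟨x, i⟩` with `m ≤ i < j` being defined.

The machine has a stack of pending tasks: `0` is the empty stack, `⟨frame, K⟩ + 1` is the stack `K`
with `frame` on top. Its states are `⟨0, ⟨e, ⟨n, K⟩⟩⟩` (evaluate program `e` on input `n`, then go
on with `K`) and `⟨1, ⟨v, K⟩⟩` (return the value `v` to `K`). It has halted with output `v` in the
state `⟨1, ⟨v, 0⟩⟩`. -/

/-- The state "evaluate program `e` on input `n`, then go on with `K`". -/
def evalSt {k : ℕ} (e n K : PR k) : PR k := pr (num 0) (pr e (pr n K))

/-- The state "return the value `v` to `K`". -/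
def retSt {k : ℕ} (v K : PR k) : PR k := pr (num 1) (pr v K)

/-- Put `⟨tag, data⟩` on top of the stack `K`. -/
def push {k : ℕ} (tag : ℕ) (data K : PR k) : PR k := S (pr (pr (num tag) data) K)

/-- One step from the state "evaluate program `e` on input `n`, then go on with `K`". -/
def evalStep {k : ℕ} (e n K : PR k) : PR k :=
  switch (L e)
    [ retSt (num 0) K,
      retSt (S n) K,
      retSt (L n) K,
      retSt (R n) K,
      evalSt (L (R e)) n (push 0 (pr (R (R e)) n) K),
      evalSt (R (R e)) n (push 2 (L (R e)) K),
      ite (R n)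
        (evalSt (L (R e)) (L n) K)
        (evalSt e (pr (L n) (P (R n))) (push 3 (pr (R (R e)) (pr (L n) (P (R n)))) K)) ]
    (evalSt (R e) n (push 4 (pr e n) K))

/-- One step from the state "return the value `v` to the stack with the frame `⟨t, d⟩` on top of
the stack `K`". -/
def retStep {k : ℕ} (v t d K : PR k) : PR k :=
  switch t
    [ evalSt (L d) (R d) (push 1 v K),
      retSt (pr d v) K,
      evalSt d v K,
      evalSt (L d) (pr (L (R d)) (pr (R (R d)) v)) K ]
    (ite v
      (retSt (R (R d)) K)
      (evalSt (L d) (pr (L (R d)) (S (R (R d)))) K))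

/-- One step of the machine; halted states do not change. -/
def step : PR 1 :=
  let s : PR 1 := proj 0
  let x : PR 1 := R s
  ite (L s)
    (evalStep (L x) (L (R x)) (R (R x)))
    (ite (R x) s
      (retStep (L x) (L (L (P (R x)))) (R (L (P (R x)))) (R (P (R x)))))

/-- `run (t, s)` is the state which is reached from the state `s` after `t` steps. -/
def run : PR 2 := prec (proj 0) (comp step ![proj 1])

end PR

/-! ### First-order arithmetic with three additional unary predicates

Terms and formulas with free variables among `0, …, n - 1` (de Bruijn indices: a quantifier binds
the variable `0` of its body and moves the other variables up by one). -/

/-- Terms of primitive recursive arithmetic. -/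
inductive Tm (n : ℕ) : Type
  | var (i : Fin n) : Tm n
  | app {k : ℕ} (f : PR k) (ts : Fin k → Tm n) : Tm n

namespace Tm

/-- Simultaneous substitution. -/
def subst {n m : ℕ} (σ : Fin n → Tm m) : Tm n → Tm m
  | var i => σ i
  | app f ts => app f fun i => (ts i).subst σ

/-- Weakening by one new variable `0`. -/
def shift {n : ℕ} (t : Tm n) : Tm (n + 1) := t.subst fun i => var i.succ

def zero {n : ℕ} : Tm n := app PR.zero ![]
def succ {n : ℕ} (t : Tm n) : Tm n := app PR.succ ![t]
def pair {n : ℕ} (s t : Tm n) : Tm n := app PR.pair ![s, t]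
def left {n : ℕ} (t : Tm n) : Tm n := app PR.left ![t]
def right {n : ℕ} (t : Tm n) : Tm n := app PR.right ![t]

/-- A substitution, extended below a quantifier. -/
def up {n m : ℕ} (σ : Fin n → Tm m) : Fin (n + 1) → Tm (m + 1) :=
  vecCons (var 0) fun i => (σ i).shift

end Tm

/-- Formulas of first-order arithmetic with the additional unary predicates `V` ("is a v-set"),
`M` ("is a Meaningful condition") and `T` ("is a True condition"). -/
inductive Fm : ℕ → Type
  | bot {n : ℕ} : Fm n
  | eq {n : ℕ} (s t : Tm n) : Fm n
  | V {n : ℕ} (t : Tm n) : Fm n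
  | M {n : ℕ} (t : Tm n) : Fm n
  | T {n : ℕ} (t : Tm n) : Fm n
  | and {n : ℕ} (φ ψ : Fm n) : Fm n
  | or {n : ℕ} (φ ψ : Fm n) : Fm n
  | imp {n : ℕ} (φ ψ : Fm n) : Fm n
  | all {n : ℕ} (φ : Fm (n + 1)) : Fm n
  | ex {n : ℕ} (φ : Fm (n + 1)) : Fm n

namespace Fm

open Tm (var)

/-- Simultaneous (capture-avoiding) substitution. -/
def subst : {n m : ℕ} → (Fin n → Tm m) → Fm n → Fm m
  | _, _, _, bot => bot
  | _, _, σ, eq s t => eq (s.subst σ) (t.subst σ)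
  | _, _, σ, V t => V (t.subst σ)
  | _, _, σ, M t => M (t.subst σ)
  | _, _, σ, T t => T (t.subst σ)
  | _, _, σ, and φ ψ => and (φ.subst σ) (ψ.subst σ)
  | _, _, σ, or φ ψ => or (φ.subst σ) (ψ.subst σ)
  | _, _, σ, imp φ ψ => imp (φ.subst σ) (ψ.subst σ)
  | _, _, σ, all φ => all (φ.subst (Tm.up σ))
  | _, _, σ, ex φ => ex (φ.subst (Tm.up σ))

/-- Weakening by one new variable `0`. -/
def shift {n : ℕ} (φ : Fm n) : Fm (n + 1) := φ.subst fun i => var i.succ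

/-- The instance `φ(t)` of `φ(x)`, where `x` is the variable `0`. -/
def inst {n : ℕ} (φ : Fm (n + 1)) (t : Tm n) : Fm n := φ.subst (vecCons t var)

def iff {n : ℕ} (φ ψ : Fm n) : Fm n := and (imp φ ψ) (imp ψ φ)

/-- Kleene's predicate: `o = ⟨t, v⟩`, and the computation of program `e` on input `i` has halted
with output `v` after `t` steps. -/
def kleene {n : ℕ} (e i o : Tm n) : Fm n :=
  eq (Tm.app PR.run ![o.left, Tm.pair Tm.zero (Tm.pair e (Tm.pair i Tm.zero))])
    (Tm.pair Tm.zero.succ (Tm.pair o.right Tm.zero))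

end Fm

/-- Kleene's output function. -/
def Tm.out {n : ℕ} (o : Tm n) : Tm n := o.right

namespace Fm

open Tm (var)

/-- "`e i` is defined". -/
def defd {n : ℕ} (e i : Tm n) : Fm n := ex (kleene e.shift i.shift (var 0))

/-- "`e i` is defined and satisfies `P`", the argument of `P` being its variable `0`. -/
def ap {n : ℕ} (e i : Tm n) (P : Fm (n + 1)) : Fm n :=
  ex (and (kleene e.shift i.shift (var 0))
    (P.subst (vecCons (var 0).out fun j => var j.succ)))

/-- Quantifier-free formulas of primitive recursive arithmetic. -/
inductive QF : {n : ℕ} → Fm n → Prop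
  | bot {n : ℕ} : QF (Fm.bot (n := n))
  | eq {n : ℕ} (s t : Tm n) : QF (Fm.eq s t)
  | and {n : ℕ} {φ ψ : Fm n} : QF φ → QF ψ → QF (Fm.and φ ψ)
  | or {n : ℕ} {φ ψ : Fm n} : QF φ → QF ψ → QF (Fm.or φ ψ)
  | imp {n : ℕ} {φ ψ : Fm n} : QF φ → QF ψ → QF (Fm.imp φ ψ)

/-- Existential quantifiers in front of a quantifier-free formula of primitive recursive
arithmetic. -/
inductive Sigma1 : {n : ℕ} → Fm n → Prop
  | qf {n : ℕ} {φ : Fm n} : QF φ → Sigma1 φ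
  | ex {n : ℕ} {φ : Fm (n + 1)} : Sigma1 φ → Sigma1 (Fm.ex φ)

/-- Almost-negative formulas, the predicates `V`, `M` and `T` included. -/
inductive AlmostNegative : {n : ℕ} → Fm n → Prop
  | sigma1 {n : ℕ} {φ : Fm n} : Sigma1 φ → AlmostNegative φ
  | V {n : ℕ} (t : Tm n) : AlmostNegative (Fm.V t)
  | M {n : ℕ} (t : Tm n) : AlmostNegative (Fm.M t)
  | T {n : ℕ} (t : Tm n) : AlmostNegative (Fm.T t)
  | and {n : ℕ} {φ ψ : Fm n} :
      AlmostNegative φ → AlmostNegative ψ → AlmostNegative (Fm.and φ ψ)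
  | imp {n : ℕ} {φ ψ : Fm n} :
      AlmostNegative φ → AlmostNegative ψ → AlmostNegative (Fm.imp φ ψ)
  | all {n : ℕ} {φ : Fm (n + 1)} : AlmostNegative φ → AlmostNegative (Fm.all φ)

/-! ### The axioms -/

/-- Induction: `φ(0) → (∀ x, φ(x) → φ(x + 1)) → ∀ x, φ(x)`. -/
def induction {n : ℕ} (φ : Fm (n + 1)) : Fm n :=
  imp (φ.inst Tm.zero)
    (imp (all (imp φ (φ.subst (vecCons (var 0).succ fun i => var i.succ)))) (all φ))

/-- Extended Church's Thesis for `φ(n)` and `ψ(n, m)`: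
`(∀ n, φ(n) → ∃ m, ψ(n, m)) → ∃ e, ∀ n, φ(n) → e n is defined and ψ(n, e n)`.
In `φ` the variable `0` is `n`; in `ψ` the variable `0` is `m` and the variable `1` is `n`;
the other variables are parameters. -/
def ect {n : ℕ} (φ : Fm (n + 1)) (ψ : Fm (n + 2)) : Fm n :=
  imp (all (imp φ (ex ψ)))
    (ex (all (imp (φ.subst (vecCons (var 0) fun i => var i.succ.succ))
      (ap (var 1) (var 0)
        (ψ.subst (vecCons (var 0) (vecCons (var 1) fun i => var i.succ.succ.succ)))))))

/-- "For all `n`, `x n` is defined, the `n`-th condition `(x n)_R` of `x` is Meaningful, and if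
it is True then the `n`-th conditional element `(x n)_L` of `x` satisfies `P`",
the argument of `P` being its variable `0`. -/
def closed {k : ℕ} (x : Tm k) (P : Fm (k + 1)) : Fm k :=
  all (ap x.shift (var 0)
    (and (M (var 0).right)
      (imp (T (var 0).right)
        (P.subst (vecCons (var 0).left fun i => var i.succ.succ)))))

/-- Introduction of v-sets. -/
def vIntro {n : ℕ} : Fm n :=
  all (imp (closed (var 0) (V (var 0))) (V (var 0)))

/-- Induction over v-sets for `φ(x)`; in `φ` the variable `0` is `x`. -/
def vInd {n : ℕ} (φ : Fm (n + 1)) : Fm n :=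
  imp (all (imp (closed (var 0) (φ.subst (vecCons (var 0) fun i => var i.succ.succ))) φ))
    (all (imp (V (var 0)) φ))

/-- Truth of `Ξ(f, g)`, if it is Meaningful. -/
def xiTrue {n : ℕ} (Ξ : PR 2) : Fm n :=
  all (all
    (let f : Tm (n + 2) := var 1
     let g : Tm (n + 2) := var 0
     imp (M (Tm.app Ξ ![f, g]))
      (iff (T (Tm.app Ξ ![f, g]))
        (all (imp (ap f.shift (var 0) (T (var 0))) (ap g.shift (var 0) (T (var 0))))))))

/-- Sufficient condition for `Ξ(f, g)` to be Meaningful. -/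
def xiMeaningful {n : ℕ} (Ξ : PR 2) : Fm n :=
  all (all
    (let f : Tm (n + 2) := var 1
     let g : Tm (n + 2) := var 0
     imp
      (and
        (all (imp (defd f.shift (var 0)) (ap f.shift (var 0) (M (var 0)))))
        (all (imp
          (and (defd f.shift (var 0)) (and (defd g.shift (var 0)) (ap f.shift (var 0) (T (var 0)))))
          (ap g.shift (var 0) (M (var 0))))))
      (M (Tm.app Ξ ![f, g]))))

end Fm

/-- The axioms of Heyting arithmetic (with all primitive recursive functions), Extended Church's
Thesis in the language with `V`, `M` and `T`, the defining assumptions on `V`, and the two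
assumptions on `Ξ`. -/
inductive Axm (Ξ : PR 2) : {n : ℕ} → Fm n → Prop
  | proj {n k : ℕ} (i : Fin k) (ts : Fin k → Tm n) :
      Axm Ξ (Fm.eq (Tm.app (PR.proj i) ts) (ts i))
  | comp {n m k : ℕ} (f : PR m) (g : Fin m → PR k) (ts : Fin k → Tm n) :
      Axm Ξ (Fm.eq (Tm.app (PR.comp f g) ts) (Tm.app f fun i => Tm.app (g i) ts))
  | prec_zero {n k : ℕ} (f : PR k) (g : PR (k + 2)) (ts : Fin k → Tm n) :
      Axm Ξ (Fm.eq (Tm.app (PR.prec f g) (vecCons Tm.zero ts)) (Tm.app f ts))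
  | prec_succ {n k : ℕ} (f : PR k) (g : PR (k + 2)) (t : Tm n) (ts : Fin k → Tm n) :
      Axm Ξ (Fm.eq (Tm.app (PR.prec f g) (vecCons t.succ ts))
        (Tm.app g (vecCons t (vecCons (Tm.app (PR.prec f g) (vecCons t ts)) ts))))
  | succ_ne_zero {n : ℕ} (t : Tm n) : Axm Ξ (Fm.imp (Fm.eq t.succ Tm.zero) Fm.bot)
  | succ_inj {n : ℕ} (s t : Tm n) : Axm Ξ (Fm.imp (Fm.eq s.succ t.succ) (Fm.eq s t))
  | induction {n : ℕ} (φ : Fm (n + 1)) : Axm Ξ (Fm.induction φ)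
  | ect {n : ℕ} (φ : Fm (n + 1)) (ψ : Fm (n + 2)) (hφ : Fm.AlmostNegative φ) :
      Axm Ξ (Fm.ect φ ψ)
  | vIntro {n : ℕ} : Axm Ξ (Fm.vIntro (n := n))
  | vInd {n : ℕ} (φ : Fm (n + 1)) : Axm Ξ (Fm.vInd φ)
  | xiTrue {n : ℕ} : Axm Ξ (Fm.xiTrue (n := n) Ξ)
  | xiMeaningful {n : ℕ} : Axm Ξ (Fm.xiMeaningful (n := n) Ξ)

/-- Derivability from the hypotheses `Γ` in intuitionistic first-order logic with equality over
the axioms `Axm Ξ` (natural deduction). -/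
inductive Prv (Ξ : PR 2) : {n : ℕ} → List (Fm n) → Fm n → Prop
  | axm {n : ℕ} {Γ : List (Fm n)} {φ : Fm n} : Axm Ξ φ → Prv Ξ Γ φ
  | hyp {n : ℕ} {Γ : List (Fm n)} {φ : Fm n} : φ ∈ Γ → Prv Ξ Γ φ
  | bot_elim {n : ℕ} {Γ : List (Fm n)} {φ : Fm n} : Prv Ξ Γ Fm.bot → Prv Ξ Γ φ
  | and_intro {n : ℕ} {Γ : List (Fm n)} {φ ψ : Fm n} :
      Prv Ξ Γ φ → Prv Ξ Γ ψ → Prv Ξ Γ (Fm.and φ ψ)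
  | and_left {n : ℕ} {Γ : List (Fm n)} {φ ψ : Fm n} : Prv Ξ Γ (Fm.and φ ψ) → Prv Ξ Γ φ
  | and_right {n : ℕ} {Γ : List (Fm n)} {φ ψ : Fm n} : Prv Ξ Γ (Fm.and φ ψ) → Prv Ξ Γ ψ
  | or_left {n : ℕ} {Γ : List (Fm n)} {φ ψ : Fm n} : Prv Ξ Γ φ → Prv Ξ Γ (Fm.or φ ψ)
  | or_right {n : ℕ} {Γ : List (Fm n)} {φ ψ : Fm n} : Prv Ξ Γ ψ → Prv Ξ Γ (Fm.or φ ψ)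
  | or_elim {n : ℕ} {Γ : List (Fm n)} {φ ψ χ : Fm n} :
      Prv Ξ Γ (Fm.or φ ψ) → Prv Ξ (φ :: Γ) χ → Prv Ξ (ψ :: Γ) χ → Prv Ξ Γ χ
  | imp_intro {n : ℕ} {Γ : List (Fm n)} {φ ψ : Fm n} :
      Prv Ξ (φ :: Γ) ψ → Prv Ξ Γ (Fm.imp φ ψ)
  | imp_elim {n : ℕ} {Γ : List (Fm n)} {φ ψ : Fm n} :
      Prv Ξ Γ (Fm.imp φ ψ) → Prv Ξ Γ φ → Prv Ξ Γ ψ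
  | all_intro {n : ℕ} {Γ : List (Fm n)} {φ : Fm (n + 1)} :
      Prv Ξ (Γ.map Fm.shift) φ → Prv Ξ Γ (Fm.all φ)
  | all_elim {n : ℕ} {Γ : List (Fm n)} {φ : Fm (n + 1)} (t : Tm n) :
      Prv Ξ Γ (Fm.all φ) → Prv Ξ Γ (φ.inst t)
  | ex_intro {n : ℕ} {Γ : List (Fm n)} {φ : Fm (n + 1)} (t : Tm n) :
      Prv Ξ Γ (φ.inst t) → Prv Ξ Γ (Fm.ex φ)
  | ex_elim {n : ℕ} {Γ : List (Fm n)} {φ : Fm (n + 1)} {χ : Fm n} :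
      Prv Ξ Γ (Fm.ex φ) → Prv Ξ (φ :: Γ.map Fm.shift) χ.shift → Prv Ξ Γ χ
  | eq_refl {n : ℕ} {Γ : List (Fm n)} (t : Tm n) : Prv Ξ Γ (Fm.eq t t)
  | eq_subst {n : ℕ} {Γ : List (Fm n)} {s t : Tm n} (φ : Fm (n + 1)) :
      Prv Ξ Γ (Fm.eq s t) → Prv Ξ Γ (φ.inst s) → Prv Ξ Γ (φ.inst t)

/-- A sentence is a theorem if it is derivable without hypotheses. -/
def Thm (Ξ : PR 2) (φ : Fm 0) : Prop := Prv Ξ [] φ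

/-! ### First-order set theory -/

/-- Formulas of first-order set theory, with unbounded and bounded quantifiers, and with free
variables among `0, …, n - 1` (de Bruijn indices). `ball j φ` is `∀ x ∈ j, φ`, and `bex j φ` is
`∃ x ∈ j, φ`. -/
inductive SFm : ℕ → Type
  | bot {n : ℕ} : SFm n
  | eq {n : ℕ} (i j : Fin n) : SFm n
  | and {n : ℕ} (φ ψ : SFm n) : SFm n
  | or {n : ℕ} (φ ψ : SFm n) : SFm n
  | imp {n : ℕ} (φ ψ : SFm n) : SFm n
  | all {n : ℕ} (φ : SFm (n + 1)) : SFm n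
  | ex {n : ℕ} (φ : SFm (n + 1)) : SFm n
  | ball {n : ℕ} (j : Fin n) (φ : SFm (n + 1)) : SFm n
  | bex {n : ℕ} (j : Fin n) (φ : SFm (n + 1)) : SFm n

namespace SFm

/-- Membership is not primitive: `x ∈ y` is `∃ x' ∈ y, x = x'`. -/
def mem {n : ℕ} (i j : Fin n) : SFm n := bex j (eq i.succ 0)

def iff {n : ℕ} (φ ψ : SFm n) : SFm n := and (imp φ ψ) (imp ψ φ)

/-- Formulas all of whose quantifiers are bounded. -/
inductive Bounded : {n : ℕ} → SFm n → Prop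
  | bot {n : ℕ} : Bounded (SFm.bot (n := n))
  | eq {n : ℕ} (i j : Fin n) : Bounded (SFm.eq i j)
  | and {n : ℕ} {φ ψ : SFm n} : Bounded φ → Bounded ψ → Bounded (SFm.and φ ψ)
  | or {n : ℕ} {φ ψ : SFm n} : Bounded φ → Bounded ψ → Bounded (SFm.or φ ψ)
  | imp {n : ℕ} {φ ψ : SFm n} : Bounded φ → Bounded ψ → Bounded (SFm.imp φ ψ)
  | ball {n : ℕ} (j : Fin n) {φ : SFm (n + 1)} : Bounded φ → Bounded (SFm.ball j φ)
  | bex {n : ℕ} (j : Fin n) {φ : SFm (n + 1)} : Bounded φ → Bounded (SFm.bex j φ)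

/-- Renaming of variables. -/
def rename : {n m : ℕ} → (Fin n → Fin m) → SFm n → SFm m
  | _, _, _, bot => bot
  | _, _, r, eq i j => eq (r i) (r j)
  | _, _, r, and φ ψ => and (φ.rename r) (ψ.rename r)
  | _, _, r, or φ ψ => or (φ.rename r) (ψ.rename r)
  | _, _, r, imp φ ψ => imp (φ.rename r) (ψ.rename r)
  | _, _, r, all φ => all (φ.rename (vecCons 0 fun i => (r i).succ))
  | _, _, r, ex φ => ex (φ.rename (vecCons 0 fun i => (r i).succ))
  | _, _, r, ball j φ => ball (r j) (φ.rename (vecCons 0 fun i => (r i).succ))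
  | _, _, r, bex j φ => bex (r j) (φ.rename (vecCons 0 fun i => (r i).succ))

/-- Universal closure. -/
def close : {n : ℕ} → SFm n → SFm 0
  | 0, φ => φ
  | _ + 1, φ => close (all φ)

/-- The interpretation of set theory in arithmetic, the formula `E` standing for extensional
equality and the set variable `i` for the number `ρ i`. Unbounded quantifiers range over the
v-sets, and quantifiers bounded by `x` over the `n`-th conditional elements `(x n)_L` of `x`, for
the `n` such that the `n`-th condition `(x n)_R` is True. -/
def interp (E : Fm 2) : {n k : ℕ} → SFm n → (Fin n → Tm k) → Fm k
  | _, _, bot, _ => Fm.bot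
  | _, _, eq i j, ρ => E.subst ![ρ i, ρ j]
  | _, _, and φ ψ, ρ => Fm.and (φ.interp E ρ) (ψ.interp E ρ)
  | _, _, or φ ψ, ρ => Fm.or (φ.interp E ρ) (ψ.interp E ρ)
  | _, _, imp φ ψ, ρ => Fm.imp (φ.interp E ρ) (ψ.interp E ρ)
  | _, _, all φ, ρ =>
      Fm.all (Fm.imp (Fm.V (Tm.var 0)) (φ.interp E (vecCons (Tm.var 0) fun i => (ρ i).shift)))
  | _, _, ex φ, ρ =>
      Fm.ex (Fm.and (Fm.V (Tm.var 0)) (φ.interp E (vecCons (Tm.var 0) fun i => (ρ i).shift)))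
  | _, _, ball j φ, ρ =>
      Fm.all (Fm.imp (Fm.ap (ρ j).shift (Tm.var 0) (Fm.T (Tm.var 0).right))
        (Fm.ap (ρ j).shift (Tm.var 0)
          (φ.interp E (vecCons (Tm.var 0).left fun i => (ρ i).shift.shift))))
  | _, _, bex j φ, ρ =>
      Fm.ex (Fm.ap (ρ j).shift (Tm.var 0)
        (Fm.and (Fm.T (Tm.var 0).right)
          (φ.interp E (vecCons (Tm.var 0).left fun i => (ρ i).shift.shift))))

/-- The recursive characterisation of extensional equality:
`∀ x y, x = y ↔ (∀ a ∈ x, a ∈ y) ∧ (∀ b ∈ y, b ∈ x)`. -/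
def extEq : SFm 0 :=
  all (all
    (let x : Fin 2 := 1
     let y : Fin 2 := 0
     iff (eq x y) (and (ball x (mem 0 y.succ)) (ball y (mem 0 x.succ)))))

/-- Separation for `φ(x, y, p₁, …, pₙ)`, where `x` is the variable `0`, `y` is the variable `1`, and
the other variables are the parameters: `∀ p₁ … pₙ y, ∃ z, ∀ x, x ∈ z ↔ x ∈ y ∧ φ(x, y, p)`. -/
def separation {n : ℕ} (φ : SFm (n + 2)) : SFm 0 :=
  close (all (ex (all
    (let x : Fin (n + 3) := 0
     let z : Fin (n + 3) := 1
     let y : Fin (n + 3) := 2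
     iff (mem x z) (and (mem x y) (φ.rename (vecCons x fun i => i.succ.succ)))))))

end SFm

end VSet

/-! ### Syntax: substitution and derivability -/

namespace VSet

open Matrix (vecCons)

/-! ### Substitution -/

/-! The set `z` has to list elements of `y` under Meaningful conditions, but `Ξ` only yields
conditions of the form `∀ n, T(f n) → T(g n)`, so disjunctions and existential statements need not
be equivalent to Meaningful conditions. The remedy is to work with countable disjunctions `∃ r, T(h
r)`, where `h` is a total program enumerating Meaningful conditions (`Rep`, as opposed to `Cd` for a
single condition). Such formulas are plainly closed under `∨` and `∃`. They are closed under `∀ n`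
guarded by a single condition because Extended Church's Thesis turns `∀ n (φ(n) → ∃ r, T(h_n r))`
into `∃ e, ∀ n (φ(n) → T(h_n (e n)))`, and for fixed `e` the inner statement is one Meaningful
condition (`Cd.all_imp_ap`, `Rep.all_imp`). Implication is a special case, since a countable
disjunction in the antecedent becomes a universal quantifier.

Extensional equality of v-sets has this form by induction over v-sets (`ExtEq.rep`), hence so has
every bounded formula (`ExtEq.srep`). A v-set may list one element many times under different
conditions, so a countable disjunction is as good as a condition: `z` is indexed by pairs `⟨d, s⟩`,
and its member there is the `d`-th conditional element of `y` under the `s`-th disjunct of "the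
`d`-th condition of `y` is True and the element satisfies `φ`" (`ExtEq.exists_sep`). Invariance of
`φ` under extensional equality (`ExtEq.sat_iff`) passes from conditional elements to members.

For the existence of `E`, call `x` and `y` equal if some program enumerates a bisimulation relating
them. Church's Thesis chooses bisimulations uniformly, and their union is again enumerated
(`exists_sim`, `extEq_bisim`).

All this has to be derived inside the formal theory. A formula is derivable if it is true at every
node of the canonical Kripke model (`thm_of_force`), so the argument is carried out in an arbitrary
world, where connectives have their Kripke clauses and each schema may be used for properties that a
formula expresses. Numbers of a world may be nonstandard, so even arithmetic and the theory of the
universal machine are redone there by induction on formulas. -/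

theorem funext_cons {α : Type*} {n : ℕ} {f g : Fin (n + 1) → α} (h0 : f 0 = g 0)
    (hs : ∀ i : Fin n, f i.succ = g i.succ) : f = g :=
  funext fun i => Fin.cases h0 hs i

theorem map_cons {α β : Type*} {n : ℕ} (f : α → β) (a : α) (v : Fin n → α) :
    (fun i => f (vecCons a v i)) = vecCons (f a) fun i => f (v i) :=
  funext_cons rfl fun _ => rfl

namespace Tm

@[simp] theorem subst_var {n m : ℕ} (σ : Fin n → Tm m) (i : Fin n) :
    (var i).subst σ = σ i := rfl

theorem subst_app {n m k : ℕ} (σ : Fin n → Tm m) (f : PR k) (ts : Fin k → Tm n) :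
    (app f ts).subst σ = app f fun i => (ts i).subst σ := rfl

theorem subst_subst {n m k : ℕ} (σ : Fin n → Tm m) (τ : Fin m → Tm k) (t : Tm n) :
    (t.subst σ).subst τ = t.subst fun i => (σ i).subst τ := by
  induction t with
  | var i => rfl
  | app f ts ih => simp [subst_app, ih]

@[simp] theorem subst_id {n : ℕ} (t : Tm n) : t.subst var = t := by
  induction t with
  | var i => rfl
  | app f ts ih => simp [subst_app, ih]

theorem shift_subst {n m : ℕ} (σ : Fin (n + 1) → Tm m) (t : Tm n) :
    t.shift.subst σ = t.subst fun i => σ i.succ := by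
  simp [shift, subst_subst]

theorem subst_shift {n m : ℕ} (σ : Fin n → Tm m) (t : Tm n) :
    (t.subst σ).shift = t.subst fun i => (σ i).shift := by
  simp [shift, subst_subst]

@[simp] theorem shift_var {n : ℕ} (i : Fin n) : (var i).shift = var i.succ := rfl

@[simp] theorem up_zero {n m : ℕ} (σ : Fin n → Tm m) : up σ 0 = var 0 := rfl
@[simp] theorem up_one {n m : ℕ} (σ : Fin (n + 1) → Tm m) : up σ 1 = (σ 0).shift := rfl
@[simp] theorem up_two {n m : ℕ} (σ : Fin (n + 2) → Tm m) : up σ 2 = (σ 1).shift := rfl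
@[simp] theorem up_succ {n m : ℕ} (σ : Fin n → Tm m) (i : Fin n) :
    up σ i.succ = (σ i).shift := rfl

theorem up_subst {n m k : ℕ} (σ : Fin n → Tm m) (τ : Fin m → Tm k) :
    (fun i => (up σ i).subst (up τ)) = up fun i => (σ i).subst τ :=
  funext_cons rfl fun i => by simp [shift_subst, subst_shift]

@[simp] theorem up_var {n : ℕ} : up (var : Fin n → Tm n) = var :=
  funext_cons rfl fun _ => rfl

end Tm

namespace Fm

open Tm (var up)

theorem subst_subst {n : ℕ} (φ : Fm n) : ∀ {m k : ℕ} (σ : Fin n → Tm m) (τ : Fin m → Tm k),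
    (φ.subst σ).subst τ = φ.subst fun i => (σ i).subst τ := by
  induction φ <;> intro m k σ τ <;> simp_all [subst, Tm.subst_subst, Tm.up_subst]

@[simp] theorem subst_id {n : ℕ} (φ : Fm n) : φ.subst var = φ := by
  induction φ <;> simp_all [subst]

/-- Renaming of variables. -/
def ren {n m : ℕ} (r : Fin n → Fin m) (φ : Fm n) : Fm m := φ.subst fun i => var (r i)

theorem shift_subst {n m : ℕ} (σ : Fin (n + 1) → Tm m) (φ : Fm n) :
    φ.shift.subst σ = φ.subst fun i => σ i.succ := by
  simp [shift, subst_subst]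

theorem subst_shift {n m : ℕ} (σ : Fin n → Tm m) (φ : Fm n) :
    (φ.subst σ).shift = φ.subst fun i => (σ i).shift := by
  simp [shift, subst_subst]; rfl

theorem shift_up {n m : ℕ} (σ : Fin n → Tm m) (φ : Fm n) :
    φ.shift.subst (up σ) = (φ.subst σ).shift := by
  simp [shift_subst, subst_shift]

theorem inst_subst {n m : ℕ} (σ : Fin n → Tm m) (φ : Fm (n + 1)) (t : Tm n) :
    (φ.inst t).subst σ = (φ.subst (up σ)).inst (t.subst σ) := by
  simp only [inst, subst_subst]
  congr 1
  exact funext_cons rfl fun i => by simp [Tm.shift_subst]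

theorem subst_up_inst {n m : ℕ} (σ : Fin n → Tm m) (φ : Fm (n + 1)) (t : Tm m) :
    (φ.subst (up σ)).inst t = φ.subst (vecCons t σ) := by
  simp only [inst, subst_subst]
  congr 1
  exact funext_cons rfl fun i => by simp [Tm.shift_subst]

theorem QF.subst {n : ℕ} {φ : Fm n} (h : QF φ) :
    ∀ {m : ℕ} (σ : Fin n → Tm m), QF (φ.subst σ) := by
  induction h <;> intro m σ <;> simp only [Fm.subst] <;> constructor <;> apply_assumption

theorem Sigma1.subst {n : ℕ} {φ : Fm n} (h : Sigma1 φ) :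
    ∀ {m : ℕ} (σ : Fin n → Tm m), Sigma1 (φ.subst σ) := by
  induction h with
  | qf h => exact fun σ => .qf (h.subst σ)
  | ex _ ih => exact fun σ => .ex (ih _)

theorem AlmostNegative.subst {n : ℕ} {φ : Fm n} (h : AlmostNegative φ) :
    ∀ {m : ℕ} (σ : Fin n → Tm m), AlmostNegative (φ.subst σ) := by
  induction h with
  | sigma1 h => exact fun σ => .sigma1 (h.subst σ)
  | V t => exact fun σ => .V _
  | M t => exact fun σ => .M _
  | T t => exact fun σ => .T _
  | and _ _ h1 h2 => exact fun σ => .and (h1 σ) (h2 σ)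
  | imp _ _ h1 h2 => exact fun σ => .imp (h1 σ) (h2 σ)
  | all _ h => exact fun σ => .all (h _)

end Fm

namespace Tm

section
variable {n m : ℕ} (σ : Fin n → Tm m)

@[simp] theorem subst_app₀ (f : PR 0) : (app f ![]).subst σ = app f ![] :=
  congrArg (app f) (Subsingleton.elim _ _)

@[simp] theorem subst_app₁ (f : PR 1) (a : Tm n) :
    (app f ![a]).subst σ = app f ![a.subst σ] := by
  rw [subst_app, map_cons]; congr; exact Subsingleton.elim _ _

@[simp] theorem subst_app₂ (f : PR 2) (a b : Tm n) :
    (app f ![a, b]).subst σ = app f ![a.subst σ, b.subst σ] := by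
  rw [subst_app, map_cons, map_cons]; congr; exact Subsingleton.elim _ _

@[simp] theorem subst_zero : (zero : Tm n).subst σ = zero := subst_app₀ σ _
@[simp] theorem subst_succ (a : Tm n) : a.succ.subst σ = (a.subst σ).succ := subst_app₁ σ _ _
@[simp] theorem subst_left (a : Tm n) : a.left.subst σ = (a.subst σ).left := subst_app₁ σ _ _
@[simp] theorem subst_right (a : Tm n) : a.right.subst σ = (a.subst σ).right := subst_app₁ σ _ _
@[simp] theorem subst_out (a : Tm n) : a.out.subst σ = (a.subst σ).out := subst_app₁ σ _ _
@[simp] theorem subst_pair (a b : Tm n) : (a.pair b).subst σ = (a.subst σ).pair (b.subst σ) :=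
  subst_app₂ σ _ _ _

end

end Tm

namespace Fm

open Tm (var up)

section
variable {n m : ℕ} (σ : Fin n → Tm m)

theorem subst_kleene (e i o : Tm n) :
    (kleene e i o).subst σ = kleene (e.subst σ) (i.subst σ) (o.subst σ) := by
  simp [kleene, subst]

theorem subst_ap (e i : Tm n) (P : Fm (n + 1)) :
    (ap e i P).subst σ = ap (e.subst σ) (i.subst σ) (P.subst (up σ)) := by
  simp only [ap, subst, subst_kleene, Tm.shift_subst, Tm.subst_shift, subst_subst, Tm.up_succ,
    Tm.subst_var, Tm.up_zero]
  congr 3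
  exact funext_cons (by simp) fun i => by simp [Tm.shift_subst]; rfl

theorem subst_defd (e i : Tm n) :
    (defd e i).subst σ = defd (e.subst σ) (i.subst σ) := by
  simp [defd, subst, subst_kleene, Tm.shift_subst, Tm.subst_shift]

theorem subst_closed (x : Tm n) (P : Fm (n + 1)) :
    (closed x P).subst σ = closed (x.subst σ) (P.subst (up σ)) := by
  simp only [closed, subst, subst_ap, Tm.shift_subst, Tm.subst_shift, subst_subst, Tm.up_succ,
    Tm.subst_var, Tm.up_zero, Tm.subst_right]
  congr 5
  exact funext_cons (by simp) fun i => by simp [Tm.shift, Tm.subst_subst]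

end

end Fm

-- Each axiom is stated in every context, so an instance of an instance is an instance. For Church's
-- Thesis this also needs that substitution preserves almost-negative formulas.
open Tm (var up) in
theorem Axm.subst {Ξ : PR 2} {n : ℕ} {φ : Fm n} (h : Axm Ξ φ) {m : ℕ} (σ : Fin n → Tm m) :
    Axm Ξ (φ.subst σ) := by
  cases h with
  | proj i ts => exact .proj i _
  | comp f g ts => exact .comp f g _
  | prec_zero f g ts =>
    simp only [Fm.subst, Tm.subst_app, map_cons, Tm.subst_zero]
    exact .prec_zero f g _
  | prec_succ f g t ts =>
    simp only [Fm.subst, Tm.subst_app, map_cons, Tm.subst_succ]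
    exact .prec_succ f g _ _
  | succ_ne_zero t =>
    simp only [Fm.subst, Tm.subst_succ, Tm.subst_zero]
    exact .succ_ne_zero _
  | succ_inj s t =>
    simp only [Fm.subst, Tm.subst_succ]
    exact .succ_inj _ _
  | induction φ =>
    convert Axm.induction (Ξ := Ξ) (φ.subst (up σ)) using 1
    simp only [Fm.induction, Fm.subst, Fm.inst_subst, Tm.subst_zero, Fm.subst_subst]
    congr 5
    exact funext_cons (by simp) fun i => by simp [Tm.shift_subst]; rfl
  | ect φ ψ hφ =>
    convert Axm.ect (Ξ := Ξ) (φ.subst (up σ)) (ψ.subst (up (up σ))) (hφ.subst _) using 1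
    simp only [Fm.ect, Fm.subst, Fm.subst_subst, Fm.subst_ap]
    congr 5
    · exact funext_cons (by simp) fun i => by simp [Tm.shift, Tm.subst_subst]
    · congr 1
      refine funext_cons (by simp) (Fin.cases (by simp) fun i => ?_)
      simp [Tm.shift, Tm.subst_subst]
  | vIntro =>
    convert Axm.vIntro (Ξ := Ξ) (n := m) using 1
    simp [Fm.vIntro, Fm.subst, Fm.subst_closed]
  | vInd φ =>
    convert Axm.vInd (Ξ := Ξ) (φ.subst (up σ)) using 1
    simp only [Fm.vInd, Fm.subst, Fm.subst_closed, Fm.subst_subst, Tm.subst_var, Tm.up_zero]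
    congr 5
    exact funext_cons (by simp) fun i => by simp [Tm.shift, Tm.subst_subst]
  | xiTrue =>
    convert Axm.xiTrue (Ξ := Ξ) (n := m) using 1
    simp [Fm.xiTrue, Fm.subst, Fm.subst_ap, Fm.iff]
  | xiMeaningful =>
    convert Axm.xiMeaningful (Ξ := Ξ) (n := m) using 1
    simp [Fm.xiMeaningful, Fm.subst, Fm.subst_ap, Fm.subst_defd]

end VSet

namespace VSet

open Matrix (vecCons)

/-! ### Derivations -/

namespace Prv

open Tm (var up)
open Fm (shift)

variable {Ξ : PR 2}

theorem map_shift_subst {n m : ℕ} (σ : Fin n → Tm m) (Γ : List (Fm n)) :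
    (Γ.map shift).map (Fm.subst (up σ)) = (Γ.map (Fm.subst σ)).map shift := by
  simp [Function.comp_def, Fm.shift_up]

theorem subst {n : ℕ} {Γ : List (Fm n)} {φ : Fm n} (h : Prv Ξ Γ φ) :
    ∀ {m : ℕ} (σ : Fin n → Tm m), Prv Ξ (Γ.map (Fm.subst σ)) (φ.subst σ) := by
  induction h with
  | axm h => exact fun σ => axm (h.subst σ)
  | hyp h => exact fun σ => hyp (List.mem_map_of_mem h)
  | bot_elim _ ih => exact fun σ => bot_elim (ih σ)
  | and_intro _ _ h1 h2 => exact fun σ => and_intro (h1 σ) (h2 σ)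
  | and_left _ ih => exact fun σ => and_left (ih σ)
  | and_right _ ih => exact fun σ => and_right (ih σ)
  | or_left _ ih => exact fun σ => or_left (ih σ)
  | or_right _ ih => exact fun σ => or_right (ih σ)
  | or_elim _ _ _ h1 h2 h3 => exact fun σ => or_elim (h1 σ) (h2 σ) (h3 σ)
  | imp_intro _ ih => exact fun σ => imp_intro (ih σ)
  | imp_elim _ _ h1 h2 => exact fun σ => imp_elim (h1 σ) (h2 σ)
  | all_intro _ ih =>
    intro m σ
    have := ih (up σ)
    rw [map_shift_subst] at this
    exact all_intro this
  | all_elim t _ ih =>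
    intro m σ
    rw [Fm.inst_subst]
    exact all_elim _ (ih σ)
  | ex_intro t _ ih =>
    intro m σ
    have := ih σ
    rw [Fm.inst_subst] at this
    exact ex_intro _ this
  | ex_elim _ _ h1 h2 =>
    intro m σ
    have := h2 (up σ)
    rw [List.map_cons, map_shift_subst, Fm.shift_up] at this
    exact ex_elim (h1 σ) this
  | eq_refl t => exact fun σ => eq_refl _
  | eq_subst φ _ _ h1 h2 =>
    intro m σ
    have := h2 σ
    rw [Fm.inst_subst] at this ⊢
    exact eq_subst _ (h1 σ) this

theorem weaken {n : ℕ} {Γ : List (Fm n)} {φ : Fm n} (h : Prv Ξ Γ φ) :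
    ∀ {Δ : List (Fm n)}, Γ ⊆ Δ → Prv Ξ Δ φ := by
  induction h with
  | axm h => exact fun _ => axm h
  | hyp h => exact fun s => hyp (s h)
  | bot_elim _ ih => exact fun s => bot_elim (ih s)
  | and_intro _ _ h1 h2 => exact fun s => and_intro (h1 s) (h2 s)
  | and_left _ ih => exact fun s => and_left (ih s)
  | and_right _ ih => exact fun s => and_right (ih s)
  | or_left _ ih => exact fun s => or_left (ih s)
  | or_right _ ih => exact fun s => or_right (ih s)
  | or_elim _ _ _ h1 h2 h3 =>
    exact fun s => or_elim (h1 s) (h2 (List.cons_subset_cons _ s)) (h3 (List.cons_subset_cons _ s))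
  | imp_intro _ ih => exact fun s => imp_intro (ih (List.cons_subset_cons _ s))
  | imp_elim _ _ h1 h2 => exact fun s => imp_elim (h1 s) (h2 s)
  | all_intro _ ih => exact fun s => all_intro (ih (List.map_subset _ s))
  | all_elim t _ ih => exact fun s => all_elim _ (ih s)
  | ex_intro t _ ih => exact fun s => ex_intro _ (ih s)
  | ex_elim _ _ h1 h2 =>
    exact fun s => ex_elim (h1 s) (h2 (List.cons_subset_cons _ (List.map_subset _ s)))
  | eq_refl t => exact fun _ => eq_refl _
  | eq_subst φ _ _ h1 h2 => exact fun s => eq_subst _ (h1 s) (h2 s)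

theorem of_nil {n : ℕ} {Γ : List (Fm n)} {φ : Fm n} (h : Prv Ξ [] φ) : Prv Ξ Γ φ :=
  h.weaken (List.nil_subset _)

theorem cons {n : ℕ} {Γ : List (Fm n)} {φ ψ : Fm n} (h : Prv Ξ Γ φ) : Prv Ξ (ψ :: Γ) φ :=
  h.weaken (List.subset_cons_self _ _)

theorem cut {n : ℕ} {Δ : List (Fm n)} {φ : Fm n} :
    ∀ {Γ : List (Fm n)} (_ : Prv Ξ Γ φ) (_ : ∀ γ ∈ Γ, Prv Ξ Δ γ), Prv Ξ Δ φ
  | [], h, _ => h.of_nil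
  | γ :: Γ, h, H =>
    imp_elim (cut (imp_intro h) fun _ hδ => H _ (List.mem_cons_of_mem _ hδ)) (H γ List.mem_cons_self)

theorem hyp_zero {n : ℕ} {Γ : List (Fm n)} {φ : Fm n} : Prv Ξ (φ :: Γ) φ := hyp (by simp)

theorem eq_subst' {n : ℕ} {Γ : List (Fm n)} {s t : Tm n} (φ : Fm (n + 1)) {ψ χ : Fm n}
    (h : Prv Ξ Γ (Fm.eq s t)) (hψ : φ.inst s = ψ) (hχ : φ.inst t = χ) (h' : Prv Ξ Γ ψ) :
    Prv Ξ Γ χ := by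
  subst hψ hχ
  exact eq_subst φ h h'

theorem eq_symm {n : ℕ} {Γ : List (Fm n)} {s t : Tm n} (h : Prv Ξ Γ (Fm.eq s t)) :
    Prv Ξ Γ (Fm.eq t s) :=
  eq_subst' (Fm.eq (var 0) s.shift) h (by simp [Fm.inst, Fm.subst, Tm.shift_subst])
    (by simp [Fm.inst, Fm.subst, Tm.shift_subst]) (eq_refl s)

theorem eq_trans {n : ℕ} {Γ : List (Fm n)} {s t u : Tm n} (h : Prv Ξ Γ (Fm.eq s t))
    (h' : Prv Ξ Γ (Fm.eq t u)) : Prv Ξ Γ (Fm.eq s u) :=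
  eq_subst' (Fm.eq s.shift (var 0)) h' (by simp [Fm.inst, Fm.subst, Tm.shift_subst])
    (by simp [Fm.inst, Fm.subst, Tm.shift_subst]) h

/-- Leibniz's law for simultaneous substitution. The rule `eq_subst` handles one variable, so the
variables are exchanged one after the other. -/
theorem subst_congr {n m : ℕ} {Γ : List (Fm m)} {σ τ : Fin n → Tm m}
    (h : ∀ i, Prv Ξ Γ (Fm.eq (σ i) (τ i))) (φ : Fm n) (h' : Prv Ξ Γ (φ.subst σ)) :
    Prv Ξ Γ (φ.subst τ) := by
  -- Interpolating substitutions: the first `k` variables are already sent to `τ`, the others still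
  -- to `σ`.
  suffices H : ∀ k ≤ n, Prv Ξ Γ (φ.subst fun i => if i.1 < k then τ i else σ i) by
    simpa using H n le_rfl
  intro k
  induction k with
  | zero => simpa using h'
  | succ k ih =>
    intro hk
    refine eq_subst' (φ.subst fun i => if i.1 = k then var 0 else
      (if i.1 < k then τ i else σ i).shift) (h ⟨k, hk⟩) ?_ ?_ (ih (Nat.le_of_succ_le hk))
    all_goals
      rw [Fm.inst, Fm.subst_subst]
      congr 1
      funext i
      rcases lt_trichotomy i.1 k with hi | hi | hi
      · simp [hi, hi.ne, Tm.shift_subst, hi.trans (Nat.lt_succ_self k)]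
      · obtain ⟨i, _⟩ := i
        subst hi
        simp
      · simp [hi.ne', hi.not_gt, Tm.shift_subst, Nat.not_lt.2 (Nat.succ_le_of_lt hi)]

theorem of_all_shift {n : ℕ} {Γ : List (Fm (n + 1))} {φ : Fm (n + 1)}
    (h : (Fm.all φ).shift ∈ Γ) : Prv Ξ Γ φ := by
  have := all_elim (var 0) (hyp (Ξ := Ξ) h)
  rwa [Fm.subst_up_inst, show vecCons (var 0) (fun i : Fin n => var i.succ) = var from
    funext_cons rfl fun _ => rfl, Fm.subst_id] at this

theorem all_imp {n : ℕ} (φ : Fm n) (ψ : Fm (n + 1)) :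
    Prv Ξ [.all (φ.shift.imp ψ)] (φ.imp (.all ψ)) :=
  imp_intro (all_intro (imp_elim (φ := φ.shift) (of_all_shift (by simp)) (hyp (by simp))))

theorem all_imp_of_ex {n : ℕ} (φ : Fm (n + 1)) (ψ : Fm n) :
    Prv Ξ [.all (φ.imp ψ.shift), .ex φ] ψ :=
  ex_elim (φ := φ) (hyp (by simp)) (imp_elim (of_all_shift (by simp)) hyp_zero)

end Prv

end VSet

/-! ### Completeness for the canonical Kripke model -/

namespace VSet

open Matrix (vecCons)

/-! ### Formulas are countable -/

open Encodable (encode)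

def PR.code : {k : ℕ} → PR k → ℕ
  | _, .zero => Nat.pair 0 0
  | _, .succ => Nat.pair 1 0
  | _, .proj i => Nat.pair 2 i
  | _, .comp (m := m) f g =>
    Nat.pair 3 (Nat.pair m (Nat.pair f.code (encode (List.ofFn fun i => (g i).code))))
  | _, .prec f g => Nat.pair 4 (Nat.pair f.code g.code)

theorem PR.code_inj {k : ℕ} (f g : PR k) (h : f.code = g.code) : f = g := by
  induction f with
  | zero => cases g <;> simp_all [code, Nat.pair_eq_pair]
  | succ => cases g <;> simp_all [code, Nat.pair_eq_pair]
  | proj i => cases g <;> simp_all [code, Nat.pair_eq_pair, Fin.ext_iff]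
  | comp f g ih1 ih2 =>
    cases g <;> simp only [code, Nat.pair_eq_pair] at h <;> try omega
    obtain ⟨-, h1, h2, h3⟩ := h
    subst h1
    have h3 := List.ofFn_injective (Encodable.encode_injective h3)
    rw [ih1 _ h2, funext fun i => ih2 i _ (congrFun h3 i)]
  | prec f g ih1 ih2 =>
    cases g <;> simp only [code, Nat.pair_eq_pair] at h <;> try omega
    rw [ih1 _ h.2.1, ih2 _ h.2.2]

def Tm.code {n : ℕ} : Tm n → ℕ
  | var i => Nat.pair 0 i
  | app (k := k) f ts => Nat.pair 1 (Nat.pair k (Nat.pair f.code (encode (List.ofFn fun i => (ts i).code))))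

theorem Tm.code_inj {n : ℕ} (s t : Tm n) (h : s.code = t.code) : s = t := by
  induction s generalizing t with
  | var i => cases t <;> simp_all [code, Nat.pair_eq_pair, Fin.ext_iff]
  | app f ts ih =>
    cases t <;> simp only [code, Nat.pair_eq_pair] at h <;> try omega
    obtain ⟨-, h1, h2, h3⟩ := h
    subst h1
    have h3 := List.ofFn_injective (Encodable.encode_injective h3)
    rw [PR.code_inj _ _ h2, funext fun i => ih i _ (congrFun h3 i)]

def Fm.code : {n : ℕ} → Fm n → ℕ
  | _, bot => Nat.pair 0 0
  | _, eq s t => Nat.pair 1 (Nat.pair s.code t.code)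
  | _, V t => Nat.pair 2 t.code
  | _, M t => Nat.pair 3 t.code
  | _, T t => Nat.pair 4 t.code
  | _, and φ ψ => Nat.pair 5 (Nat.pair φ.code ψ.code)
  | _, or φ ψ => Nat.pair 6 (Nat.pair φ.code ψ.code)
  | _, imp φ ψ => Nat.pair 7 (Nat.pair φ.code ψ.code)
  | _, all φ => Nat.pair 8 φ.code
  | _, ex φ => Nat.pair 9 φ.code

theorem Fm.code_inj {n : ℕ} (φ ψ : Fm n) (h : φ.code = ψ.code) : φ = ψ := by
  induction φ with
  | bot => cases ψ <;> simp_all [code, Nat.pair_eq_pair]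
  | eq s t =>
    cases ψ <;> simp only [code, Nat.pair_eq_pair] at h <;> try omega
    rw [Tm.code_inj _ _ h.2.1, Tm.code_inj _ _ h.2.2]
  | V t | M t | T t =>
    cases ψ <;> simp only [code, Nat.pair_eq_pair] at h <;> try omega
    rw [Tm.code_inj _ _ h.2]
  | and _ _ h1 h2 | or _ _ h1 h2 | imp _ _ h1 h2 =>
    cases ψ <;> simp only [code, Nat.pair_eq_pair] at h <;> try omega
    rw [h1 _ h.2.1, h2 _ h.2.2]
  | all _ ih | ex _ ih =>
    cases ψ <;> simp only [code, Nat.pair_eq_pair] at h <;> try omega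
    rw [ih _ h.2]

/-- Lets the construction of saturated theories treat all formulas with names in one sequence. -/
instance {n : ℕ} : Countable (Fm n) :=
  (Function.Injective.countable (f := Fm.code) fun φ ψ => Fm.code_inj φ ψ)

/-! ### Theories -/

open Tm (var up)

variable {Ξ : PR 2}

/-- A set of formulas whose free variables are replaced by names (natural numbers), closed under
derivations. -/
structure Theory (Ξ : PR 2) where
  mem : {n : ℕ} → Fm n → (Fin n → ℕ) → Prop
  closed {n : ℕ} {Γ : List (Fm n)} {φ : Fm n} {ρ : Fin n → ℕ} :
    Prv Ξ Γ φ → (∀ γ ∈ Γ, mem γ ρ) → mem φ ρ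
  ren {n m : ℕ} {r : Fin n → Fin m} {φ : Fm n} {ρ : Fin m → ℕ} :
    mem (φ.ren r) ρ ↔ mem φ fun i => ρ (r i)

theorem Fm.ren_ren {n m k : ℕ} (r : Fin n → Fin m) (s : Fin m → Fin k) (φ : Fm n) :
    (φ.ren r).ren s = φ.ren fun i => s (r i) := by
  simp [ren, subst_subst]

theorem Fm.shift_eq_ren {n : ℕ} (φ : Fm n) : φ.shift = φ.ren Fin.succ := rfl

theorem Fm.ren_all {n m : ℕ} (r : Fin n → Fin m) (φ : Fm (n + 1)) :
    (all φ).ren r = all (φ.ren (vecCons 0 fun i => (r i).succ)) := by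
  simp only [ren, subst]
  congr 2
  exact funext_cons rfl fun i => by simp

theorem Fm.ren_ex {n m : ℕ} (r : Fin n → Fin m) (φ : Fm (n + 1)) :
    (ex φ).ren r = ex (φ.ren (vecCons 0 fun i => (r i).succ)) := by
  simp only [ren, subst]
  congr 2
  exact funext_cons rfl fun i => by simp

namespace Theory

variable (Θ : Theory Ξ)

instance : LE (Theory Ξ) := ⟨fun Θ Θ' => ∀ ⦃n⦄ (φ : Fm n) ρ, Θ.mem φ ρ → Θ'.mem φ ρ⟩

theorem of_prv {n : ℕ} {φ : Fm n} {ρ : Fin n → ℕ} (h : Prv Ξ [] φ) : Θ.mem φ ρ :=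
  Θ.closed h (by simp)

theorem mem_of {n : ℕ} {φ ψ : Fm n} {ρ : Fin n → ℕ} (h : Prv Ξ [φ] ψ) (h' : Θ.mem φ ρ) :
    Θ.mem ψ ρ :=
  Θ.closed h (by simpa)

theorem mem_of₂ {n : ℕ} {φ φ' ψ : Fm n} {ρ : Fin n → ℕ} (h : Prv Ξ [φ, φ'] ψ) (h1 : Θ.mem φ ρ)
    (h2 : Θ.mem φ' ρ) : Θ.mem ψ ρ :=
  Θ.closed h (by simp [h1, h2])

theorem mp {n : ℕ} {φ ψ : Fm n} {ρ : Fin n → ℕ} (h1 : Θ.mem (φ.imp ψ) ρ)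
    (h2 : Θ.mem φ ρ) : Θ.mem ψ ρ :=
  Θ.mem_of₂ (.imp_elim .hyp_zero (.hyp (by simp))) h1 h2

/-- The theory generated by `Θ` and the formula `φ`. -/
def add {m : ℕ} (φ : Fm m) (s : Fin m → ℕ) : Theory Ξ where
  mem {n} ψ ρ := Θ.mem ((φ.ren (Fin.castAdd n)).imp (ψ.ren (Fin.natAdd m))) (Fin.append s ρ)
  closed {n Γ ψ ρ} h h' := by
    refine Θ.closed (Γ := Γ.map fun γ => (φ.ren (Fin.castAdd n)).imp (γ.ren (Fin.natAdd m))) ?_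
      (by simpa using h')
    refine .imp_intro (Prv.cut (h.subst _) ?_)
    simp only [List.mem_map, forall_exists_index, and_imp, forall_apply_eq_imp_iff₂]
    exact fun γ hγ => .imp_elim (.hyp (List.mem_cons_of_mem _ (List.mem_map.2 ⟨γ, hγ, rfl⟩)))
      .hyp_zero
  ren {n k r ψ ρ} := by
    have : Fin.append s (fun i => ρ (r i)) = fun i => Fin.append s ρ
        (Fin.addCases (Fin.castAdd k) (fun i => Fin.natAdd m (r i)) i) := by
      funext i
      refine Fin.addCases (fun i => ?_) (fun i => ?_) i <;> simp
    rw [this, ← Θ.ren (r := Fin.addCases (Fin.castAdd k) fun i => Fin.natAdd m (r i))]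
    simp only [Fm.ren, Fm.subst, Fm.subst_subst]
    simp

/-- The definition of `add` keeps the variables of `φ` and `ψ` apart. By invariance under renaming,
any common context in which they may share variables does as well. -/
theorem add_iff {m n k : ℕ} {φ : Fm m} {ψ : Fm n} (r1 : Fin m → Fin k) (r2 : Fin n → Fin k)
    (ρ : Fin k → ℕ) : (Θ.add φ fun i => ρ (r1 i)).mem ψ (fun i => ρ (r2 i)) ↔
      Θ.mem ((φ.ren r1).imp (ψ.ren r2)) ρ := by
  have : (Fin.append (fun i => ρ (r1 i)) fun i => ρ (r2 i)) = fun i => ρ (Fin.addCases r1 r2 i) := by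
    funext i
    refine Fin.addCases (fun i => ?_) (fun i => ?_) i <;> simp
  simp only [add, this]
  rw [← Θ.ren (r := Fin.addCases r1 r2)]
  simp only [Fm.ren, Fm.subst, Fm.subst_subst]
  simp

theorem add_iff' {m : ℕ} {φ ψ : Fm m} {ρ : Fin m → ℕ} :
    (Θ.add φ ρ).mem ψ ρ ↔ Θ.mem (φ.imp ψ) ρ := by
  have := Θ.add_iff (φ := φ) (ψ := ψ) id id ρ
  simpa [Fm.ren] using this

theorem le_add {m : ℕ} (φ : Fm m) (ρ : Fin m → ℕ) : Θ ≤ Θ.add φ ρ := fun _ _ _ h =>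
  Θ.mem_of (.imp_intro (Prv.hyp_zero.cons)) (Θ.ren.2 (by simpa using h))

theorem add_self {m : ℕ} (φ : Fm m) (ρ : Fin m → ℕ) : (Θ.add φ ρ).mem φ ρ :=
  Θ.add_iff'.2 (Θ.of_prv (.imp_intro .hyp_zero))

/-- The name `c` is generic if nothing particular is known about it. -/
def Generic (c : ℕ) : Prop :=
  ∀ ⦃n : ℕ⦄ (φ : Fm (n + 1)) (ρ : Fin n → ℕ), (∀ i, ρ i ≠ c) → Θ.mem φ (vecCons c ρ) →
    Θ.mem (.all φ) ρ

variable {Θ}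

/-- If the antecedent does not mention `c`, the quantifier over `c` can be moved past it
(`Prv.all_imp`). -/
theorem Generic.add {c : ℕ} (h : Θ.Generic c) {m : ℕ} (φ : Fm m) (s : Fin m → ℕ)
    (hs : ∀ i, s i ≠ c) : (Θ.add φ s).Generic c := by
  intro n ψ ρ hρ hψ
  have := (Θ.add_iff (φ := φ) (ψ := ψ) (fun i => (Fin.castAdd n i).succ)
    (vecCons 0 fun i => (Fin.natAdd m i).succ) (vecCons c (Fin.append s ρ))).1 (by
      convert hψ using 1
      · congr 1; funext i; simp
      · exact funext_cons rfl fun i => by simp)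
  suffices H : Θ.mem ((φ.ren (Fin.castAdd n)).imp (.all (ψ.ren (vecCons 0 fun i =>
      (Fin.natAdd m i).succ)))) (Fin.append s ρ) by
    rwa [← Fm.ren_all] at H
  refine Θ.mem_of (Prv.all_imp _ _) ?_
  simp only [Fm.shift_eq_ren, Fm.ren_ren]
  refine h _ _ (fun i => ?_) this
  refine Fin.addCases (fun i => ?_) (fun i => ?_) i <;> simp [hs, hρ]

/-- Henkin witnesses are conservative. With `c` generic and absent from `s` and `ρ`, membership of
`φ(c) → χ` gives `∀ x (φ(x) → χ)`, and `∃ x φ(x)` is already present. -/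
theorem Generic.add_witness {c : ℕ} (h : Θ.Generic c) {m n : ℕ} {φ : Fm (m + 1)} {s : Fin m → ℕ}
    (hs : ∀ i, s i ≠ c) (hφ : Θ.mem (.ex φ) s) {χ : Fm n} {ρ : Fin n → ℕ} (hρ : ∀ i, ρ i ≠ c)
    (hχ : (Θ.add φ (vecCons c s)).mem χ ρ) : Θ.mem χ ρ := by
  have := (Θ.add_iff (φ := φ) (ψ := χ) (vecCons 0 fun i => (Fin.castAdd n i).succ)
    (fun i => (Fin.natAdd m i).succ) (vecCons c (Fin.append s ρ))).1 (by
      convert hχ using 1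
      · congr 1; exact funext_cons rfl fun i => by simp
      · funext i; simp)
  have h1 : Θ.mem (χ.ren (Fin.natAdd m)) (Fin.append s ρ) := by
    refine Θ.mem_of₂ (Prv.all_imp_of_ex (φ.ren (vecCons 0 fun i => (Fin.castAdd n i).succ)) _) ?_ ?_
    · simp only [Fm.shift_eq_ren, Fm.ren_ren]
      refine h _ _ (fun i => ?_) this
      refine Fin.addCases (fun i => ?_) (fun i => ?_) i <;> simp [hs, hρ]
    · rw [← Fm.ren_ex, Θ.ren]
      simpa
  simpa using Θ.ren.1 h1

end Theory

/-! ### Saturated extensions -/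

namespace Theory

variable {Θ Θ' : Theory Ξ}

theorem le_refl (Θ : Theory Ξ) : Θ ≤ Θ := fun _ _ _ h => h

theorem le_trans {Θ₁ Θ₂ Θ₃ : Theory Ξ} (h : Θ₁ ≤ Θ₂) (h' : Θ₂ ≤ Θ₃) : Θ₁ ≤ Θ₃ :=
  fun _ _ _ H => h' _ _ (h _ _ H)

theorem add_mono (h : Θ ≤ Θ') {m : ℕ} (φ : Fm m) (s : Fin m → ℕ) : Θ.add φ s ≤ Θ'.add φ s :=
  fun _ _ _ H => h _ _ H

theorem mem_of_add {m n : ℕ} {φ : Fm m} {s : Fin m → ℕ} {χ : Fm n} {ρ : Fin n → ℕ}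
    (h : (Θ.add φ s).mem χ ρ) (h' : Θ.mem φ s) : Θ.mem χ ρ := by
  have := Θ.ren.1 (Θ.mp h (Θ.ren.2 (by simpa using h')))
  simpa using this

theorem mem_of_add_or {m n : ℕ} {φ ψ : Fm m} {s : Fin m → ℕ} {χ : Fm n} {ρ : Fin n → ℕ}
    (h : (Θ.add φ s).mem χ ρ) (h' : (Θ.add ψ s).mem χ ρ) (H : Θ.mem (φ.or ψ) s) :
    Θ.mem χ ρ := by
  refine mem_of_add (φ := φ.or ψ) (s := s) (Θ.mem_of₂ (φ := (φ.ren (Fin.castAdd n)).imp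
    (χ.ren (Fin.natAdd m))) ?_ h h') H
  exact .imp_intro (.or_elim .hyp_zero (.imp_elim (.hyp (by simp [Fm.ren])) .hyp_zero)
    (.imp_elim (.hyp (by simp [Fm.ren])) .hyp_zero))

/-- The union of an increasing sequence of theories. -/
def iUnion (f : ℕ → Theory Ξ) (hf : ∀ ⦃i j⦄, i ≤ j → f i ≤ f j) : Theory Ξ where
  mem φ ρ := ∃ i, (f i).mem φ ρ
  closed {n Γ φ ρ} h h' := by
    suffices ∃ i, ∀ γ ∈ Γ, (f i).mem γ ρ from this.imp fun i hi => (f i).closed h hi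
    clear h
    induction Γ with
    | nil => simp
    | cons γ Γ ih =>
      obtain ⟨i, hi⟩ := ih fun γ hγ => h' γ (List.mem_cons_of_mem _ hγ)
      obtain ⟨j, hj⟩ := h' γ List.mem_cons_self
      refine ⟨max i j, fun δ hδ => ?_⟩
      rcases List.mem_cons.1 hδ with rfl | hδ
      · exact hf (le_max_right _ _) _ _ hj
      · exact hf (le_max_left _ _) _ _ (hi _ hδ)
  ren := exists_congr fun i => (f i).ren

/-- `Θ` is prime and has witnesses, as far as names outside of `G` are concerned. -/
structure Saturated (Θ : Theory Ξ) (G : Set ℕ) : Prop where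
  prime {n : ℕ} {φ ψ : Fm n} {ρ : Fin n → ℕ} : (∀ i, ρ i ∉ G) → Θ.mem (φ.or ψ) ρ →
    Θ.mem φ ρ ∨ Θ.mem ψ ρ
  witness {n : ℕ} {φ : Fm (n + 1)} {ρ : Fin n → ℕ} : (∀ i, ρ i ∉ G) → Θ.mem (.ex φ) ρ →
    ∃ c ∉ G, Θ.mem φ (vecCons c ρ)

theorem _root_.Set.Infinite.exists_split {G : Set ℕ} (hG : G.Infinite) :
    ∃ G₁ G₂ : Set ℕ, G₁ ⊆ G ∧ G₂ ⊆ G ∧ G₁.Infinite ∧ G₂.Infinite ∧ Disjoint G₁ G₂ := by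
  have e := hG.natEmbedding
  refine ⟨Set.range fun n => (e (2 * n)).1, Set.range fun n => (e (2 * n + 1)).1, ?_, ?_,
    Set.infinite_range_of_injective fun a b h => ?_,
    Set.infinite_range_of_injective fun a b h => ?_, ?_⟩
  · rintro _ ⟨n, rfl⟩; exact (e _).2
  · rintro _ ⟨n, rfl⟩; exact (e _).2
  · have := e.injective (Subtype.ext h); omega
  · have := e.injective (Subtype.ext h); omega
  · rw [Set.disjoint_left]
    rintro _ ⟨n, rfl⟩ ⟨m, h⟩
    have := e.injective (Subtype.ext h); omega

section extension

variable {k : ℕ} (χ : Fm k) (τ : Fin k → ℕ) (G₁ G₂ : Set ℕ)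

/-- An admissible stage in the construction of a saturated theory which does not contain `χ`. -/
structure Stage (Θ : Theory Ξ) : Prop where
  not_mem : ¬ Θ.mem χ τ
  generic : ∀ c ∈ G₂, Θ.Generic c
  finite : {c ∈ G₁ | ¬ Θ.Generic c}.Finite

variable {χ τ G₁ G₂}

/-- One formula is treated: it is added unless this would yield `χ`, and an existential formula also
gets a witness. Names from `G₂` are never used, so they stay generic, and only finitely many names
of `G₁` are spent. -/
theorem Stage.step (hG₁ : G₁.Infinite) (hd : Disjoint G₁ G₂)
    (hΘ : Stage χ τ G₁ G₂ Θ) {n : ℕ} (φ : Fm n) (ρ : Fin n → ℕ) (hρ : ∀ i, ρ i ∉ G₂) :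
    ∃ Θ' : Theory Ξ, Θ ≤ Θ' ∧ Stage χ τ G₁ G₂ Θ' ∧ ((Θ'.add φ ρ).mem χ τ ∨ Θ'.mem φ ρ ∧
      ∀ ψ, φ = .ex ψ → ∃ c ∉ G₂, Θ'.mem ψ (vecCons c ρ)) := by
  by_cases h : (Θ.add φ ρ).mem χ τ
  · exact ⟨Θ, le_refl _, hΘ, .inl h⟩
  have h1 : Stage χ τ G₁ G₂ (Θ.add φ ρ) := by
    refine ⟨h, fun c hc => (hΘ.generic c hc).add _ _ fun i hi => hρ i (hi ▸ hc), ?_⟩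
    refine (hΘ.finite.union (Set.finite_range ρ)).subset fun c hc => ?_
    by_contra hc'
    simp only [Set.mem_union, Set.mem_ofPred_eq, not_or, not_and, not_not, Set.mem_range,
      not_exists] at hc'
    exact hc.2 ((hc'.1 hc.1).add _ _ hc'.2)
  by_cases he : ∃ ψ, φ = .ex ψ
  swap
  · exact ⟨_, le_add _ _ _, h1, .inr ⟨add_self _ _ _, fun ψ hψ => (he ⟨ψ, hψ⟩).elim⟩⟩
  obtain ⟨ψ, rfl⟩ := he
  -- Finitely many names of the infinite set `G₁` are spoiled, so a generic one remains that occurs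
  -- neither in `ρ` nor in `τ`.
  obtain ⟨c, hc, hc'⟩ := (hG₁.sdiff ((h1.finite.union (Set.finite_range ρ)).union
    (Set.finite_range τ))).nonempty
  simp only [Set.mem_union, Set.mem_ofPred_eq, not_or, not_and, not_not, Set.mem_range,
    not_exists] at hc'
  obtain ⟨⟨hgen, hcρ⟩, hcτ⟩ := hc'
  replace hgen := hgen hc
  have hc2 : c ∉ G₂ := Set.disjoint_left.1 hd hc
  have hle := le_add (Θ.add (.ex ψ) ρ) ψ (vecCons c ρ)
  refine ⟨(Θ.add (.ex ψ) ρ).add ψ (vecCons c ρ), le_trans (le_add _ _ _) hle, ⟨?_, ?_, ?_⟩,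
    .inr ⟨hle _ _ (add_self _ _ _), fun ψ' hψ' => ⟨c, hc2, ?_⟩⟩⟩
  · exact fun h' => h (hgen.add_witness hcρ (add_self _ _ _) hcτ h')
  · refine fun d hd => (h1.generic d hd).add _ _ (Fin.cases ?_ fun i => ?_)
    · rintro rfl
      exact hc2 hd
    · rintro rfl
      exact hρ i hd
  · refine ((h1.finite.union (Set.finite_range ρ)).union (Set.finite_singleton c)).subset
      fun d hd => ?_
    by_contra hd'
    simp only [Set.mem_union, Set.mem_ofPred_eq, not_or, not_and, not_not, Set.mem_range,
      not_exists, Set.mem_singleton_iff] at hd'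
    exact hd.2 ((hd'.1.1 hd.1).add _ _ (Fin.cases (Ne.symm hd'.2) hd'.1.2))
  · obtain rfl : ψ = ψ' := by injection hψ'
    exact add_self _ _ _

/-- Half of the reserve `G` supplies witnesses. The other half is left untouched and is the reserve
of the new theory, so that the construction can be repeated above it. -/
theorem exists_saturated {G : Set ℕ} (hG : G.Infinite) (hgen : ∀ c ∈ G, Θ.Generic c)
    (h : ¬ Θ.mem χ τ) : ∃ (Θ' : Theory Ξ) (G' : Set ℕ), Θ ≤ Θ' ∧ G' ⊆ G ∧
      G'.Infinite ∧ (∀ c ∈ G', Θ'.Generic c) ∧ Θ'.Saturated G' ∧ ¬ Θ'.mem χ τ := by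
  obtain ⟨G₁, G₂, h1, h2, hG₁, hG₂, hd⟩ := hG.exists_split
  have : Nonempty (Σ n, Fm n × (Fin n → ℕ)) := ⟨⟨0, .bot, ![]⟩⟩
  obtain ⟨e, he⟩ := exists_surjective_nat (Σ n, Fm n × (Fin n → ℕ))
  have step : ∀ (n : ℕ) (s : {Θ : Theory Ξ // Stage χ τ G₁ G₂ Θ}),
      ∃ s' : {Θ : Theory Ξ // Stage χ τ G₁ G₂ Θ}, s.1 ≤ s'.1 ∧
      ((∀ i, (e n).2.2 i ∉ G₂) → (s'.1.add (e n).2.1 (e n).2.2).mem χ τ ∨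
        s'.1.mem (e n).2.1 (e n).2.2 ∧
      ∀ ψ, (e n).2.1 = .ex ψ → ∃ c ∉ G₂, s'.1.mem ψ (vecCons c (e n).2.2)) := by
    intro n s
    by_cases hn : ∀ i, (e n).2.2 i ∉ G₂
    · obtain ⟨Θ', ha, hb, hc⟩ := s.2.step hG₁ hd (e n).2.1 (e n).2.2 hn
      exact ⟨⟨Θ', hb⟩, ha, fun _ => hc⟩
    · exact ⟨s, le_refl _, fun H => (hn H).elim⟩
  choose next hle hnext using step
  let f : ℕ → {Θ : Theory Ξ // Stage χ τ G₁ G₂ Θ} := Nat.rec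
    ⟨Θ, h, fun c hc => hgen c (h2 hc), by
      convert Set.finite_empty
      ext c
      simp only [Set.mem_ofPred_eq, Set.mem_empty_iff_false, iff_false, not_and, not_not]
      exact fun hc => hgen c (h1 hc)⟩ next
  have hf : ∀ ⦃i j⦄, i ≤ j → (f i).1 ≤ (f j).1 := by
    intro i j hij
    induction hij with
    | refl => exact le_refl _
    | step _ ih => exact le_trans ih (hle _ _)
  have key : ∀ {n : ℕ} (φ : Fm n) (ρ : Fin n → ℕ), (∀ i, ρ i ∉ G₂) →
      ∃ i, ((f i).1.add φ ρ).mem χ τ ∨ (f i).1.mem φ ρ ∧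
        ∀ ψ, φ = .ex ψ → ∃ c ∉ G₂, (f i).1.mem ψ (vecCons c ρ) := by
    intro n φ ρ hρ
    obtain ⟨i, hi⟩ := he ⟨n, φ, ρ⟩
    have := hnext i (f i)
    rw [hi] at this
    exact ⟨i + 1, this hρ⟩
  refine ⟨iUnion (fun i => (f i).1) hf, G₂, fun _ _ _ H => ⟨0, H⟩, h2, hG₂, ?_, ⟨?_, ?_⟩, ?_⟩
  · rintro c hc n φ ρ hρ ⟨i, hi⟩
    exact ⟨i, (f i).2.generic c hc _ _ hρ hi⟩
  · rintro n φ ψ ρ hρ ⟨i, hi⟩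
    obtain ⟨j, hj | hj⟩ := key φ ρ hρ
    swap
    · exact .inl ⟨j, hj.1⟩
    obtain ⟨l, hl | hl⟩ := key ψ ρ hρ
    swap
    · exact .inr ⟨l, hl.1⟩
    -- Neither disjunct was admitted, so each of them yields `χ`. At a stage beyond all three
    -- indices the disjunction then yields `χ` itself.
    refine ((f (max i (max j l))).2.not_mem (mem_of_add_or (φ := φ) (ψ := ψ) (s := ρ) ?_ ?_ ?_)).elim
    · exact add_mono (hf (by simp)) _ _ _ _ hj
    · exact add_mono (hf (by simp)) _ _ _ _ hl
    · exact hf (by simp) _ _ hi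
  · rintro n φ ρ hρ ⟨i, hi⟩
    obtain ⟨j, hj | hj⟩ := key _ ρ hρ
    · exact ((f (max i j)).2.not_mem (mem_of_add (add_mono (hf (le_max_right _ _)) _ _ _ _ hj)
        (hf (le_max_left _ _) _ _ hi))).elim
    · obtain ⟨c, hc, hc'⟩ := hj.2 φ rfl
      exact ⟨c, hc, j, hc'⟩
  · rintro ⟨i, hi⟩
    exact (f i).2.not_mem hi

end extension

/-- The theory of all derivable formulas. -/
def derivable (Ξ : PR 2) : Theory Ξ where
  mem {n} φ ρ := ∀ (N : ℕ) (r : Fin n → Fin N), (∀ i, (r i).1 = ρ i) → Prv Ξ [] (φ.ren r)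
  closed {n Γ φ ρ} h h' N r hr := by
    refine (h.subst fun i => var (r i)).cut fun γ hγ => ?_
    obtain ⟨δ, hδ, rfl⟩ := List.mem_map.1 hγ
    exact h' δ hδ N r hr
  ren {n m r φ ρ} := by
    refine ⟨fun h N s hs => ?_, fun h N s hs => ?_⟩
    -- A context large enough for all of `ρ`, including names outside the range of `r`. Variables
    -- from `N` on do not occur in the renamed formula and may be replaced by `0`.
    · let N' := N + ∑ i, (ρ i + 1)
      have hN' : ∀ i, ρ i < N' := fun i => by
        have : ρ i + 1 ≤ ∑ i, (ρ i + 1) :=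
          Finset.single_le_sum (f := fun i => ρ i + 1) (by simp) (Finset.mem_univ i)
        omega
      have := (h N' (fun i => ⟨ρ i, hN' i⟩) fun i => rfl).subst
        (fun i => if h : i.1 < N then var ⟨i, h⟩ else Tm.zero)
      simp only [Fm.ren_ren] at this
      simp only [Fm.ren, Fm.subst_subst, List.map_nil, Tm.subst_var] at this
      rw [Fm.ren]
      convert this using 3 with i
      simp [← hs i]
    · rw [Fm.ren_ren]
      exact h _ _ fun i => hs _

/-- A theorem with a free variable may be generalised. This provides the infinite reserve from which
the first world is built. -/
theorem derivable_generic (c : ℕ) : (derivable Ξ).Generic c := by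
  intro n φ ρ hρ h N r hr
  rw [Fm.ren_all]
  refine .all_intro ?_
  -- The variable `c` is renamed to the bound variable `0`, the variables below `N` move up by one,
  -- and the rest do not occur.
  have := (h (max (c + 1) N) (vecCons ⟨c, by omega⟩ fun i => (r i).castLE (by omega))
    (Fin.cases rfl fun i => by simp [hr])).subst
    (fun i => if i.1 = c then (var 0 : Tm (N + 1)) else
      if h : i.1 < N then var (Fin.succ ⟨i, h⟩) else Tm.zero)
  simp only [Fm.ren, Fm.subst_subst, List.map_nil, Tm.subst_var] at this
  simp only [Fm.ren, List.map_nil]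
  convert this using 2
  refine funext_cons (by simp) fun i => ?_
  have : (r i).1 ≠ c := by rw [hr]; exact hρ i
  simp [this]

end Theory

/-! ### Worlds -/

/-- A node of the canonical Kripke model. -/
structure World (Ξ : PR 2) where
  Θ : Theory Ξ
  G : Set ℕ
  infinite : G.Infinite
  generic : ∀ c ∈ G, Θ.Generic c
  saturated : Θ.Saturated G
  consistent : ¬ Θ.mem (.bot (n := 0)) ![]

namespace World

variable {w : World Ξ}

/-- Names which are equal in a world. -/
def setoid (w : World Ξ) : Setoid {c // c ∉ w.G} where
  r a b := w.Θ.mem (.eq (var 0) (var 1)) ![a, b]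
  iseqv := by
    have H : ∀ {n : ℕ} (i j : Fin n) (ρ : Fin n → ℕ),
        w.Θ.mem (.eq (var 0) (var 1)) ![ρ i, ρ j] ↔ w.Θ.mem (.eq (var i) (var j)) ρ := by
      intro n i j ρ
      rw [show (Fm.eq (var i) (var j)) = (Fm.eq (var 0) (var 1)).ren ![i, j] from rfl, w.Θ.ren,
        map_cons, map_cons]
      congr!
    refine ⟨fun a => (H 0 0 ![a.1]).2 (w.Θ.of_prv (.eq_refl _)), fun {a b} h => ?_,
      fun {a b c} h h' => ?_⟩
    · exact (H 1 0 ![a.1, b.1]).2 (w.Θ.mem_of (.eq_symm .hyp_zero) h)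
    · exact (H 0 2 ![a.1, b.1, c.1]).2 (w.Θ.mem_of₂ (.eq_trans .hyp_zero (.hyp (by simp)))
        ((H 0 1 ![a.1, b.1, c.1]).1 h) ((H 1 2 ![a.1, b.1, c.1]).1 h'))

/-- The individuals of a world. -/
def D (w : World Ξ) : Type := Quotient w.setoid

/-- The individual with a given name. -/
def el (w : World Ξ) (c : ℕ) (hc : c ∉ w.G) : w.D := Quotient.mk w.setoid ⟨c, hc⟩

/-- A name of an individual. -/
noncomputable def name (d : w.D) : ℕ := (Quotient.out d).1

theorem name_not_mem (d : w.D) : name d ∉ w.G := (Quotient.out d).2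

@[simp] theorem el_name (d : w.D) : w.el (name d) (name_not_mem d) = d := Quotient.out_eq d

theorem el_eq_el {c d : ℕ} {hc : c ∉ w.G} {hd : d ∉ w.G} :
    w.el c hc = w.el d hd ↔ w.Θ.mem (.eq (var 0) (var 1)) ![c, d] := Quotient.eq

theorem mem_eq {n : ℕ} {i j : Fin n} {ρ : Fin n → ℕ} (hi : ρ i ∉ w.G) (hj : ρ j ∉ w.G) :
    w.Θ.mem (.eq (var i) (var j)) ρ ↔ w.el (ρ i) hi = w.el (ρ j) hj := by
  rw [el_eq_el, show (Fm.eq (var i) (var j)) = (Fm.eq (var 0) (var 1)).ren ![i, j] from rfl,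
    w.Θ.ren, map_cons, map_cons]
  congr!

/-- Truth of a formula in a world. -/
def force {n : ℕ} (φ : Fm n) (ρ : Fin n → w.D) : Prop := w.Θ.mem φ fun i => name (ρ i)

/-- Leibniz's law: membership depends only on the individuals named. Hence `force`, which uses
chosen names, is independent of the choice. -/
theorem mem_congr {n : ℕ} {φ : Fm n} {ρ τ : Fin n → ℕ} (hρ : ∀ i, ρ i ∉ w.G) (hτ : ∀ i, τ i ∉ w.G)
    (h : ∀ i, w.el (ρ i) (hρ i) = w.el (τ i) (hτ i)) (H : w.Θ.mem φ ρ) : w.Θ.mem φ τ := by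
  have h1 : w.Θ.mem (φ.ren (Fin.castAdd n)) (Fin.append ρ τ) := w.Θ.ren.2 (by simpa)
  suffices h2 : w.Θ.mem (φ.ren (Fin.natAdd n)) (Fin.append ρ τ) by
    simpa only [Fin.append_right] using w.Θ.ren.1 h2
  refine w.Θ.closed (Γ := φ.ren (Fin.castAdd n) :: List.ofFn fun i : Fin n =>
    .eq (var (Fin.castAdd n i)) (var (Fin.natAdd n i))) ?_ ?_
  · exact Prv.subst_congr (fun i => .hyp (List.mem_cons_of_mem _ (List.mem_ofFn.2 ⟨i, rfl⟩))) φ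
      .hyp_zero
  · intro γ hγ
    rcases List.mem_cons.1 hγ with rfl | hγ
    · exact h1
    · obtain ⟨i, rfl⟩ := List.mem_ofFn.1 hγ
      rw [mem_eq (by simpa only [Fin.append_left] using hρ i)
        (by simpa only [Fin.append_right] using hτ i)]
      simpa only [Fin.append_left, Fin.append_right] using h i

theorem mem_iff {n : ℕ} {φ : Fm n} {ρ : Fin n → ℕ} (hρ : ∀ i, ρ i ∉ w.G) :
    w.Θ.mem φ ρ ↔ force φ fun i => w.el (ρ i) (hρ i) :=
  ⟨mem_congr hρ (fun _ => name_not_mem _) (by simp),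
    mem_congr (fun _ => name_not_mem _) hρ (by simp)⟩

theorem force_closed {n : ℕ} {Γ : List (Fm n)} {φ : Fm n} {ρ : Fin n → w.D} (h : Prv Ξ Γ φ)
    (h' : ∀ γ ∈ Γ, force γ ρ) : force φ ρ :=
  w.Θ.closed h h'

theorem force_prv {n : ℕ} {φ : Fm n} (ρ : Fin n → w.D) (h : Prv Ξ [] φ) : force φ ρ :=
  w.Θ.of_prv h

theorem force_axm {n : ℕ} {φ : Fm n} (ρ : Fin n → w.D) (h : Axm Ξ φ) : force φ ρ :=
  w.Θ.of_prv (.axm h)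

theorem force_ren {n m : ℕ} {φ : Fm n} {r : Fin n → Fin m} {ρ : Fin m → w.D} :
    force (φ.ren r) ρ ↔ force φ fun i => ρ (r i) := w.Θ.ren

theorem force_eq_var {n : ℕ} {i j : Fin n} {ρ : Fin n → w.D} :
    force (.eq (var i) (var j)) ρ ↔ ρ i = ρ j := by
  rw [force, mem_eq (name_not_mem _) (name_not_mem _)]
  simp

theorem force_and {n : ℕ} {φ ψ : Fm n} {ρ : Fin n → w.D} :
    force (φ.and ψ) ρ ↔ force φ ρ ∧ force ψ ρ :=
  ⟨fun h => ⟨w.Θ.mem_of (.and_left .hyp_zero) h, w.Θ.mem_of (.and_right .hyp_zero) h⟩,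
    fun h => w.Θ.mem_of₂ (.and_intro .hyp_zero (.hyp (by simp))) h.1 h.2⟩

theorem force_or {n : ℕ} {φ ψ : Fm n} {ρ : Fin n → w.D} :
    force (φ.or ψ) ρ ↔ force φ ρ ∨ force ψ ρ :=
  ⟨fun h => w.saturated.prime (fun _ => name_not_mem _) h,
    fun h => h.elim (w.Θ.mem_of (.or_left .hyp_zero)) (w.Θ.mem_of (.or_right .hyp_zero))⟩

theorem not_force_bot {n : ℕ} {ρ : Fin n → w.D} : ¬ force .bot ρ := fun h => by
  refine w.consistent ?_
  rw [force, show (Fm.bot : Fm n) = (Fm.bot : Fm 0).ren Fin.elim0 from rfl, w.Θ.ren] at h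
  convert h

theorem force_all_elim {n : ℕ} {φ : Fm (n + 1)} {ρ : Fin n → w.D} (h : force (.all φ) ρ)
    (d : w.D) : force φ (vecCons d ρ) := by
  refine w.Θ.mem_of (Prv.of_all_shift (φ := φ) (List.mem_singleton.2 rfl)) ?_
  rw [Fm.shift_eq_ren, w.Θ.ren]
  exact h

/-- Existential formulas are decided in the world itself, thanks to its witnesses. -/
theorem force_ex {n : ℕ} {φ : Fm (n + 1)} {ρ : Fin n → w.D} :
    force (.ex φ) ρ ↔ ∃ d, force φ (vecCons d ρ) := by
  constructor
  · intro h
    obtain ⟨c, hc, h⟩ := w.saturated.witness (fun _ => name_not_mem _) h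
    refine ⟨w.el c hc, ?_⟩
    rw [mem_iff (Fin.cases hc fun _ => name_not_mem _)] at h
    convert h using 1
    exact funext_cons rfl fun i => (el_name (ρ i)).symm
  · rintro ⟨d, h⟩
    have : w.Θ.mem (Fm.ex φ).shift fun i => name (vecCons d ρ i) := by
      refine w.Θ.mem_of (.ex_intro (var 0) ?_) h
      rw [Fm.subst_up_inst, show vecCons (var 0) (fun i : Fin n => var i.succ) = var from
        funext_cons rfl fun _ => rfl, Fm.subst_id]
      exact .hyp_zero
    rw [Fm.shift_eq_ren, w.Θ.ren] at this
    exact this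

/-- Maps between worlds which preserve truth. -/
structure Hom (w w' : World Ξ) where
  toFun : w.D → w'.D
  mono : ∀ {n : ℕ} {φ : Fm n} {ρ : Fin n → w.D}, force φ ρ → force φ fun i => toFun (ρ i)

instance {w w' : World Ξ} : CoeFun (Hom w w') fun _ => w.D → w'.D := ⟨Hom.toFun⟩

/-- The identity. -/
def Hom.id (w : World Ξ) : Hom w w := ⟨fun d => d, fun h => h⟩

/-- Composition. -/
def Hom.comp {w w' w'' : World Ξ} (g : Hom w' w'') (f : Hom w w') : Hom w w'' :=
  ⟨fun d => g (f d), fun h => g.mono (f.mono h)⟩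

@[simp] theorem Hom.id_apply (d : w.D) : Hom.id w d = d := rfl

@[simp] theorem Hom.comp_apply {w w' w'' : World Ξ} (g : Hom w' w'') (f : Hom w w') (d : w.D) :
    g.comp f d = g (f d) := rfl

/-- The map between worlds which is induced by an inclusion of theories. -/
noncomputable def Hom.ofLE {w w' : World Ξ} (h : w.Θ ≤ w'.Θ) (hG : w'.G ⊆ w.G) : Hom w w' where
  toFun d := w'.el (name d) fun hc => name_not_mem d (hG hc)
  mono h' := (mem_iff _).1 (h _ _ h')

/-- A world in which `φ` fails can be found for each theory which does not contain `φ`. -/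
theorem exists_world {Θ : Theory Ξ} {G : Set ℕ} (hG : G.Infinite) (hgen : ∀ c ∈ G, Θ.Generic c)
    {n : ℕ} {φ : Fm n} {ρ : Fin n → ℕ} (h : ¬ Θ.mem φ ρ) :
    ∃ w : World Ξ, Θ ≤ w.Θ ∧ w.G ⊆ G ∧ (∀ i, ρ i ∉ w.G) ∧ ¬ w.Θ.mem φ ρ := by
  -- The names in `ρ` leave the reserve, so that they denote individuals of the new world.
  obtain ⟨Θ', G', h1, h2, h3, h4, h5, h6⟩ := Theory.exists_saturated (χ := φ) (τ := ρ)
    (hG.sdiff (Set.finite_range ρ)) (fun c hc => hgen c hc.1) h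
  refine ⟨⟨Θ', G', h3, h4, h5, fun hb => h6 ?_⟩, h1, fun c hc => (h2 hc).1,
    fun i hi => (h2 hi).2 ⟨i, rfl⟩, h6⟩
  have : Θ'.mem ((.bot : Fm 0).ren (Fin.elim0 : Fin 0 → Fin n)) ρ :=
    Θ'.ren.2 (by convert hb)
  exact Θ'.mem_of (.bot_elim .hyp_zero) this

/-- If `ψ` does not follow after adding `φ`, a saturated extension of the enlarged theory omits `ψ`
and is a later world refuting the right-hand side. -/
theorem force_imp {n : ℕ} {φ ψ : Fm n} {ρ : Fin n → w.D} :
    force (φ.imp ψ) ρ ↔ ∀ (w' : World Ξ) (f : Hom w w'), force φ (fun i => f (ρ i)) →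
      force ψ fun i => f (ρ i) := by
  refine ⟨fun h w' f h' => w'.Θ.mp (f.mono h) h', fun h => ?_⟩
  by_contra hn
  rw [force, ← Theory.add_iff'] at hn
  obtain ⟨w', h1, h2, h3, h4⟩ := exists_world w.infinite
    (fun c hc => (w.generic c hc).add _ _ fun i hi => name_not_mem _ (hi ▸ hc)) hn
  refine h4 ?_
  rw [mem_iff h3]
  refine h w' (.ofLE (Theory.le_trans (Theory.le_add _ _ _) h1) h2) ?_
  exact (mem_iff h3).1 (h1 _ _ (Theory.add_self _ _ _))

/-- A generic name stands for an arbitrary individual: if `∀ φ` is not in the theory, neither is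
`φ(c)`, and `c` becomes an individual of a later world in which `φ(c)` fails. -/
theorem force_all {n : ℕ} {φ : Fm (n + 1)} {ρ : Fin n → w.D} :
    force (.all φ) ρ ↔ ∀ (w' : World Ξ) (f : Hom w w') (d : w'.D),
      force φ (vecCons d fun i => f (ρ i)) := by
  refine ⟨fun h w' f d => force_all_elim (f.mono h) d, fun h => ?_⟩
  by_contra hn
  obtain ⟨c, hc⟩ := w.infinite.nonempty
  have hn' : ¬ w.Θ.mem φ (vecCons c fun i => name (ρ i)) := fun h' =>
    hn (w.generic c hc _ _ (fun i hi => name_not_mem _ (hi ▸ hc)) h')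
  obtain ⟨w', h1, h2, h3, h4⟩ := exists_world w.infinite w.generic hn'
  refine h4 ?_
  rw [mem_iff h3]
  convert h w' (.ofLE h1 h2) (w'.el c (h3 0)) using 1
  exact funext_cons rfl fun _ => rfl

/-- Completeness. -/
theorem thm_of_force {φ : Fm 0} (h : ∀ w : World Ξ, force (w := w) φ ![]) : Thm Ξ φ := by
  by_contra hn
  have : ¬ (Theory.derivable Ξ).mem φ ![] := fun h' => hn (by
    have := h' 0 id fun i => i.elim0
    rwa [Fm.ren, show (fun i : Fin 0 => var (id i)) = var from rfl, Fm.subst_id] at this)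
  obtain ⟨w, -, -, h3, h4⟩ := exists_world Set.infinite_univ
    (fun c _ => Theory.derivable_generic c) this
  rw [mem_iff h3] at h4
  refine h4 ?_
  convert h w

end World

/-! ### First-order arithmetic in a world -/

namespace World

variable {w w' : World Ξ}

/-! ### Terms in a world -/

/-- `∃ x, x = t` is derivable, and the world has a witness for it. -/
theorem exists_eval {n : ℕ} (t : Tm n) (ρ : Fin n → w.D) :
    ∃ d, force (.eq (var 0) t.shift) (vecCons d ρ) := by
  refine force_ex.1 (force_prv ρ (.ex_intro t ?_))
  have : Fm.inst (.eq (var 0) t.shift) t = .eq t t := by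
    simp [Fm.inst, Fm.subst, Tm.shift_subst]
  rw [this]
  exact .eq_refl _

/-- The value of a term. -/
noncomputable def _root_.VSet.Tm.eval {n : ℕ} (t : Tm n) (ρ : Fin n → w.D) : w.D :=
  (exists_eval t ρ).choose

theorem eval_spec {n : ℕ} (t : Tm n) (ρ : Fin n → w.D) :
    force (.eq (var 0) t.shift) (vecCons (t.eval ρ) ρ) := (exists_eval t ρ).choose_spec

theorem eval_unique {n : ℕ} {t : Tm n} {ρ : Fin n → w.D} {d : w.D}
    (h : force (.eq (var 0) t.shift) (vecCons d ρ)) : t.eval ρ = d := by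
  have H := eval_spec t ρ
  generalize t.eval ρ = e at H ⊢
  have h1 : force ((Fm.eq (var 0) t.shift).ren (vecCons 0 fun i => i.succ.succ))
      (vecCons d (vecCons e ρ)) := by
    rw [force_ren, map_cons]; exact h
  have h2 : force ((Fm.eq (var 0) t.shift).ren (vecCons 1 fun i => i.succ.succ))
      (vecCons d (vecCons e ρ)) := by
    rw [force_ren, map_cons]; exact H
  rw [Fm.ren, Fm.subst, Tm.shift_subst] at h1 h2
  have h3 : force (.eq (var 1) (var 0)) (vecCons d (vecCons e ρ)) :=
    force_closed (Γ := [_, _]) (.eq_trans (.hyp (List.mem_cons_of_mem _ (List.mem_singleton.2 rfl)))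
      (.eq_symm .hyp_zero)) (List.forall_mem_cons.2 ⟨h1, List.forall_mem_cons.2 ⟨h2, by simp⟩⟩)
  exact force_eq_var.1 h3

theorem eval_var {n : ℕ} (i : Fin n) (ρ : Fin n → w.D) : (var i).eval ρ = ρ i :=
  eval_unique (force_eq_var.2 rfl)

/-- The values of the terms are adjoined to the environment as extra variables. There the equations
between these variables and the terms hold, and `Prv.subst_congr` exchanges one for the other. -/
theorem force_subst {n m : ℕ} {φ : Fm n} {σ : Fin n → Tm m} {ρ : Fin m → w.D} :
    force (φ.subst σ) ρ ↔ force φ fun i => (σ i).eval ρ := by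
  set e := fun i => (σ i).eval ρ
  have H1 : force φ e ↔ force (φ.ren (Fin.natAdd m)) (Fin.append ρ e) := by
    rw [force_ren]; simp only [Fin.append_right]
  have H2 : force (φ.subst σ) ρ ↔ force ((φ.subst σ).ren (Fin.castAdd n)) (Fin.append ρ e) := by
    rw [force_ren]; simp only [Fin.append_left]
  have H3 : ∀ i, force (.eq (var (Fin.natAdd m i)) ((σ i).subst fun j => var (Fin.castAdd n j)))
      (Fin.append ρ e) := by
    intro i
    have : force ((Fm.eq (var 0) (σ i).shift).ren (vecCons (Fin.natAdd m i) (Fin.castAdd n)))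
        (Fin.append ρ e) := by
      rw [force_ren, map_cons]
      simp only [Fin.append_left, Fin.append_right]
      exact eval_spec _ _
    simpa [Fm.ren, Fm.subst, Tm.shift_subst] using this
  have H4 : ∀ γ ∈ List.ofFn fun i => Fm.eq (var (Fin.natAdd m i))
      ((σ i).subst fun j => var (Fin.castAdd n j)), force γ (Fin.append ρ e) := by
    intro γ hγ
    obtain ⟨i, rfl⟩ := List.mem_ofFn.1 hγ
    exact H3 i
  rw [H1, H2, Fm.ren, Fm.subst_subst]
  constructor
  · intro h
    refine force_closed (Γ := _ :: _) ?_ (List.forall_mem_cons.2 ⟨h, H4⟩)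
    refine Prv.subst_congr (fun i => .eq_symm (.hyp (List.mem_cons_of_mem _ ?_))) φ .hyp_zero
    exact List.mem_ofFn.2 ⟨i, rfl⟩
  · intro h
    refine force_closed (Γ := _ :: _) ?_ (List.forall_mem_cons.2 ⟨h, H4⟩)
    refine Prv.subst_congr (fun i => (.hyp (List.mem_cons_of_mem _ ?_))) φ .hyp_zero
    exact List.mem_ofFn.2 ⟨i, rfl⟩

theorem force_eq {n : ℕ} {s t : Tm n} {ρ : Fin n → w.D} :
    force (.eq s t) ρ ↔ s.eval ρ = t.eval ρ := by
  rw [show Fm.eq s t = (Fm.eq (var 0) (var 1)).subst ![s, t] from rfl, force_subst, force_eq_var]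
  rfl

theorem eval_cons {n m : ℕ} (t : Tm m) (σ : Fin n → Tm m) (ρ : Fin m → w.D) :
    (fun i => (vecCons t σ i).eval ρ) = vecCons (t.eval ρ) fun i => (σ i).eval ρ :=
  map_cons (fun t : Tm m => t.eval ρ) _ _

/-- The v-sets of a world. -/
def V (d : w.D) : Prop := force (.V (var 0)) ![d]
/-- The Meaningful conditions of a world. -/
def M (d : w.D) : Prop := force (.M (var 0)) ![d]
/-- The True conditions of a world. -/
def T (d : w.D) : Prop := force (.T (var 0)) ![d]

theorem force_V {n : ℕ} {t : Tm n} {ρ : Fin n → w.D} : force (.V t) ρ ↔ V (t.eval ρ) := by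
  rw [show Fm.V t = (Fm.V (var 0)).subst ![t] from rfl, force_subst, eval_cons, V]
  congr!

theorem force_M {n : ℕ} {t : Tm n} {ρ : Fin n → w.D} : force (.M t) ρ ↔ M (t.eval ρ) := by
  rw [show Fm.M t = (Fm.M (var 0)).subst ![t] from rfl, force_subst, eval_cons, M]
  congr!

theorem force_T {n : ℕ} {t : Tm n} {ρ : Fin n → w.D} : force (.T t) ρ ↔ T (t.eval ρ) := by
  rw [show Fm.T t = (Fm.T (var 0)).subst ![t] from rfl, force_subst, eval_cons, T]
  congr!

theorem Hom.eval (f : Hom w w') {n : ℕ} (t : Tm n) (ρ : Fin n → w.D) :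
    f (t.eval ρ) = t.eval fun i => f (ρ i) := by
  have := f.mono (eval_spec t ρ)
  rw [map_cons] at this
  exact (eval_unique this).symm

/-- The primitive recursive functions of a world. -/
noncomputable def fn {k : ℕ} (f : PR k) (v : Fin k → w.D) : w.D := (Tm.app f var).eval v

theorem eval_ren {n m : ℕ} (t : Tm n) (r : Fin n → Fin m) (ρ : Fin m → w.D) :
    (t.subst fun i => var (r i)).eval ρ = t.eval fun i => ρ (r i) := by
  refine eval_unique ?_
  have := eval_spec t fun i => ρ (r i)
  rw [show vecCons (t.eval fun i => ρ (r i)) (fun i => ρ (r i)) = fun i =>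
    (vecCons (t.eval fun i => ρ (r i)) ρ : Fin _ → w.D) (vecCons 0 (fun i => (r i).succ) i) from
    funext_cons rfl fun _ => rfl, ← force_ren] at this
  simpa [Fm.ren, Fm.subst, Tm.shift_subst, Tm.subst_shift] using this

theorem eval_shift {n : ℕ} (t : Tm n) (d : w.D) (ρ : Fin n → w.D) :
    t.shift.eval (vecCons d ρ) = t.eval ρ := eval_ren t _ _

theorem eval_app {n k : ℕ} (f : PR k) (ts : Fin k → Tm n) (ρ : Fin n → w.D) :
    (Tm.app f ts).eval ρ = fn f fun i => (ts i).eval ρ := by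
  have := eval_spec (Tm.app f ts) ρ
  rw [show Fm.eq (var 0) (Tm.app f ts).shift = (Fm.eq (var 0) (Tm.app f var).shift).subst
    (vecCons (var 0) fun i => (ts i).shift) from rfl, force_subst, eval_cons] at this
  simp only [eval_var, eval_shift] at this
  exact (eval_unique this).symm

@[simp] theorem Hom.fn (f : Hom w w') {k : ℕ} (g : PR k) (v : Fin k → w.D) :
    f (fn g v) = World.fn g fun i => f (v i) := f.eval _ _

theorem Hom.V (f : Hom w w') {d : w.D} (h : V d) : World.V (f d) := by
  have := f.mono h; rwa [map_cons, Subsingleton.elim (fun i : Fin 0 => _) ![]] at this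
theorem Hom.M (f : Hom w w') {d : w.D} (h : M d) : World.M (f d) := by
  have := f.mono h; rwa [map_cons, Subsingleton.elim (fun i : Fin 0 => _) ![]] at this
theorem Hom.T (f : Hom w w') {d : w.D} (h : T d) : World.T (f d) := by
  have := f.mono h; rwa [map_cons, Subsingleton.elim (fun i : Fin 0 => _) ![]] at this

/-! ### Arithmetic in a world -/

theorem fn_proj {k : ℕ} (i : Fin k) (v : Fin k → w.D) : fn (.proj i) v = v i := by
  have := force_axm (Ξ := Ξ) v (.proj i var)
  rwa [force_eq, eval_var] at this

theorem fn_comp {m k : ℕ} (f : PR m) (g : Fin m → PR k) (v : Fin k → w.D) :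
    fn (.comp f g) v = fn f fun i => fn (g i) v := by
  have := force_axm (Ξ := Ξ) v (.comp f g var)
  simp only [force_eq, eval_app, eval_var] at this
  exact this

noncomputable instance : Zero w.D := ⟨fn .zero ![]⟩

/-- The successor function. -/
noncomputable def suc (d : w.D) : w.D := fn .succ ![d]

theorem eval_app₀ {n : ℕ} (f : PR 0) (ρ : Fin n → w.D) : (Tm.app f ![]).eval ρ = fn f ![] := by
  rw [eval_app]; congr!
theorem eval_app₁ {n : ℕ} (f : PR 1) (a : Tm n) (ρ : Fin n → w.D) :
    (Tm.app f ![a]).eval ρ = fn f ![a.eval ρ] := by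
  rw [eval_app, eval_cons]; congr!
theorem eval_app₂ {n : ℕ} (f : PR 2) (a b : Tm n) (ρ : Fin n → w.D) :
    (Tm.app f ![a, b]).eval ρ = fn f ![a.eval ρ, b.eval ρ] := by
  rw [eval_app, eval_cons, eval_cons]; congr!

theorem eval_zero {n : ℕ} (ρ : Fin n → w.D) : Tm.zero.eval ρ = 0 := eval_app₀ _ _
theorem eval_succ {n : ℕ} (t : Tm n) (ρ : Fin n → w.D) : t.succ.eval ρ = suc (t.eval ρ) :=
  eval_app₁ _ _ _

theorem fn_comp₀ {k : ℕ} (f : PR 0) (g : Fin 0 → PR k) (v : Fin k → w.D) :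
    fn (.comp f g) v = fn f ![] := by
  rw [fn_comp]; congr!
theorem fn_comp₁ {k : ℕ} (f : PR 1) (a : PR k) (v : Fin k → w.D) :
    fn (.comp f ![a]) v = fn f ![fn a v] := by
  rw [fn_comp, map_cons (fun g => fn g v)]; congr!
theorem fn_comp₂ {k : ℕ} (f : PR 2) (a b : PR k) (v : Fin k → w.D) :
    fn (.comp f ![a, b]) v = fn f ![fn a v, fn b v] := by
  rw [fn_comp, map_cons (fun g => fn g v), map_cons (fun g => fn g v)]; congr!
theorem fn_comp₃ {k : ℕ} (f : PR 3) (a b c : PR k) (v : Fin k → w.D) :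
    fn (.comp f ![a, b, c]) v = fn f ![fn a v, fn b v, fn c v] := by
  rw [fn_comp, map_cons (fun g => fn g v), map_cons (fun g => fn g v), map_cons (fun g => fn g v)]
  congr!

theorem fn_prec_zero {k : ℕ} (f : PR k) (g : PR (k + 2)) (v : Fin k → w.D) :
    fn (.prec f g) (vecCons 0 v) = fn f v := by
  have := force_axm (Ξ := Ξ) v (.prec_zero f g var)
  rw [force_eq, eval_app, eval_cons, eval_zero] at this
  simp only [eval_var] at this
  exact this

theorem fn_prec_suc {k : ℕ} (f : PR k) (g : PR (k + 2)) (x : w.D) (v : Fin k → w.D) :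
    fn (.prec f g) (vecCons (suc x) v) = fn g (vecCons x (vecCons (fn (.prec f g) (vecCons x v)) v)) := by
  have := force_axm (Ξ := Ξ) (vecCons x v) (.prec_succ f g (var 0) fun i => var i.succ)
  rw [force_eq, eval_app, eval_app, eval_cons, eval_cons, eval_cons, eval_succ, eval_app, eval_cons] at this
  simpa only [eval_var, Matrix.cons_val_zero, Matrix.cons_val_succ] using this

theorem suc_ne_zero (d : w.D) : suc d ≠ 0 := by
  have := force_axm (Ξ := Ξ) ![d] (.succ_ne_zero (var 0))
  intro h
  rw [force_imp] at this
  refine not_force_bot (this w (.id w) ?_)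
  rw [force_eq, eval_zero, eval_succ, eval_var]
  exact h

theorem suc_inj {d e : w.D} : suc d = suc e ↔ d = e := by
  have := force_axm (Ξ := Ξ) ![d, e] (.succ_inj (var 0) (var 1))
  refine ⟨fun h => ?_, fun h => h ▸ rfl⟩
  rw [force_imp] at this
  have := this w (.id w)
  rw [force_eq, force_eq, eval_succ, eval_succ, eval_var, eval_var] at this
  exact this h

theorem force_inst {n : ℕ} {φ : Fm (n + 1)} {t : Tm n} {ρ : Fin n → w.D} :
    force (φ.inst t) ρ ↔ force φ (vecCons (t.eval ρ) ρ) := by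
  rw [Fm.inst, force_subst, eval_cons]
  simp only [eval_var]

theorem Hom.zero (f : Hom w w') : f 0 = 0 := by
  exact (f.fn _ _).trans (congrArg (World.fn _) (Subsingleton.elim _ _))

theorem Hom.suc (f : Hom w w') (d : w.D) : f (suc d) = World.suc (f d) := by
  refine (f.fn _ _).trans ?_
  rw [map_cons, Subsingleton.elim (fun i : Fin 0 => _) ![]]
  rfl

/-- Induction for formulas. -/
theorem induct {n : ℕ} (φ : Fm (n + 1))
    (h0 : ∀ (w : World Ξ) (ρ : Fin n → w.D), force φ (vecCons 0 ρ))
    (hs : ∀ (w : World Ξ) (x : w.D) (ρ : Fin n → w.D), force φ (vecCons x ρ) →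
      force φ (vecCons (suc x) ρ))
    {w : World Ξ} (x : w.D) (ρ : Fin n → w.D) : force φ (vecCons x ρ) := by
  have := force_axm (Ξ := Ξ) ρ (.induction φ)
  rw [Fm.induction, force_imp] at this
  have := this w (.id w) (by rw [force_inst, eval_zero]; exact h0 _ _)
  rw [force_imp] at this
  refine force_all_elim (this w (.id w) ?_) x
  rw [force_all]
  intro w' f d
  rw [force_imp]
  intro w'' g h
  rw [force_subst, eval_cons, eval_succ]
  rw [map_cons] at h ⊢
  simp only [eval_var]
  exact hs _ _ _ h

/-- Induction for formulas with an additional universally quantified variable. -/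
theorem induct_all {n : ℕ} (φ : Fm (n + 2))
    (h0 : ∀ (w : World Ξ) (d : w.D) (ρ : Fin n → w.D), force φ (vecCons d (vecCons 0 ρ)))
    (hs : ∀ (w : World Ξ) (x : w.D) (ρ : Fin n → w.D),
      (∀ d, force φ (vecCons d (vecCons x ρ))) → ∀ d, force φ (vecCons d (vecCons (suc x) ρ)))
    {w : World Ξ} (x : w.D) (ρ : Fin n → w.D) (d : w.D) : force φ (vecCons d (vecCons x ρ)) := by
  refine force_all_elim (induct (.all φ) (fun w ρ => ?_) (fun w x ρ h => ?_) x ρ) d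
  · rw [force_all]
    intro w' f d
    rw [map_cons, f.zero]
    exact h0 _ _ _
  · rw [force_all]
    intro w' f d
    have := f.mono h
    rw [map_cons, f.suc] at *
    exact hs _ _ _ (fun e => force_all_elim this e) d

end World

namespace World

variable {w w' : World Ξ}

attribute [simp] force_and force_or force_ex force_eq force_V force_M force_T not_force_bot
  eval_var eval_app₀ eval_app₁ eval_app₂ eval_zero eval_succ suc_ne_zero suc_inj fn_proj
  fn_comp₀ fn_comp₁ fn_comp₂ fn_comp₃

@[simp] theorem zero_ne_suc (d : w.D) : 0 ≠ suc d := (suc_ne_zero d).symm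

/-! ### Equality is decidable -/

theorem zero_or_suc (d : w.D) : d = 0 ∨ ∃ e, d = suc e := by
  have := induct (Ξ := Ξ) (n := 0) (.or (.eq (var 0) .zero) (.ex (.eq (var 1) (.succ (var 0)))))
    (by simp) (by simp) d ![]
  simpa using this

/-- Induction on `e` for all `d`, comparing predecessors. The second alternative is the Kripke
meaning of `¬ d = e`. -/
theorem eq_or_apart (d e : w.D) : d = e ∨ ∀ (w' : World Ξ) (f : Hom w w'), f d ≠ f e := by
  have := induct_all (Ξ := Ξ) (n := 0) (.or (.eq (var 0) (var 1)) (.imp (.eq (var 0) (var 1)) .bot))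
    (fun w d ρ => ?_) (fun w x ρ h d => ?_) e ![] d
  · simpa [force_imp] using this
  · rcases zero_or_suc d with rfl | ⟨d, rfl⟩
    · simp
    · simp [force_imp, Hom.suc, Hom.zero]
  · rcases zero_or_suc d with rfl | ⟨d, rfl⟩
    · simp [force_imp, Hom.suc, Hom.zero]
    · simpa [force_imp, Hom.suc] using h d

theorem Hom.injective (f : Hom w w') : Function.Injective f := fun d e h =>
  (eq_or_apart d e).resolve_right fun H => H w' f h

@[simp] theorem Hom.inj (f : Hom w w') {d e : w.D} : f d = f e ↔ d = e := f.injective.eq_iff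

/-- Maps between worlds are injective, so an equation cannot become true later, and an implication
from an equation may be read classically. -/
theorem force_imp_eq {n : ℕ} {s t : Tm n} {φ : Fm n} {ρ : Fin n → w.D} :
    force (.imp (.eq s t) φ) ρ ↔ (s.eval ρ = t.eval ρ → force φ ρ) := by
  rw [force_imp]
  refine ⟨fun h => by simpa using h w (.id w), fun h w' f h' => ?_⟩
  rw [force_eq, ← f.eval, ← f.eval, f.inj] at h'
  exact f.mono (h h')

attribute [simp] force_imp_eq

/-- Packs "in all later worlds and for all parameters" into one formula in `x`, so that the
parameters may vary in an induction on `x`. -/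
theorem exists_alls : ∀ {n : ℕ} (φ : Fm (n + 1)), ∃ ψ : Fm 1, ∀ (w : World Ξ) (x : w.D),
    force ψ ![x] ↔ ∀ (w' : World Ξ) (f : Hom w w') (ρ : Fin n → w'.D), force φ (vecCons (f x) ρ)
  | 0, φ => ⟨φ, fun w x => ⟨fun h w' f ρ => by
      have := f.mono h
      rwa [map_cons f, Subsingleton.elim (fun i : Fin 0 => _) ρ] at this,
      fun h => h w (.id w) ![]⟩⟩
  | n + 1, φ => by
    obtain ⟨ψ, hψ⟩ := exists_alls (.all (φ.ren (vecCons 1 (vecCons 0 fun i => i.succ.succ))))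
    refine ⟨ψ, fun w x => (hψ w x).trans ?_⟩
    simp only [force_all, force_ren, map_cons]
    refine ⟨fun h w' f ρ => ?_, fun h w' f ρ w'' g d => ?_⟩
    · convert h w' f (fun i => ρ i.succ) w' (.id w') (ρ 0) using 1
      refine funext_cons rfl (Fin.cases rfl fun i => rfl)
    · convert h w'' (g.comp f) (vecCons d fun i => g (ρ i)) using 1
      exact funext_cons rfl (Fin.cases rfl fun i => rfl)

/-- Induction for formulas with additional universally quantified variables. -/
theorem induct_alls {n : ℕ} (φ : Fm (n + 1))
    (h0 : ∀ (w : World Ξ) (ρ : Fin n → w.D), force φ (vecCons 0 ρ))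
    (hs : ∀ (w : World Ξ) (x : w.D), (∀ ρ : Fin n → w.D, force φ (vecCons x ρ)) →
      ∀ ρ : Fin n → w.D, force φ (vecCons (suc x) ρ))
    {w : World Ξ} (x : w.D) (ρ : Fin n → w.D) : force φ (vecCons x ρ) := by
  obtain ⟨ψ, hψ⟩ := exists_alls (Ξ := Ξ) φ
  refine (hψ w x).1 (induct ψ (fun w ρ => ?_) (fun w x ρ h => ?_) x ![]) w (.id w) ρ
  · rw [Subsingleton.elim ρ ![], hψ]
    intro w' f ρ
    rw [f.zero]
    exact h0 _ _
  · rw [Subsingleton.elim ρ ![], hψ] at h ⊢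
    intro w' f ρ
    rw [f.suc]
    exact hs _ _ (h w' f) ρ

/-! ### Addition -/

noncomputable instance : Add w.D := ⟨fun a b => fn .add ![a, b]⟩
noncomputable instance : One w.D := ⟨suc 0⟩

theorem add_def (a b : w.D) : fn .add ![a, b] = a + b := rfl

protected theorem zero_add (a : w.D) : 0 + a = a := by
  rw [← add_def, PR.add, fn_prec_zero]
  simp

theorem suc_add (a b : w.D) : suc a + b = suc (a + b) := by
  rw [← add_def, PR.add, fn_prec_suc]
  simp [← add_def, PR.add, suc]

protected theorem add_zero (a : w.D) : a + 0 = a := by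
  have := induct (Ξ := Ξ) (n := 0) (.eq (.app .add ![var 0, .zero]) (var 0))
    (by simp [add_def, World.zero_add]) (by simp [add_def, suc_add]) a ![]
  simpa [add_def] using this

theorem add_suc (a b : w.D) : a + suc b = suc (a + b) := by
  have := induct (Ξ := Ξ) (n := 1) (.eq (.app .add ![var 0, .succ (var 1)])
    (.succ (.app .add ![var 0, var 1])))
    (by simp [add_def, World.zero_add]) (by simp [add_def, suc_add]) a ![b]
  simpa [add_def] using this

protected theorem add_comm (a b : w.D) : a + b = b + a := by
  have := induct (Ξ := Ξ) (n := 1) (.eq (.app .add ![var 0, var 1]) (.app .add ![var 1, var 0]))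
    (by simp [add_def, World.zero_add, World.add_zero])
    (by simp [add_def, suc_add, add_suc]) a ![b]
  simpa [add_def] using this

protected theorem add_assoc (a b c : w.D) : a + b + c = a + (b + c) := by
  have := induct (Ξ := Ξ) (n := 2) (.eq (.app .add ![.app .add ![var 0, var 1], var 2])
    (.app .add ![var 0, .app .add ![var 1, var 2]]))
    (by simp [add_def, World.zero_add])
    (by simp [add_def, suc_add]) a ![b, c]
  simpa [add_def] using this

protected theorem add_left_cancel (a b c : w.D) (h : a + b = a + c) : b = c := by
  have := induct (Ξ := Ξ) (n := 2) (.imp (.eq (.app .add ![var 0, var 1])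
    (.app .add ![var 0, var 2])) (.eq (var 1) (var 2)))
    (by simp [add_def, World.zero_add])
    (by simp [add_def, suc_add]) a ![b, c]
  simpa [add_def, h] using this

noncomputable instance : AddCancelCommMonoid w.D where
  add_assoc := World.add_assoc
  zero_add := World.zero_add
  add_zero := World.add_zero
  add_comm := World.add_comm
  nsmul := nsmulRec
  add_left_cancel a _ _ h := World.add_left_cancel a _ _ h

theorem suc_eq (a : w.D) : suc a = a + 1 := by
  rw [show (1 : w.D) = suc 0 from rfl, add_suc, add_zero]

theorem le_or_le (a b : w.D) : (∃ c, b = a + c) ∨ ∃ c, a = b + c := by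
  have := induct (Ξ := Ξ) (n := 1) (.or (.ex (.eq (var 2) (.app .add ![var 1, var 0])))
    (.ex (.eq (var 1) (.app .add ![var 2, var 0]))))
    (by simp [add_def]) (fun w x ρ h => ?_) a ![b]
  · simpa [add_def] using this
  · simp only [force_or, force_ex, force_eq, eval_var, eval_app₂, add_def] at h ⊢
    simp at h ⊢
    rcases h with ⟨c, h⟩ | ⟨c, h⟩
    · rcases zero_or_suc c with rfl | ⟨c, rfl⟩
      · exact .inr ⟨1, by rw [suc_eq, h, add_zero]⟩
      · exact .inl ⟨c, by rw [h, add_suc, suc_add]⟩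
    · exact .inr ⟨suc c, by rw [h, add_suc]⟩

theorem le_or_lt (a b : w.D) : (∃ c, b = a + c) ∨ ∃ c, a = suc (b + c) := by
  rcases le_or_le a b with h | ⟨c, h⟩
  · exact .inl h
  · rcases zero_or_suc c with rfl | ⟨c, rfl⟩
    · exact .inl ⟨0, by simp [h]⟩
    · exact .inr ⟨c, by rw [h, add_suc]⟩

/-- Complete induction for formulas with additional universally quantified variables. -/
theorem strong_induct {n : ℕ} (φ : Fm (n + 1))
    (hs : ∀ (w : World Ξ) (x : w.D),
      (∀ y c : w.D, x = suc (y + c) → ∀ ρ : Fin n → w.D, force φ (vecCons y ρ)) →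
      ∀ ρ : Fin n → w.D, force φ (vecCons x ρ))
    {w : World Ξ} (x : w.D) (ρ : Fin n → w.D) : force φ (vecCons x ρ) := by
  -- Ordinary induction on a bound `b` for the statement "if `b = y + c + 1`, then `φ(y)`", which
  -- covers all `y < b`. It is used with `b = x + 1`, `y = x` and `c = 0`.
  have := induct_alls (Ξ := Ξ) (n := n + 2) (.imp (.eq (var 0) (.succ (.app .add ![var 1, var 2])))
    (φ.ren (vecCons 1 fun i => i.succ.succ.succ))) (by simp) (fun w x IH ρ => ?_)
    (suc x) (vecCons x (vecCons 0 ρ))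
  · simpa [force_ren, add_def, map_cons] using this
  · simp only [force_imp_eq, force_ren, eval_var, eval_succ, eval_app₂, add_def, map_cons]
      at IH ⊢
    intro hx
    refine hs _ _ (fun y c hy τ => ?_) _
    refine IH (vecCons y (vecCons (c + ρ 1) τ)) ?_
    have hx : x = ρ 0 + ρ 1 := suc_inj.1 hx
    have hy : ρ 0 = suc (y + c) := hy
    change x = suc (y + (c + ρ 1))
    rw [hx, hy, suc_add, add_assoc]

/-! ### Cantor pairing -/

theorem pred_suc (a : w.D) : fn .pred ![suc a] = a := by
  rw [PR.pred, fn_prec_suc]; simp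

theorem pred_zero : fn .pred ![(0 : w.D)] = 0 := by
  rw [PR.pred, fn_prec_zero]; rfl

theorem sub_zero' (a : w.D) : fn .sub ![a, 0] = a := by
  simp only [PR.sub, fn_comp₂, fn_proj]
  simp [fn_prec_zero]

theorem sub_suc' (a b : w.D) : fn .sub ![a, suc b] = fn .pred ![fn .sub ![a, b]] := by
  simp only [PR.sub, fn_comp₂, fn_proj]
  simp [fn_prec_suc]

theorem suc_sub_suc (a b : w.D) : fn .sub ![suc a, suc b] = fn .sub ![a, b] := by
  have := induct (Ξ := Ξ) (n := 1) (.eq (.app .sub ![.succ (var 1), .succ (var 0)])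
    (.app .sub ![var 1, var 0]))
    (by simp [sub_suc', sub_zero', pred_suc]) (fun w x ρ h => ?_) b ![a]
  · simpa using this
  · simp at h ⊢
    rw [sub_suc', h, ← sub_suc']

theorem add_sub (a b : w.D) : fn .sub ![a + b, a] = b := by
  have := induct (Ξ := Ξ) (n := 1) (.eq (.app .sub ![.app .add ![var 0, var 1], var 0]) (var 1))
    (by simp [add_def, sub_zero']) (by simp [add_def, suc_add, suc_sub_suc]) a ![b]
  simpa [add_def] using this

theorem sub_add_self (a b : w.D) : fn .sub ![a, a + b] = 0 := by
  have h0 : fn .sub ![0, b] = (0 : w.D) := by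
    have := induct (Ξ := Ξ) (n := 0) (.eq (.app .sub ![.zero, var 0]) .zero)
      (by simp [sub_zero']) (fun w x ρ h => by simp at h ⊢; rw [sub_suc', h, pred_zero]) b ![]
    simpa using this
  have := induct (Ξ := Ξ) (n := 1) (.imp (.eq (.app .sub ![.zero, var 1]) .zero)
    (.eq (.app .sub ![var 0, .app .add ![var 0, var 1]]) .zero))
    (by simp [add_def]) (by simp [add_def, suc_add, suc_sub_suc]) a ![b]
  simpa [add_def, h0] using this

theorem ifz_zero (a b : w.D) : fn .ifz ![0, a, b] = a := by
  rw [PR.ifz, fn_prec_zero]; simp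

theorem ifz_suc (c a b : w.D) : fn .ifz ![suc c, a, b] = b := by
  rw [PR.ifz, fn_prec_suc]; simp

/-- Triangular numbers. -/
noncomputable def tri (a : w.D) : w.D := fn .tri ![a]

theorem tri_zero : tri (0 : w.D) = 0 := by
  rw [tri, PR.tri, fn_prec_zero]; rfl

theorem tri_suc (a : w.D) : tri (suc a) = tri a + suc a := by
  rw [tri, PR.tri, fn_prec_suc]
  simp [tri, PR.tri, add_def, add_suc, add_comm]
  rfl

theorem tri_add (a b : w.D) : ∃ c, tri (a + b) = tri a + c := by
  have := induct (Ξ := Ξ) (n := 1) (.ex (.eq (.app .tri ![.app .add ![var 2, var 1]])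
    (.app .add ![.app .tri ![var 2], var 0])))
    (by simp [add_def]) (fun w x ρ h => ?_) b ![a]
  · simpa [add_def, tri] using this
  · simp [add_def] at h ⊢
    obtain ⟨c, h⟩ := h
    refine ⟨c + suc (ρ 0 + x), ?_⟩
    have := tri_suc (ρ 0 + x)
    simp only [tri] at this
    rw [add_suc, this, h, add_assoc]

noncomputable def diag (a : w.D) : w.D := fn .diag ![a]

theorem diag_spec (a : w.D) : ∃ r s, a = tri (diag a) + r ∧ diag a = r + s := by
  have := induct (Ξ := Ξ) (n := 0) (.ex (.ex (.and (.eq (var 2) (.app .add ![.app .tri ![.app .diag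
    ![var 2]], var 1])) (.eq (.app .diag ![var 2]) (.app .add ![var 1, var 0])))))
    (fun w ρ => ?_) (fun w x ρ h => ?_) a ![]
  · simpa [tri, diag, add_def] using this
  · have h0 : diag (0 : w.D) = 0 := by rw [diag, PR.diag, fn_prec_zero]; rfl
    have h1 : tri (0 : w.D) = 0 := tri_zero
    simp only [tri, diag] at h0 h1
    refine force_ex.2 ⟨0, force_ex.2 ⟨0, ?_⟩⟩
    simp [add_def, h0, h1]
  · have hd : diag (suc x) = fn .ifz ![fn .sub ![tri (suc (diag x)), suc x], suc (diag x), diag x] := by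
      rw [diag, PR.diag, fn_prec_suc]; simp [tri, diag, PR.diag, suc]
    suffices H : ∃ r s, suc x = tri (diag (suc x)) + r ∧ diag (suc x) = r + s by
      simpa [tri, diag, add_def] using H
    obtain ⟨r, s, h1, h2⟩ : ∃ r s, x = tri (diag x) + r ∧ diag x = r + s := by
      simpa [tri, diag, add_def] using h
    rw [tri_suc] at hd
    -- If `s = 0`, then `x` is the last point of its diagonal and `x + 1` is the next triangular
    -- number. Otherwise `x + 1` lies on the same diagonal.
    rcases zero_or_suc s with rfl | ⟨s, rfl⟩
    · have h3 : suc x = tri (diag x) + suc (diag x) := by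
        nth_rw 1 [h1]; rw [h2, add_zero, add_suc]
      refine ⟨0, suc (diag x), ?_, ?_⟩
      · rw [hd, ← h3]
        have := sub_add_self (suc x) 0
        rw [add_zero] at this
        rw [this, ifz_zero, tri_suc, add_zero, ← h3]
      · rw [hd, ← h3]
        have := sub_add_self (suc x) 0
        rw [add_zero] at this
        rw [this, ifz_zero, zero_add]
    · have h3 : tri (diag x) + suc (diag x) = suc x + suc s := by
        conv_rhs => rw [h1]
        rw [h2]
        simp only [suc_eq]
        abel
      rw [h3, add_sub, ifz_suc] at hd
      refine ⟨suc r, s, ?_, ?_⟩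
      · rw [hd, add_suc, ← h1]
      · rw [hd, h2, suc_add, add_suc]

theorem tri_add_inj {d r s d' r' s' : w.D} (h : d = r + s) (h' : d' = r' + s')
    (H : tri d + r = tri d' + r') : d = d' := by
  -- If `d < d'`, then `tri d + r ≤ tri d + d < tri (d + 1) ≤ tri d'`, which contradicts equality of
  -- the sums.
  have key : ∀ {d r s d' r' : w.D} (c : w.D), d = r + s → d' = suc (d + c) →
      tri d + r = tri d' + r' → False := by
    intro d r s d' r' c h h' H
    obtain ⟨e, he⟩ := tri_add (suc d) c
    rw [← suc_add] at h'
    rw [h', he, tri_suc, add_assoc, add_assoc, add_right_inj, h] at H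
    have : r + suc (s + (e + r')) = r + 0 := by
      rw [add_zero]
      refine Eq.trans ?_ H.symm
      simp only [suc_eq]
      abel
    simp at this
  rcases le_or_lt d d' with ⟨c, hc⟩ | ⟨c, hc⟩
  · rcases zero_or_suc c with rfl | ⟨c, rfl⟩
    · simp [hc]
    · exact (key c h (by rw [hc, add_suc]) H).elim
  · exact (key c h' hc H.symm).elim

/-- The Cantor pairing function. -/
noncomputable def pair (a b : w.D) : w.D := fn .pair ![a, b]
/-- The left projection. -/
noncomputable def left (a : w.D) : w.D := fn .left ![a]
/-- The right projection. -/
noncomputable def right (a : w.D) : w.D := fn .right ![a]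

theorem pair_eq (a b : w.D) : pair a b = tri (a + b) + b := by
  simp [pair, PR.pair, tri, add_def]

theorem right_eq {a r : w.D} (h : a = tri (diag a) + r) : right a = r := by
  have : right a = fn .sub ![a, tri (diag a)] := by simp [right, PR.right, tri, diag]
  rw [this]
  nth_rw 1 [h]
  exact add_sub _ _

theorem left_eq {a r s : w.D} (h : a = tri (diag a) + r) (h' : diag a = r + s) : left a = s := by
  have : left a = fn .sub ![diag a, right a] := by simp [left, PR.left, right, diag]
  rw [this, right_eq h, h', add_sub]

theorem diag_pair (a b : w.D) : diag (pair a b) = a + b := by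
  obtain ⟨r, s, h, h'⟩ := diag_spec (pair a b)
  exact tri_add_inj h' (add_comm a b) (h.symm.trans (pair_eq a b))

@[simp] theorem right_pair (a b : w.D) : right (pair a b) = b :=
  right_eq (by rw [diag_pair, pair_eq])

@[simp] theorem left_pair (a b : w.D) : left (pair a b) = a :=
  left_eq (r := b) (by rw [diag_pair, pair_eq]) (by rw [diag_pair, add_comm])

@[simp] theorem pair_left_right (a : w.D) : pair (left a) (right a) = a := by
  obtain ⟨r, s, h, h'⟩ := diag_spec a
  rw [right_eq h, left_eq h h', pair_eq, add_comm s, ← h', ← h]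

@[simp] theorem pair_inj {a b c d : w.D} : pair a b = pair c d ↔ a = c ∧ b = d :=
  ⟨fun h => ⟨by simpa using congrArg left h, by simpa using congrArg right h⟩,
    fun h => by rw [h.1, h.2]⟩

theorem exists_pair (a : w.D) : ∃ b c, a = pair b c := ⟨_, _, (pair_left_right a).symm⟩

@[simp] theorem eval_pair {n : ℕ} (s t : Tm n) (ρ : Fin n → w.D) :
    (s.pair t).eval ρ = pair (s.eval ρ) (t.eval ρ) := eval_app₂ _ _ _ _
@[simp] theorem eval_left {n : ℕ} (t : Tm n) (ρ : Fin n → w.D) :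
    t.left.eval ρ = left (t.eval ρ) := eval_app₁ _ _ _
@[simp] theorem eval_right {n : ℕ} (t : Tm n) (ρ : Fin n → w.D) :
    t.right.eval ρ = right (t.eval ρ) := eval_app₁ _ _ _
@[simp] theorem eval_out {n : ℕ} (t : Tm n) (ρ : Fin n → w.D) :
    t.out.eval ρ = right (t.eval ρ) := eval_app₁ _ _ _

theorem Hom.fn₁ (f : Hom w w') (g : PR 1) (a : w.D) : f (World.fn g ![a]) = World.fn g ![f a] := by
  rw [f.fn, map_cons f, Subsingleton.elim (fun i : Fin 0 => _) ![]]

theorem Hom.fn₂ (f : Hom w w') (g : PR 2) (a b : w.D) :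
    f (World.fn g ![a, b]) = World.fn g ![f a, f b] := by
  rw [f.fn, map_cons f, map_cons f, Subsingleton.elim (fun i : Fin 0 => _) ![]]

attribute [simp] Hom.suc Hom.zero
@[simp] theorem Hom.pair (f : Hom w w') (a b : w.D) : f (pair a b) = World.pair (f a) (f b) :=
  f.fn₂ _ _ _
@[simp] theorem Hom.left (f : Hom w w') (a : w.D) : f (left a) = World.left (f a) := f.fn₁ _ _
@[simp] theorem Hom.right (f : Hom w w') (a : w.D) : f (right a) = World.right (f a) := f.fn₁ _ _

end World

/-! ### Computability in a world -/

namespace World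

variable {w w' : World Ξ}

/-! ### The universal machine -/

/-- Numerals. -/
noncomputable def nm : ℕ → w.D
  | 0 => 0
  | c + 1 => suc (nm c)

@[simp] theorem Hom.nm (f : Hom w w') (c : ℕ) : f (nm c) = World.nm c := by
  induction c with
  | zero => exact f.zero
  | succ c ih => simp [World.nm, ih]

section
variable {k : ℕ} (v : Fin k → w.D)

@[simp] theorem fn_num (c : ℕ) : fn (.num c) v = nm c := by
  induction c with
  | zero => exact fn_comp₀ _ _ _
  | succ c ih => simp [PR.num, nm, ih]; rfl

@[simp] theorem fn_S (a : PR k) : fn (.S a) v = suc (fn a v) := fn_comp₁ _ _ _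
@[simp] theorem fn_P (a : PR k) : fn (.P a) v = fn .pred ![fn a v] := fn_comp₁ _ _ _
@[simp] theorem fn_L (a : PR k) : fn (.L a) v = left (fn a v) := fn_comp₁ _ _ _
@[simp] theorem fn_R (a : PR k) : fn (.R a) v = right (fn a v) := fn_comp₁ _ _ _
@[simp] theorem fn_pr (a b : PR k) : fn (.pr a b) v = pair (fn a v) (fn b v) := fn_comp₂ _ _ _ _

open Classical in
@[simp] theorem fn_ite (c a b : PR k) :
    fn (.ite c a b) v = if fn c v = 0 then fn a v else fn b v := by
  rw [PR.ite, fn_comp₃]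
  rcases zero_or_suc (fn c v) with h | ⟨d, h⟩
  · simp [h, ifz_zero]
  · simp [h, ifz_suc]

end

@[simp] theorem pred_suc' (a : w.D) : fn .pred ![suc a] = a := pred_suc a

/-- The state "evaluate `e` on input `n`, then go on with `K`". -/
noncomputable def ev (e n K : w.D) : w.D := pair (nm 0) (pair e (pair n K))
/-- The state "return `v` to `K`". -/
noncomputable def rt (v K : w.D) : w.D := pair (nm 1) (pair v K)
/-- The stack `K` with a frame on top. -/
noncomputable def psh (t : ℕ) (d K : w.D) : w.D := suc (pair (pair (nm t) d) K)

/-- One step of the machine. -/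
noncomputable def stp (s : w.D) : w.D := fn .step ![s]

theorem stp_ev_simp (e n K : w.D) : stp (ev e n K) = fn (.evalStep (.L (.R (.proj 0)))
    (.L (.R (.R (.proj 0)))) (.R (.R (.R (.proj 0))))) ![ev e n K] := by
  simp [stp, PR.step, ev, nm]

variable (e n K f g u v x m d a : w.D)

theorem stp_ev_zero : stp (ev (pair (nm 0) a) n K) = rt 0 K := by
  rw [stp_ev_simp]
  simp [PR.evalStep, PR.switch, PR.retSt, ev, rt, nm]

theorem stp_ev_succ : stp (ev (pair (nm 1) a) n K) = rt (suc n) K := by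
  rw [stp_ev_simp]
  simp [PR.evalStep, PR.switch, PR.retSt, ev, rt, nm]

theorem stp_ev_left : stp (ev (pair (nm 2) a) n K) = rt (left n) K := by
  rw [stp_ev_simp]
  simp [PR.evalStep, PR.switch, PR.retSt, ev, rt, nm]

theorem stp_ev_right : stp (ev (pair (nm 3) a) n K) = rt (right n) K := by
  rw [stp_ev_simp]
  simp [PR.evalStep, PR.switch, PR.retSt, ev, rt, nm]

theorem stp_ev_pair : stp (ev (pair (nm 4) (pair f g)) n K) = ev f n (psh 0 (pair g n) K) := by
  rw [stp_ev_simp]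
  simp [PR.evalStep, PR.switch, PR.evalSt, PR.push, ev, psh, nm]

theorem stp_ev_comp : stp (ev (pair (nm 5) (pair f g)) n K) = ev g n (psh 2 f K) := by
  rw [stp_ev_simp]
  simp [PR.evalStep, PR.switch, PR.evalSt, PR.push, ev, psh, nm]

theorem stp_ev_prec_zero : stp (ev (pair (nm 6) (pair f g)) (pair x 0) K) = ev f x K := by
  rw [stp_ev_simp]
  simp [PR.evalStep, PR.switch, PR.evalSt, PR.push, ev, nm]

theorem stp_ev_prec_suc : stp (ev (pair (nm 6) (pair f g)) (pair x (suc m)) K) =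
    ev (pair (nm 6) (pair f g)) (pair x m) (psh 3 (pair g (pair x m)) K) := by
  rw [stp_ev_simp]
  simp [PR.evalStep, PR.switch, PR.evalSt, PR.push, ev, psh, nm]

theorem stp_ev_min : stp (ev (pair (suc (suc (suc (suc (suc (suc (suc a))))))) f) n K) =
    ev f n (psh 4 (pair (pair (suc (suc (suc (suc (suc (suc (suc a))))))) f) n) K) := by
  rw [stp_ev_simp]
  simp [PR.evalStep, PR.switch, PR.evalSt, PR.push, ev, psh, nm]

theorem stp_rt_simp (t : ℕ) : stp (rt v (psh t d K)) = fn (.retStep (.L (.R (.proj 0)))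
    (.L (.L (.P (.R (.R (.proj 0)))))) (.R (.L (.P (.R (.R (.proj 0))))))
    (.R (.P (.R (.R (.proj 0)))))) ![rt v (psh t d K)] := by
  simp [stp, PR.step, rt, nm, psh]

theorem stp_rt_zero : stp (rt v 0) = rt v 0 := by
  simp [stp, PR.step, rt, nm]

theorem stp_rt_pair : stp (rt v (psh 0 (pair g n) K)) = ev g n (psh 1 v K) := by
  rw [stp_rt_simp]
  simp [PR.retStep, PR.switch, PR.evalSt, PR.push, ev, rt, psh, nm]

theorem stp_rt_pair' : stp (rt v (psh 1 u K)) = rt (pair u v) K := by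
  rw [stp_rt_simp]
  simp [PR.retStep, PR.switch, PR.retSt, PR.push, rt, psh, nm]

theorem stp_rt_comp : stp (rt v (psh 2 f K)) = ev f v K := by
  rw [stp_rt_simp]
  simp [PR.retStep, PR.switch, PR.evalSt, PR.push, ev, rt, psh, nm]

theorem stp_rt_prec : stp (rt v (psh 3 (pair g (pair x m)) K)) = ev g (pair x (pair m v)) K := by
  rw [stp_rt_simp]
  simp [PR.retStep, PR.switch, PR.evalSt, PR.push, ev, rt, psh, nm]

theorem stp_rt_min_zero : stp (rt 0 (psh 4 (pair e (pair x m)) K)) = rt m K := by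
  rw [stp_rt_simp]
  simp [PR.retStep, PR.switch, PR.retSt, PR.push, rt, psh, nm]

theorem stp_rt_min_suc : stp (rt (suc v) (psh 4 (pair e (pair x m)) K)) =
    ev e (pair x (suc m)) K := by
  rw [stp_rt_simp]
  simp [PR.retStep, PR.switch, PR.evalSt, PR.push, ev, rt, psh, nm]

end World

namespace World

variable {w w' : World Ξ}

/-! ### Runs of the machine -/

/-- The state which is reached from `s` after `t` steps. -/
noncomputable def rn (t s : w.D) : w.D := fn .run ![t, s]

@[simp] theorem rn_zero (s : w.D) : rn 0 s = s := by
  rw [rn, PR.run, fn_prec_zero]; simp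

theorem rn_suc' (t s : w.D) : rn (suc t) s = stp (rn t s) := by
  rw [rn, PR.run, fn_prec_suc]; simp [rn, stp, PR.run]

theorem rn_add (a b s : w.D) : rn (a + b) s = rn a (rn b s) := by
  have := induct (Ξ := Ξ) (n := 2) (.eq (.app .run ![.app .add ![var 0, var 1], var 2])
    (.app .run ![var 0, .app .run ![var 1, var 2]])) ?_ ?_ a ![b, s]
  · simpa [add_def, rn] using this
  · intro w ρ
    have := rn_zero (rn (ρ 0) (ρ 1))
    simpa [add_def, rn] using this.symm
  · intro w x ρ h
    have h1 := rn_suc' (x + ρ 0) (ρ 1)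
    have h2 := rn_suc' x (rn (ρ 0) (ρ 1))
    simp only [rn] at h1 h2
    simp [add_def, suc_add] at h ⊢
    rw [h1, h2, h]

theorem rn_suc (t s : w.D) : rn (suc t) s = rn t (stp s) := by
  rw [suc_eq, rn_add, show (1 : w.D) = suc 0 from rfl, rn_suc', rn_zero]

theorem rn_rt_zero (t v : w.D) : rn t (rt v 0) = rt v 0 := by
  have := induct (Ξ := Ξ) (n := 1) (.eq (.app .run ![var 0, .pair (.succ .zero) (.pair (var 1) .zero)])
    (.pair (.succ .zero) (.pair (var 1) .zero))) ?_ ?_ t ![v]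
  · simpa [rn, rt, nm] using this
  · intro w ρ
    have := rn_zero (rt (ρ 0) 0)
    simpa [rn, rt, nm] using this
  · intro w x ρ h
    have h1 := rn_suc' x (rt (ρ 0) 0)
    have h2 := stp_rt_zero (ρ 0)
    simp only [rn, rt, nm] at h1 h2
    simp at h ⊢
    rw [h1, h, h2]

/-- `s'` can be reached from `s`. -/
def Reach (s s' : w.D) : Prop := ∃ t, rn t s = s'

theorem Reach.refl (s : w.D) : Reach s s := ⟨0, rn_zero s⟩

theorem Reach.trans {s s' s'' : w.D} : Reach s s' → Reach s' s'' → Reach s s'' := by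
  rintro ⟨t, rfl⟩ ⟨t', rfl⟩
  exact ⟨t' + t, rn_add _ _ _⟩

theorem Reach.step {s s' s'' : w.D} (h : stp s = s') (h' : Reach s' s'') : Reach s s'' := by
  obtain ⟨t, rfl⟩ := h'
  exact ⟨suc t, by rw [rn_suc, h]⟩

/-- The run from `s` with `t` steps to go reaches `s'` with `t'` steps to go. -/
def Seg (t s t' s' : w.D) : Prop := ∃ a, t = t' + a ∧ rn a s = s'

theorem Seg.refl (t s : w.D) : Seg t s t s := ⟨0, by simp⟩

theorem Seg.trans {t s t' s' t'' s'' : w.D} : Seg t s t' s' → Seg t' s' t'' s'' →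
    Seg t s t'' s'' := by
  rintro ⟨a, rfl, rfl⟩ ⟨b, rfl, rfl⟩
  exact ⟨b + a, by rw [add_assoc], rn_add _ _ _⟩

theorem Seg.step {t s s' t'' s'' : w.D} (h : stp s = s') (h' : Seg t s' t'' s'') :
    Seg (suc t) s t'' s'' := by
  obtain ⟨a, rfl, rfl⟩ := h'
  exact ⟨suc a, by rw [add_suc], by rw [rn_suc, h]⟩

theorem Seg.rn {t s t' s' : w.D} (h : Seg t s t' s') : rn t s = World.rn t' s' := by
  obtain ⟨a, rfl, rfl⟩ := h
  exact rn_add _ _ _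

theorem Seg.le {t s t' s' : w.D} (h : Seg t s t' s') : ∃ a, t = t' + a := h.imp fun _ h => h.1

theorem ev_ne_rt (e n K v K' : w.D) : ev e n K ≠ rt v K' := by
  simp [ev, rt, nm]

theorem rt_inj {v K v' K' : w.D} : rt v K = rt v' K' ↔ v = v' ∧ K = K' := by
  simp [rt]

/-- The final state has an empty stack, so with a frame still pending the run must take another
step. -/
theorem pop {t u d K v : w.D} {j : ℕ} (h : rn t (rt u (psh j d K)) = rt v 0) :
    ∃ t', t = suc t' ∧ rn t' (stp (rt u (psh j d K))) = rt v 0 := by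
  rcases zero_or_suc t with rfl | ⟨t, rfl⟩
  · rw [rn_zero, rt_inj] at h
    simp [psh] at h
  · exact ⟨t, rfl, by rwa [rn_suc] at h⟩

/-- The evaluation of `e` on input `n` ends, and does not depend on the stack. -/
def Dec (t e n K K' : w.D) : Prop :=
  ∃ u t', Seg t (ev e n K) t' (rt u K) ∧ Reach (ev e n K') (rt u K')

theorem Dec.of_step {t e n K K' u : w.D} (h : stp (ev e n K) = rt u K)
    (h' : stp (ev e n K') = rt u K') : Dec (suc t) e n K K' :=
  ⟨u, t, .step h (.refl _ _), .step h' (.refl _)⟩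

theorem tag_cases (t : w.D) : t = nm 0 ∨ t = nm 1 ∨ t = nm 2 ∨ t = nm 3 ∨ t = nm 4 ∨ t = nm 5 ∨
    t = nm 6 ∨ ∃ a, t = suc (suc (suc (suc (suc (suc (suc a)))))) := by
  rcases zero_or_suc t with rfl | ⟨t, rfl⟩
  · simp [nm]
  rcases zero_or_suc t with rfl | ⟨t, rfl⟩
  · simp [nm]
  rcases zero_or_suc t with rfl | ⟨t, rfl⟩
  · simp [nm]
  rcases zero_or_suc t with rfl | ⟨t, rfl⟩
  · simp [nm]
  rcases zero_or_suc t with rfl | ⟨t, rfl⟩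
  · simp [nm]
  rcases zero_or_suc t with rfl | ⟨t, rfl⟩
  · simp [nm]
  rcases zero_or_suc t with rfl | ⟨t, rfl⟩
  · simp [nm]
  · simp [nm]

/-- The computation of `e` on `n` never looks below its own stack. Case distinction on the program:
each subcomputation starts later, hence has a shorter run, and the induction hypothesis describes it
both above `K` and above `K'`. -/
theorem dec_step {T : w.D} (IH : ∀ t c : w.D, T = suc (t + c) → ∀ e n K K' v : w.D,
    rn t (ev e n K) = rt v 0 → Dec t e n K K') (e n K K' v : w.D)
    (h : rn T (ev e n K) = rt v 0) : Dec T e n K K' := by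
  rcases zero_or_suc T with rfl | ⟨T, rfl⟩
  · rw [rn_zero] at h
    exact (ev_ne_rt _ _ _ _ _ h).elim
  -- After the first step `T` steps are left, so the hypothesis applies to all runs of length at
  -- most `T`.
  replace IH : ∀ {t : w.D}, (∃ c, T = t + c) → ∀ {e n K : w.D} (K' : w.D),
      rn t (ev e n K) = rt v 0 → Dec t e n K K' :=
    fun ⟨c, hc⟩ e n K K' h => IH _ c (by rw [hc]) _ _ _ _ _ h
  rw [rn_suc] at h
  obtain ⟨tag, a, rfl⟩ := exists_pair e
  obtain ⟨f, g, rfl⟩ := exists_pair a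
  rcases tag_cases tag with rfl | rfl | rfl | rfl | rfl | rfl | rfl | ⟨tag, rfl⟩
  · exact .of_step (stp_ev_zero _ _ _) (stp_ev_zero _ _ _)
  · exact .of_step (stp_ev_succ _ _ _) (stp_ev_succ _ _ _)
  · exact .of_step (stp_ev_left _ _ _) (stp_ev_left _ _ _)
  · exact .of_step (stp_ev_right _ _ _) (stp_ev_right _ _ _)
  · rw [stp_ev_pair] at h
    obtain ⟨u₁, t₁, s₁, r₁⟩ := IH ⟨0, (add_zero T).symm⟩ (psh 0 (pair g n) K') h
    rw [s₁.rn] at h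
    obtain ⟨t₁, rfl, h₁⟩ := pop h
    rw [stp_rt_pair] at h₁
    have s₂ := s₁.trans (.step (stp_rt_pair _ _ _ _) (.refl _ _))
    obtain ⟨u₂, t₂, s₃, r₂⟩ := IH s₂.le (psh 1 u₁ K') h₁
    rw [s₃.rn] at h₁
    obtain ⟨t₂, rfl, h₂⟩ := pop h₁
    refine ⟨pair u₁ u₂, t₂, .step (stp_ev_pair _ _ _ _) (s₂.trans (s₃.trans
      (.step (stp_rt_pair' _ _ _) (.refl _ _)))), ?_⟩
    exact .step (stp_ev_pair _ _ _ _) (r₁.trans (.step (stp_rt_pair _ _ _ _) (r₂.trans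
      (.step (stp_rt_pair' _ _ _) (.refl _)))))
  · rw [stp_ev_comp] at h
    obtain ⟨u₁, t₁, s₁, r₁⟩ := IH ⟨0, (add_zero T).symm⟩ (psh 2 f K') h
    rw [s₁.rn] at h
    obtain ⟨t₁, rfl, h₁⟩ := pop h
    rw [stp_rt_comp] at h₁
    have s₂ := s₁.trans (.step (stp_rt_comp _ _ _) (.refl _ _))
    obtain ⟨u₂, t₂, s₃, r₂⟩ := IH s₂.le K' h₁
    exact ⟨u₂, t₂, .step (stp_ev_comp _ _ _ _) (s₂.trans s₃),
      .step (stp_ev_comp _ _ _ _) (r₁.trans (.step (stp_rt_comp _ _ _) r₂))⟩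
  · obtain ⟨x, m, rfl⟩ := exists_pair n
    rcases zero_or_suc m with rfl | ⟨m, rfl⟩
    · rw [stp_ev_prec_zero] at h
      obtain ⟨u₁, t₁, s₁, r₁⟩ := IH ⟨0, (add_zero T).symm⟩ K' h
      exact ⟨u₁, t₁, .step (stp_ev_prec_zero _ _ _ _) s₁, .step (stp_ev_prec_zero _ _ _ _) r₁⟩
    · rw [stp_ev_prec_suc] at h
      obtain ⟨u₁, t₁, s₁, r₁⟩ := IH ⟨0, (add_zero T).symm⟩ (psh 3 (pair g (pair x m)) K') h
      rw [s₁.rn] at h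
      obtain ⟨t₁, rfl, h₁⟩ := pop h
      rw [stp_rt_prec] at h₁
      have s₂ := s₁.trans (.step (stp_rt_prec _ _ _ _ _) (.refl _ _))
      obtain ⟨u₂, t₂, s₃, r₂⟩ := IH s₂.le K' h₁
      exact ⟨u₂, t₂, .step (stp_ev_prec_suc _ _ _ _ _) (s₂.trans s₃),
        .step (stp_ev_prec_suc _ _ _ _ _) (r₁.trans (.step (stp_rt_prec _ _ _ _ _) r₂))⟩
  · obtain ⟨x, m, rfl⟩ := exists_pair n
    rw [stp_ev_min] at h
    generalize hE : pair (suc (suc (suc (suc (suc (suc (suc tag))))))) (pair f g) = E at *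
    have hst : ∀ K, stp (ev E (pair x m) K) = ev (pair f g) (pair x m) (psh 4 (pair E (pair x m)) K) := by
      intro K
      rw [← hE, stp_ev_min]
    obtain ⟨u₁, t₁, s₁, r₁⟩ := IH ⟨0, (add_zero T).symm⟩ (psh 4 (pair E (pair x m)) K') h
    rw [s₁.rn] at h
    obtain ⟨t₁, rfl, h₁⟩ := pop h
    rcases zero_or_suc u₁ with rfl | ⟨u, rfl⟩
    · exact ⟨m, t₁, .step (hst _) (s₁.trans (.step (stp_rt_min_zero _ _ _ _) (.refl _ _))),
        .step (hst _) (r₁.trans (.step (stp_rt_min_zero _ _ _ _) (.refl _)))⟩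
    · rw [stp_rt_min_suc] at h₁
      have s₂ := s₁.trans (.step (stp_rt_min_suc _ _ _ _ _) (.refl _ _))
      obtain ⟨u₂, t₂, s₃, r₂⟩ := IH s₂.le K' h₁
      exact ⟨u₂, t₂, .step (hst _) (s₂.trans s₃),
        .step (hst _) (r₁.trans (.step (stp_rt_min_suc _ _ _ _ _) r₂))⟩

/-- The state "evaluate `e` on input `n`, then go on with `K`". -/
def _root_.VSet.Tm.ev {k : ℕ} (e n K : Tm k) : Tm k := .pair .zero (.pair e (.pair n K))
/-- The state "return `v` to `K`". -/
def _root_.VSet.Tm.rt {k : ℕ} (v K : Tm k) : Tm k := .pair (.succ .zero) (.pair v K)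

@[simp] theorem eval_ev {k : ℕ} (e n K : Tm k) (ρ : Fin k → w.D) :
    (Tm.ev e n K).eval ρ = ev (e.eval ρ) (n.eval ρ) (K.eval ρ) := by
  simp [Tm.ev, ev, nm]

@[simp] theorem eval_rt {k : ℕ} (v K : Tm k) (ρ : Fin k → w.D) :
    (Tm.rt v K).eval ρ = rt (v.eval ρ) (K.eval ρ) := by
  simp [Tm.rt, rt, nm]

theorem rn_def (t s : w.D) : fn .run ![t, s] = rn t s := rfl

theorem dec {t e n K v : w.D} (K' : w.D) (h : rn t (ev e n K) = rt v 0) : Dec t e n K K' := by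
  -- Running times may be nonstandard, so `Dec` is written out as a formula to make complete
  -- induction in the theory applicable.
  have := strong_induct (Ξ := Ξ) (n := 5)
    (.imp (.eq (.app .run ![var 0, .ev (var 1) (var 2) (var 3)]) (.rt (var 5) .zero))
      (.ex (.ex (.and
        (.ex (.and (.eq (var 3) (.app .add ![var 1, var 0]))
          (.eq (.app .run ![var 0, .ev (var 4) (var 5) (var 6)]) (.rt (var 2) (var 6)))))
        (.ex (.eq (.app .run ![var 0, .ev (var 4) (var 5) (var 7)]) (.rt (var 2) (var 7))))))))
    ?_ t ![e, n, K, K', v]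
  · simp only [force_imp_eq, force_ex, force_and, force_eq, eval_app₂, add_def, rn_def, eval_ev,
      eval_rt, eval_var, eval_zero] at this
    exact this h
  · intro w T IH ρ
    have := dec_step (T := T) (fun t c hc e n K K' v h => by
      have := IH t c hc ![e, n, K, K', v]
      simp only [force_imp_eq, force_ex, force_and, force_eq, eval_app₂, add_def, rn_def, eval_ev,
        eval_rt, eval_var, eval_zero] at this
      exact this h)
    have := this (ρ 0) (ρ 1) (ρ 2) (ρ 3) (ρ 4)
    simp only [Dec, Seg, Reach] at this
    simp only [force_imp_eq, force_ex, force_and, force_eq, eval_app₂, add_def, rn_def, eval_ev,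
      eval_rt, eval_var, eval_zero]
    exact this

/-! ### Application -/

/-- The value of the program `e` on input `n` is `v`. -/
def Ap (e n v : w.D) : Prop := Reach (ev e n 0) (rt v 0)

/-- The shorter run has halted, and halted states do not change. -/
theorem halt_unique {s t v t' v' : w.D} (h : rn t s = rt v 0) (h' : rn t' s = rt v' 0) :
    v = v' := by
  rcases le_or_le t t' with ⟨c, rfl⟩ | ⟨c, rfl⟩
  · rw [add_comm, rn_add, h, rn_rt_zero, rt_inj] at h'
    exact h'.1
  · rw [add_comm, rn_add, h', rn_rt_zero, rt_inj] at h
    exact h.1.symm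

theorem Ap.unique {e n v v' : w.D} (h : Ap e n v) (h' : Ap e n v') : v = v' :=
  halt_unique h.choose_spec h'.choose_spec

/-- A computation on the empty stack can be transplanted onto any stack. Together with the converse
`ap_of_halt` this makes programs compositional. -/
theorem Ap.reach {e n v : w.D} (h : Ap e n v) (K : w.D) : Reach (ev e n K) (rt v K) := by
  obtain ⟨t, h⟩ := h
  obtain ⟨u, t', s, r⟩ := dec K h
  rw [s.rn, rn_rt_zero, rt_inj] at h
  rwa [h.1] at r

theorem ap_of_halt {t e n K v : w.D} (h : rn t (ev e n K) = rt v 0) :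
    ∃ u t', Ap e n u ∧ rn t' (rt u K) = rt v 0 := by
  obtain ⟨u, t', s, r⟩ := dec 0 h
  exact ⟨u, t', r, by rw [← s.rn, h]⟩

theorem Ap.map {e n v : w.D} (h : Ap e n v) (f : Hom w w') : Ap (f e) (f n) (f v) := by
  obtain ⟨t, h⟩ := h
  refine ⟨f t, ?_⟩
  have := congrArg f h
  simpa only [rn, f.fn₂, ev, rt, f.pair, f.nm, f.zero] using this

/-- Composition of programs. -/
noncomputable def cmp (f g : w.D) : w.D := pair (nm 5) (pair f g)
/-- Pairing of programs. -/
noncomputable def prg (f g : w.D) : w.D := pair (nm 4) (pair f g)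

@[simp] theorem Hom.cmp (f : Hom w w') (a b : w.D) : f (cmp a b) = World.cmp (f a) (f b) := by
  simp [World.cmp]
@[simp] theorem Hom.prg (f : Hom w w') (a b : w.D) : f (prg a b) = World.prg (f a) (f b) := by
  simp [World.prg]

theorem ap_cmp {f g n v : w.D} : Ap (cmp f g) n v ↔ ∃ u, Ap g n u ∧ Ap f u v := by
  constructor
  · rintro ⟨t, h⟩
    rcases zero_or_suc t with rfl | ⟨t, rfl⟩
    · rw [rn_zero] at h
      exact (ev_ne_rt _ _ _ _ _ h).elim
    · rw [rn_suc, cmp, stp_ev_comp] at h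
      obtain ⟨u, t', h1, h2⟩ := ap_of_halt h
      obtain ⟨t', rfl, h3⟩ := pop h2
      rw [stp_rt_comp] at h3
      exact ⟨u, h1, t', h3⟩
  · rintro ⟨u, h1, h2⟩
    exact .step (stp_ev_comp _ _ _ _) ((h1.reach _).trans (.step (stp_rt_comp _ _ _) h2))

theorem ap_prg {f g n v : w.D} : Ap (prg f g) n v ↔ ∃ u u', Ap f n u ∧ Ap g n u' ∧ v = pair u u' := by
  constructor
  · rintro ⟨t, h⟩
    rcases zero_or_suc t with rfl | ⟨t, rfl⟩
    · rw [rn_zero] at h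
      exact (ev_ne_rt _ _ _ _ _ h).elim
    · rw [rn_suc, prg, stp_ev_pair] at h
      obtain ⟨u, t₁, h1, h2⟩ := ap_of_halt h
      obtain ⟨t₂, rfl, h3⟩ := pop h2
      rw [stp_rt_pair] at h3
      obtain ⟨u', t₃, h4, h5⟩ := ap_of_halt h3
      obtain ⟨t₄, rfl, h6⟩ := pop h5
      rw [stp_rt_pair', rn_rt_zero, rt_inj] at h6
      exact ⟨u, u', h1, h4, h6.1.symm⟩
  · rintro ⟨u, u', h1, h2, rfl⟩
    exact .step (stp_ev_pair _ _ _ _) ((h1.reach _).trans (.step (stp_rt_pair _ _ _ _)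
      ((h2.reach _).trans (.step (stp_rt_pair' _ _ _) (.refl _)))))

theorem ap_left {a n v : w.D} : Ap (pair (nm 2) a) n v ↔ v = left n := by
  have : Ap (pair (nm 2) a) n (left n) := .step (stp_ev_left _ _ _) (.refl _)
  exact ⟨fun h => h.unique this, fun h => h ▸ this⟩

theorem ap_right {a n v : w.D} : Ap (pair (nm 3) a) n v ↔ v = right n := by
  have : Ap (pair (nm 3) a) n (right n) := .step (stp_ev_right _ _ _) (.refl _)
  exact ⟨fun h => h.unique this, fun h => h ▸ this⟩

/-- The identity program. -/
noncomputable def idp (w : World Ξ) : w.D := prg (pair (nm 2) 0) (pair (nm 3) 0)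

@[simp] theorem Hom.idp (f : Hom w w') : f w.idp = w'.idp := by
  simp [World.idp]

@[simp] theorem ap_idp {n v : w.D} : Ap w.idp n v ↔ v = n := by
  simp [idp, ap_prg, ap_left, ap_right]

/-- A program which is nowhere defined. -/
noncomputable def divp (w : World Ξ) : w.D := pair (nm 7) (pair (nm 1) 0)

/-- The program minimises the successor function, which has no zero. Three steps after the search
starts at `m` it starts again at `m + 1`, so a halting run would contain a shorter one. -/
theorem not_ap_divp {n v : w.D} : ¬ Ap w.divp n v := by
  rintro ⟨t, h⟩
  have := strong_induct (Ξ := Ξ) (n := 2) (.imp (.eq (.app .run ![var 0,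
    .ev (.pair (.succ (.succ (.succ (.succ (.succ (.succ (.succ .zero)))))))
      (.pair (.succ .zero) .zero)) (var 1) .zero]) (.rt (var 2) .zero)) .bot) ?_ t ![n, v]
  · simp only [force_imp_eq, eval_app₂, rn_def, eval_ev, eval_rt, eval_var, eval_zero,
      eval_pair, eval_succ] at this
    exact not_force_bot (this h)
  · clear h
    intro w T IH ρ
    simp only [force_imp_eq, eval_app₂, rn_def, eval_ev, eval_rt, eval_var, eval_zero,
      eval_pair, eval_succ] at IH ⊢
    intro h
    obtain ⟨x, m, hn⟩ := exists_pair (ρ 0)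
    change rn T (ev w.divp (ρ 0) 0) = rt (ρ 1) 0 at h
    rw [hn] at h
    rcases zero_or_suc T with rfl | ⟨T, rfl⟩
    · rw [rn_zero] at h
      exact (ev_ne_rt _ _ _ _ _ h).elim
    rw [rn_suc, divp, nm, nm, nm, nm, nm, nm, nm, stp_ev_min] at h
    rcases zero_or_suc T with rfl | ⟨T, rfl⟩
    · rw [rn_zero] at h
      exact (ev_ne_rt _ _ _ _ _ h).elim
    rw [rn_suc, show pair (suc (nm 0)) (0 : w.D) = pair (nm 1) 0 from rfl, stp_ev_succ] at h
    obtain ⟨T, rfl, h'⟩ := pop h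
    rw [stp_rt_min_suc] at h'
    refine (not_force_bot (IH T (suc (suc 0)) ?_ ![pair x (suc m), ρ 1] h')).elim
    rw [add_suc, add_suc, add_zero]

end World

/-! ### The axioms on Church's Thesis, `Ξ` and v-sets in Kripke form -/

namespace World

variable {w w' : World Ξ}

/-! ### The axioms in a world -/

@[simp] theorem Hom.map_cons (f : Hom w w') {n : ℕ} (d : w.D) (ρ : Fin n → w.D) :
    (fun i => f (vecCons d ρ i)) = vecCons (f d) fun i => f (ρ i) := VSet.map_cons _ _ _

@[simp] theorem Hom.map_nil (f : Hom w w') : (fun i => f ((![] : Fin 0 → w.D) i)) = ![] :=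
  Subsingleton.elim _ _

attribute [simp] eval_cons eval_shift

theorem force_iff {n : ℕ} {φ ψ : Fm n} {ρ : Fin n → w.D} : force (φ.iff ψ) ρ ↔
    ∀ (w' : World Ξ) (f : Hom w w'), force φ (fun i => f (ρ i)) ↔ force ψ fun i => f (ρ i) := by
  rw [Fm.iff, force_and, force_imp, force_imp]
  exact ⟨fun h w' f => ⟨h.1 w' f, h.2 w' f⟩, fun h => ⟨fun w' f => (h w' f).1, fun w' f => (h w' f).2⟩⟩

theorem force_shift {n : ℕ} {φ : Fm n} {d : w.D} {ρ : Fin n → w.D} :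
    force φ.shift (vecCons d ρ) ↔ force φ ρ := by
  rw [Fm.shift_eq_ren, force_ren]
  rfl

attribute [simp] force_shift

theorem force_kleene {n : ℕ} {e i o : Tm n} {ρ : Fin n → w.D} : force (.kleene e i o) ρ ↔
    rn (left (o.eval ρ)) (ev (e.eval ρ) (i.eval ρ) 0) = rt (right (o.eval ρ)) 0 := by
  simp [Fm.kleene, rn, ev, rt, nm]

theorem exists_kleene {n : ℕ} {e i : Tm n} {ρ : Fin n → w.D} {v : w.D}
    (h : Ap (e.eval ρ) (i.eval ρ) v) :
    ∃ o, right o = v ∧ rn (left o) (ev (e.eval ρ) (i.eval ρ) 0) = rt (right o) 0 := by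
  obtain ⟨t, h⟩ := h
  exact ⟨pair t v, by simp, by simpa using h⟩

theorem force_ap {n : ℕ} {e i : Tm n} {P : Fm (n + 1)} {ρ : Fin n → w.D} : force (.ap e i P) ρ ↔
    ∃ v, Ap (e.eval ρ) (i.eval ρ) v ∧ force P (vecCons v ρ) := by
  simp only [Fm.ap, force_ex, force_and, force_kleene, force_subst, eval_cons, eval_shift, eval_out,
    eval_var, Matrix.cons_val_zero, Matrix.cons_val_succ]
  constructor
  · rintro ⟨o, h, h'⟩
    exact ⟨_, ⟨_, h⟩, h'⟩
  · rintro ⟨v, h, h'⟩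
    obtain ⟨o, rfl, ho⟩ := exists_kleene h
    exact ⟨o, ho, h'⟩

theorem force_defd {n : ℕ} {e i : Tm n} {ρ : Fin n → w.D} : force (.defd e i) ρ ↔
    ∃ v, Ap (e.eval ρ) (i.eval ρ) v := by
  simp only [Fm.defd, force_ex, force_kleene, eval_shift, eval_var, Matrix.cons_val_zero]
  constructor
  · rintro ⟨o, h⟩
    exact ⟨_, ⟨_, h⟩⟩
  · rintro ⟨v, h⟩
    obtain ⟨o, rfl, ho⟩ := exists_kleene h
    exact ⟨o, ho⟩

attribute [simp] force_ap force_defd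

theorem force_imp_kleene {n : ℕ} {e i o : Tm n} {φ : Fm n} {ρ : Fin n → w.D} :
    force (.imp (.kleene e i o) φ) ρ ↔
      (rn (left (o.eval ρ)) (ev (e.eval ρ) (i.eval ρ) 0) = rt (right (o.eval ρ)) 0 → force φ ρ) := by
  rw [← force_kleene, Fm.kleene, force_imp_eq, force_eq]

/-- The universal reading of application, `∀ o (T(e, i, o) → P(U(o)))`. Unlike `ap`, which puts `∃`
in front of `P`, it is almost-negative whenever `P` is. The readings agree where the value is
defined. -/
theorem force_kleene_imp {n : ℕ} {e i : Tm n} {P : Fm (n + 1)} {ρ : Fin n → w.D} :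
    force (.all (.imp (.kleene e.shift i.shift (var 0)) (P.subst (vecCons (var 0).out fun j => var j.succ))))
      ρ ↔ ∀ (w' : World Ξ) (f : Hom w w') (v : w'.D), Ap (f (e.eval ρ)) (f (i.eval ρ)) v →
        force P (vecCons v fun j => f (ρ j)) := by
  simp only [force_all, force_imp_kleene, force_subst, eval_cons, eval_shift, eval_out,
    eval_var, Matrix.cons_val_zero, Matrix.cons_val_succ, Hom.eval]
  constructor
  · rintro h w' f v h'
    obtain ⟨o, rfl, ho⟩ := exists_kleene h'
    exact h w' f o ho
  · rintro h w' f v h'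
    exact h w' f _ ⟨_, h'⟩

/-- Extended Church's Thesis. -/
theorem ect {n : ℕ} {φ : Fm (n + 1)} {ψ : Fm (n + 2)} (hφ : φ.AlmostNegative) {ρ : Fin n → w.D}
    (h : ∀ (w' : World Ξ) (f : Hom w w') (d : w'.D), force φ (vecCons d fun i => f (ρ i)) →
      ∃ m, force ψ (vecCons m (vecCons d fun i => f (ρ i)))) :
    ∃ e, ∀ (w' : World Ξ) (f : Hom w w') (d : w'.D), force φ (vecCons d fun i => f (ρ i)) →
      ∃ v, Ap (f e) d v ∧ force ψ (vecCons v (vecCons d fun i => f (ρ i))) := by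
  have := force_axm (Ξ := Ξ) ρ (.ect φ ψ hφ)
  rw [Fm.ect, force_imp] at this
  have := this w (.id w) ?_
  · obtain ⟨e, he⟩ := force_ex.1 this
    refine ⟨e, fun w' f d hd => ?_⟩
    have := (force_imp.1 (force_all.1 he w' f d)) w' (.id _)
    simpa [force_subst] using this (by simpa [force_subst])
  · simp only [force_all, force_imp, force_ex]
    intro w' f d w'' g h'
    simp only [Hom.map_cons] at h' ⊢
    exact h w'' (g.comp f) (g d) h'

/-- The function given by the symbol `Ξ`. -/
noncomputable def xi (f g : w.D) : w.D := fn Ξ ![f, g]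

theorem xi_def (f g : w.D) : fn Ξ ![f, g] = xi f g := rfl

@[simp] theorem Hom.xi (k : Hom w w') (f g : w.D) : k (xi f g) = World.xi (k f) (k g) :=
  k.fn₂ _ _ _

theorem M_xi {f g : w.D}
    (h : ∀ (w' : World Ξ) (k : Hom w w') (n v : w'.D), Ap (k f) n v → M v)
    (h' : ∀ (w' : World Ξ) (k : Hom w w') (n u v : w'.D), Ap (k f) n u → Ap (k g) n v → T u → M v) :
    M (xi f g) := by
  have := force_all_elim (force_all_elim (force_axm (Ξ := Ξ) ![] .xiMeaningful) f) g
  rw [force_imp] at this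
  have := this w (.id w) ?_
  · simpa [xi] using this
  · refine force_and.2 ⟨force_all.2 fun w' k n => force_imp.2 fun w'' k' hn => ?_,
      force_all.2 fun w' k n => force_imp.2 fun w'' k' hn => ?_⟩
    · simp at hn ⊢
      obtain ⟨v, hv⟩ := hn
      exact ⟨v, hv, h w'' (k'.comp k) _ _ hv⟩
    · simp at hn ⊢
      obtain ⟨-, ⟨v, hv⟩, u, hu, hT⟩ := hn
      exact ⟨v, hv, h' w'' (k'.comp k) _ _ _ hu hv hT⟩

theorem T_xi {f g : w.D} (h : M (xi f g)) : T (xi f g) ↔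
    ∀ (w' : World Ξ) (k : Hom w w') (n u : w'.D), Ap (k f) n u → T u → ∃ v, Ap (k g) n v ∧ T v := by
  have := force_all_elim (force_all_elim (force_axm (Ξ := Ξ) ![] .xiTrue) f) g
  rw [force_imp] at this
  have := force_iff.1 (this w (.id w) (by simpa [xi] using h)) w (.id w)
  simp [force_all, force_imp, xi_def] at this
  refine this.trans ⟨fun H w' k n u hu hT => ?_, fun H w' k n w'' k' u hu hT => ?_⟩
  · simpa using H w' k n w' (.id w') u hu hT
  · simpa using H w'' (k'.comp k) (k' n) u (by simpa using hu) hT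

/-! ### V-sets -/

/-- `a` is a conditional element of `x` whose condition is True. -/
def El (x a : w.D) : Prop := ∃ n c, Ap x n (pair a c) ∧ T c

theorem El.map {x a : w.D} (h : El x a) (f : Hom w w') : El (f x) (f a) := by
  obtain ⟨n, c, h, hc⟩ := h
  exact ⟨f n, f c, by simpa using h.map f, f.T hc⟩

/-- The implication from `T` may be read in the current world: all later worlds are quantified over
anyway, and values of programs are unique and preserved. -/
theorem force_fm_closed {n : ℕ} {t : Tm n} {P : Fm (n + 1)} {ρ : Fin n → w.D} :
    force (.closed t P) ρ ↔ ∀ (w' : World Ξ) (f : Hom w w') (n : w'.D),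
      ∃ v, Ap (f (t.eval ρ)) n v ∧ M (right v) ∧
        (T (right v) → force P (vecCons (left v) fun i => f (ρ i))) := by
  rw [Fm.closed, force_all]
  simp [force_imp, force_subst, Hom.eval]
  constructor
  · intro h w' f n
    obtain ⟨v, h1, h2, h3⟩ := h w' f n
    exact ⟨v, h1, h2, fun hT => by simpa using h3 w' (.id _) hT⟩
  · intro h w' f n
    obtain ⟨v, h1, h2, h3⟩ := h w' f n
    refine ⟨v, h1, h2, fun w'' g hT => ?_⟩
    obtain ⟨v', h1', h2', h3'⟩ := h w'' (g.comp f) (g n)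
    have := h1'.unique (by simpa [Hom.eval] using h1.map g)
    subst this
    simpa using h3' (by simpa using hT)

theorem V_intro {x : w.D} (h : ∀ (w' : World Ξ) (f : Hom w w') (n : w'.D),
    ∃ v, Ap (f x) n v ∧ M (right v) ∧ (T (right v) → V (left v))) : V x := by
  have := force_all_elim (force_axm (Ξ := Ξ) ![] .vIntro) x
  rw [force_imp] at this
  simpa using this w (.id w) (force_fm_closed.2 (by simpa using h))

theorem V_induct' {n : ℕ} (φ : Fm (n + 1)) {ρ : Fin n → w.D}
    (h : ∀ (w' : World Ξ) (f : Hom w w') (x : w'.D),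
      (∀ (w'' : World Ξ) (g : Hom w' w'') (m : w''.D), ∃ v, Ap (g x) m v ∧ M (right v) ∧
        (T (right v) → force φ (vecCons (left v) fun i => g (f (ρ i))))) →
      force φ (vecCons x fun i => f (ρ i))) {x : w.D} (hx : V x) : force φ (vecCons x ρ) := by
  have := force_axm (Ξ := Ξ) ρ (.vInd φ)
  rw [Fm.vInd, force_imp] at this
  have := this w (.id w) ?_
  · have := force_imp.1 (force_all_elim this x) w (.id w) (by simpa using hx)
    simpa using this
  · refine force_all.2 fun w' f x => force_imp.2 fun w'' g h' => ?_
    have := h w'' (g.comp f) (g x)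
    simp only [Hom.comp_apply, Hom.id_apply, Hom.map_cons] at this ⊢
    refine this ?_
    simpa [force_fm_closed, force_subst] using h'

/-- Inversion of the introduction rule, by induction over v-sets for the premise of that rule. In
the induction step the conditional elements satisfy the premise, so they are v-sets by introduction.
-/
theorem V.unfold {x : w.D} (h : V x) (n : w.D) :
    ∃ a c, Ap x n (pair a c) ∧ M c ∧ (T c → V a) := by
  have := V_induct' (Ξ := Ξ) (.closed (var 0) (.V (var 0))) (ρ := ![]) (fun w' f x hx => ?_) h
  · obtain ⟨v, h1, h2, h3⟩ := force_fm_closed.1 this w (.id w) n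
    exact ⟨left v, right v, by simpa using h1, h2, by simpa using h3⟩
  · refine force_fm_closed.2 fun w'' g n => ?_
    obtain ⟨v, h1, h2, h3⟩ := hx w'' g n
    refine ⟨v, by simpa using h1, h2, fun hT => ?_⟩
    have := V_intro (x := left v) fun w₃ k m => ?_
    · simpa using this
    · obtain ⟨v', h1', h2', h3'⟩ := force_fm_closed.1 (h3 hT) w₃ k m
      exact ⟨v', by simpa using h1', h2', by simpa using h3'⟩

theorem V.of_el {x a : w.D} (h : V x) (ha : El x a) : V a := by
  obtain ⟨n, c, hn, hc⟩ := ha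
  obtain ⟨a', c', h1, h2, h3⟩ := h.unfold n
  have := hn.unique h1
  rw [pair_inj] at this
  rw [this.1]
  exact h3 (this.2 ▸ hc)

/-- Induction over v-sets. -/
theorem V.induct {n : ℕ} (φ : Fm (n + 1)) {ρ : Fin n → w.D}
    (h : ∀ (w' : World Ξ) (f : Hom w w') (x : w'.D), V x →
      (∀ (w'' : World Ξ) (g : Hom w' w'') (a : w''.D), El (g x) a →
        force φ (vecCons a fun i => g (f (ρ i)))) →
      force φ (vecCons x fun i => f (ρ i))) {x : w.D} (hx : V x) : force φ (vecCons x ρ) := by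
  -- Carrying `V` along in the induction formula makes `V x` available in the step.
  have := V_induct' (Ξ := Ξ) (.and φ (.V (var 0))) (ρ := ρ) (fun w' f x H => ?_) hx
  · exact (force_and.1 this).1
  · have hV : V x := by
      refine V_intro fun w'' g n => ?_
      obtain ⟨v, h1, h2, h3⟩ := H w'' g n
      exact ⟨v, h1, h2, fun hT => by simpa using (force_and.1 (h3 hT)).2⟩
    refine force_and.2 ⟨h w' f x hV fun w'' g a ⟨m, c, hm, hc⟩ => ?_, by simpa using hV⟩
    obtain ⟨v, h1, h2, h3⟩ := H w'' g m
    have := h1.unique hm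
    subst this
    have := (force_and.1 (h3 (by simpa using hc))).1
    simpa using this

end World

/-! ### Closure properties of single Meaningful conditions -/

namespace World

variable {w w' : World Ξ}

/-! ### Formulas which are equivalent to the truth of a Meaningful condition -/

/-- `φ` is equivalent to the truth of the condition `c`. -/
def Code (c : w.D) {n : ℕ} (φ : Fm n) (ρ : Fin n → w.D) : Prop :=
  M c ∧ ∀ (w' : World Ξ) (f : Hom w w'), force φ (fun i => f (ρ i)) ↔ T (f c)

/-- The formula which expresses `Code`. -/
def _root_.VSet.Fm.coded {n : ℕ} (φ : Fm n) : Fm (n + 1) :=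
  .and (.M (var 0)) (.iff φ.shift (.T (var 0)))

@[simp] theorem force_coded {n : ℕ} {φ : Fm n} {c : w.D} {ρ : Fin n → w.D} :
    force φ.coded (vecCons c ρ) ↔ Code c φ ρ := by
  simp [Fm.coded, Code, force_iff]

theorem Code.map {c : w.D} {n : ℕ} {φ : Fm n} {ρ : Fin n → w.D} (h : Code c φ ρ)
    (f : Hom w w') : Code (f c) φ fun i => f (ρ i) :=
  ⟨f.M h.1, fun w'' g => h.2 w'' (g.comp f)⟩

theorem Code.iff {c : w.D} {n : ℕ} {φ : Fm n} {ρ : Fin n → w.D} (h : Code c φ ρ) :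
    force φ ρ ↔ T c := h.2 w (.id w)

/-- `φ` is equivalent to the truth of some Meaningful condition. -/
def Cd {n : ℕ} (φ : Fm n) (ρ : Fin n → w.D) : Prop := ∃ c, Code c φ ρ

theorem Cd.map {n : ℕ} {φ : Fm n} {ρ : Fin n → w.D} (h : Cd φ ρ)
    (f : Hom w w') : Cd φ fun i => f (ρ i) :=
  ⟨_, h.choose_spec.map f⟩

theorem Cd.congr {n m : ℕ} {φ : Fm n} {ψ : Fm m} {ρ : Fin n → w.D} {τ : Fin m → w.D}
    (h : ∀ (w' : World Ξ) (f : Hom w w'), force φ (fun i => f (ρ i)) ↔ force ψ fun i => f (τ i)) :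
    Cd φ ρ ↔ Cd ψ τ := by
  simp only [Cd, Code, h]

/-- The formula which is always true. -/
def _root_.VSet.Fm.top {n : ℕ} : Fm n := .eq .zero .zero

@[simp] theorem force_top {n : ℕ} {ρ : Fin n → w.D} : force .top ρ := by simp [Fm.top]

theorem _root_.VSet.Fm.AlmostNegative.top {n : ℕ} : (Fm.top (n := n)).AlmostNegative :=
  .sigma1 (.qf (.eq _ _))

/-- Extended Church's Thesis without a condition. -/
theorem ct {n : ℕ} {ψ : Fm (n + 2)} {ρ : Fin n → w.D}
    (h : ∀ (w' : World Ξ) (f : Hom w w') (d : w'.D),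
      ∃ m, force ψ (vecCons m (vecCons d fun i => f (ρ i)))) :
    ∃ e, ∀ (w' : World Ξ) (f : Hom w w') (d : w'.D),
      ∃ v, Ap (f e) d v ∧ force ψ (vecCons v (vecCons d fun i => f (ρ i))) := by
  obtain ⟨e, he⟩ := ect (.top) (ψ := ψ) (ρ := ρ) fun w' f d _ => h w' f d
  exact ⟨e, fun w' f d => he w' f d force_top⟩

/-- There are programs for the constant functions. -/
theorem exists_const (c : w.D) : ∃ e, ∀ (w' : World Ξ) (f : Hom w w') (d : w'.D), Ap (f e) d (f c) := by
  obtain ⟨e, he⟩ := ct (n := 1) (ψ := .eq (var 0) (var 2)) (ρ := ![c]) fun w' f d => ⟨f c, by simp⟩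
  refine ⟨e, fun w' f d => ?_⟩
  obtain ⟨v, h, h'⟩ := he w' f d
  simp at h'
  exact h' ▸ h

/-- "`c` is a code of `φ`" is itself a formula, so Church's Thesis finds the codes by a program,
uniformly in the variable. -/
theorem Cd.choose {n : ℕ} {φ : Fm (n + 1)} {ρ : Fin n → w.D}
    (h : ∀ (w' : World Ξ) (f : Hom w w') (d : w'.D), Cd φ (vecCons d fun i => f (ρ i))) :
    ∃ e, ∀ (w' : World Ξ) (f : Hom w w') (d : w'.D),
      ∃ c, Ap (f e) d c ∧ Code c φ (vecCons d fun i => f (ρ i)) := by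
  obtain ⟨e, he⟩ := ct (ψ := φ.coded) (ρ := ρ) fun w' f d => by simpa [Cd] using h w' f d
  exact ⟨e, by simpa using he⟩

/-- Extended Church's Thesis for a condition which is equivalent to the conjunction of the truth of
a Meaningful condition and an almost-negative formula. -/
theorem ect_of_cd {n : ℕ} {φ χ : Fm (n + 1)} {ψ : Fm (n + 2)} {ρ : Fin n → w.D}
    (hφ : ∀ (w' : World Ξ) (f : Hom w w') (d : w'.D), Cd φ (vecCons d fun i => f (ρ i)))
    (hχ : χ.AlmostNegative)
    (h : ∀ (w' : World Ξ) (f : Hom w w') (d : w'.D), force φ (vecCons d fun i => f (ρ i)) →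
      force χ (vecCons d fun i => f (ρ i)) → ∃ m, force ψ (vecCons m (vecCons d fun i => f (ρ i)))) :
    ∃ e, ∀ (w' : World Ξ) (f : Hom w w') (d : w'.D), force φ (vecCons d fun i => f (ρ i)) →
      force χ (vecCons d fun i => f (ρ i)) →
      ∃ v, Ap (f e) d v ∧ force ψ (vecCons v (vecCons d fun i => f (ρ i))) := by
  obtain ⟨a, ha⟩ := Cd.choose hφ
  -- With `a` computing the codes, `φ(d)` is equivalent to the almost-negative formula `∀ o (T(a, d,
  -- o) → T(U(o)))`, which Extended Church's Thesis admits as antecedent.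
  have key : ∀ (w' : World Ξ) (f : Hom w w') (d : w'.D),
      force (.all (.imp (.kleene (Tm.shift (var 1)) (Tm.shift (var 0)) (var 0))
        (Fm.subst (vecCons (var 0).out fun j => var j.succ) (.T (var 0)))))
        (vecCons d (vecCons (f a) fun i => f (ρ i))) ↔ force φ (vecCons d fun i => f (ρ i)) := by
    intro w' f d
    obtain ⟨c, hc, hc'⟩ := ha w' f d
    rw [force_kleene_imp, hc'.iff]
    simp
    refine ⟨fun h => by simpa using h w' (.id _) c hc, fun h w'' g v hv => ?_⟩
    rw [hv.unique (by simpa using hc.map g)]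
    exact g.T h
  have := ect (ρ := vecCons a ρ) (φ := .and (.all (.imp
    (.kleene (Tm.shift (var 1)) (Tm.shift (var 0)) (var 0))
    (Fm.subst (vecCons (var 0).out fun j => var j.succ) (.T (var 0)))))
    (χ.ren (vecCons 0 fun i => i.succ.succ)))
    (ψ := ψ.ren (vecCons 0 (vecCons 1 fun i => i.succ.succ.succ)))
    (.and (.all (.imp (.sigma1 (.qf (.eq _ _))) (.T _))) (hχ.subst _)) (fun w' f d hd => ?_)
  · obtain ⟨e, he⟩ := this
    refine ⟨e, fun w' f d h1 h2 => ?_⟩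
    have := he w' f d
    rw [force_and, Hom.map_cons, key] at this
    simpa [force_ren, VSet.map_cons] using this ⟨h1, by simpa [force_ren, VSet.map_cons] using h2⟩
  · rw [force_and, Hom.map_cons, key] at hd
    simpa [force_ren, VSet.map_cons] using h w' f d hd.1 (by simpa [force_ren, VSet.map_cons] using hd.2)

/-- `Ξ(f, g)` is vacuously Meaningful and True when `f` and `g` are nowhere defined. -/
theorem exists_true : ∃ c : w.D, M c ∧ ∀ (w' : World Ξ) (f : Hom w w'), T (f c) := by
  have h : ∀ w : World Ξ, M (xi w.divp w.divp) := fun w =>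
    M_xi (fun w' f n v h => (not_ap_divp (by simpa [divp] using h)).elim)
      (fun w' f n u v h => (not_ap_divp (by simpa [divp] using h)).elim)
  refine ⟨_, h w, fun w' f => ?_⟩
  have : f (xi w.divp w.divp) = xi w'.divp w'.divp := by simp [divp]
  rw [this, T_xi (h w')]
  exact fun w' f n u h => (not_ap_divp (by simpa [divp] using h)).elim

/-- Antecedents always True, consequents never defined. Meaningfulness of a consequent is demanded
only where it is defined, but Truth demands that it be defined. -/
theorem exists_false : ∃ c : w.D, M c ∧ ∀ (w' : World Ξ) (f : Hom w w'), ¬ T (f c) := by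
  obtain ⟨t, ht, ht'⟩ := exists_true (w := w)
  obtain ⟨k, hk⟩ := exists_const t
  have h : M (xi k w.divp) :=
    M_xi (fun w' f n v h => by rw [h.unique (hk w' f n)]; exact f.M ht)
      (fun w' f n u v _ h => (not_ap_divp (by simpa [divp] using h)).elim)
  refine ⟨_, h, fun w' f hf => ?_⟩
  have hM := f.M h
  rw [f.xi] at hM hf
  obtain ⟨v, hv, -⟩ := (T_xi hM).1 hf w' (.id _) 0 (f t) (hk w' f 0) (ht' w' f)
  exact not_ap_divp (by simpa [divp] using hv)

theorem Cd.of_true {n : ℕ} {φ : Fm n} {ρ : Fin n → w.D} (h : force φ ρ) : Cd φ ρ := by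
  obtain ⟨t, ht, ht'⟩ := exists_true (w := w)
  exact ⟨t, ht, fun w' f => iff_of_true (f.mono h) (ht' w' f)⟩

theorem Cd.of_false {n : ℕ} {φ : Fm n} {ρ : Fin n → w.D}
    (h : ∀ (w' : World Ξ) (f : Hom w w'), ¬ force φ fun i => f (ρ i)) : Cd φ ρ := by
  obtain ⟨t, ht, ht'⟩ := exists_false (w := w)
  exact ⟨t, ht, fun w' f => iff_of_false (h w' f) (ht' w' f)⟩

theorem Cd.eq {n : ℕ} {s t : Tm n} {ρ : Fin n → w.D} : Cd (.eq s t) ρ := by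
  rcases eq_or_apart (s.eval ρ) (t.eval ρ) with h | h
  · exact .of_true (force_eq.2 h)
  · exact .of_false fun w' f => by simpa only [force_eq, f.eval] using h w' f

theorem Cd.T {n : ℕ} {t : Tm n} {ρ : Fin n → w.D} (h : M (t.eval ρ)) : Cd (.T t) ρ :=
  ⟨_, h, fun w' f => by rw [force_T, f.eval]⟩

/-- `ψ` of the value of `e` at `i`. -/
theorem Cd.ap {n : ℕ} {e i : Tm n} {ψ : Fm (n + 1)} {ρ : Fin n → w.D} {v : w.D}
    (h : Ap (e.eval ρ) (i.eval ρ) v) (h' : Cd ψ (vecCons v ρ)) : Cd (.ap e i ψ) ρ := by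
  refine (Cd.congr fun w' f => ?_).1 h'
  have := h.map f
  rw [f.eval, f.eval] at this
  rw [force_ap, f.map_cons]
  exact ⟨fun h => ⟨_, this, h⟩, fun ⟨v, h1, h2⟩ => h1.unique this ▸ h2⟩

/-- The code is `Ξ(a, b ∘ ⟨id, r⟩)`, where `a` computes codes of `φ(d)` and `b` turns `⟨d, u⟩` into
a code of `ψ(d, u)`. `Ξ` needs consequents to be Meaningful only under True antecedents and includes
their definedness in its Truth, so `r` may be partial. -/
theorem Cd.all_imp_ap {n : ℕ} {φ : Fm (n + 1)} {ψ : Fm (n + 2)} {r : Tm n} {ρ : Fin n → w.D}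
    (hφ : ∀ (w' : World Ξ) (f : Hom w w') (d : w'.D), Cd φ (vecCons d fun i => f (ρ i)))
    (hψ : ∀ (w' : World Ξ) (f : Hom w w') (d v : w'.D), force φ (vecCons d fun i => f (ρ i)) →
      Ap (f (r.eval ρ)) d v → Cd ψ (vecCons v (vecCons d fun i => f (ρ i)))) :
    Cd (.all (.imp φ (.ap r.shift (var 0) ψ))) ρ := by
  obtain ⟨a, ha⟩ := Cd.choose hφ
  have h0 : ∀ (w' : World Ξ) (f : Hom w w') (d : w'.D),
      force (φ.subst (vecCons (var 0).left fun i => var i.succ)) (vecCons d fun i => f (ρ i)) ↔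
        force φ (vecCons (left d) fun i => f (ρ i)) := fun w' f d => by simp [force_subst]
  have h1 : ∀ (w' : World Ξ) (f : Hom w w') (d c : w'.D),
      Code c (ψ.subst (vecCons (var 0).right (vecCons (var 0).left fun i => var i.succ)))
        (vecCons d fun i => f (ρ i)) ↔
        Code c ψ (vecCons (right d) (vecCons (left d) fun i => f (ρ i))) := fun w' f d c => by
    simp [Code, force_subst]
  -- Here the relativised form of Church's Thesis is needed: codes of `ψ` exist only where `φ(n)`
  -- holds and `r n = u`, so `b` may be partial.
  obtain ⟨b, hb⟩ : ∃ b, ∀ (w' : World Ξ) (f : Hom w w') (n u : w'.D),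
      force φ (vecCons n fun i => f (ρ i)) → Ap (f (r.eval ρ)) n u →
      ∃ c, Ap (f b) (pair n u) c ∧ Code c ψ (vecCons u (vecCons n fun i => f (ρ i))) := by
    have := ect_of_cd (ρ := ρ) (φ := φ.subst (vecCons (var 0).left fun i => var i.succ))
      (χ := .ap r.shift (var 0).left (.eq (var 0) (var 1).right))
      (ψ := (ψ.subst (vecCons (var 0).right (vecCons (var 0).left fun i => var i.succ))).coded)
      (fun w' f d => (Cd.congr fun w'' g => ?_).1 (hφ w' f (left d)))
      (.sigma1 (.ex (.qf (.and (.eq _ _) ((Fm.QF.eq (var 0) (var 1).right).subst _))))) (fun w' f d => ?_)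
    · obtain ⟨b, hb⟩ := this
      refine ⟨b, fun w' f n u hn hu => ?_⟩
      have := hb w' f (pair n u)
      simp only [h0, force_coded, h1] at this
      simpa [hn, ← f.eval, hu] using this
    · simpa using (h0 w'' (g.comp f) (g d)).symm
    · simp only [h0, force_coded, h1]
      simp [← f.eval]
      exact hψ w' f _ _
  have hM : M (xi a (cmp b (prg w.idp (r.eval ρ)))) := by
    refine M_xi (fun w' f n v h => ?_) (fun w' f n u v h h' hT => ?_)
    · obtain ⟨c, hc, hc'⟩ := ha w' f n
      exact h.unique hc ▸ hc'.1
    · obtain ⟨c, hc, hc'⟩ := ha w' f n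
      rw [h.unique hc, ← hc'.iff] at hT
      simp [ap_cmp, ap_prg] at h'
      obtain ⟨u, hu, hv⟩ := h'
      obtain ⟨c, hc, hc'⟩ := hb w' f n u hT hu
      exact hv.unique hc ▸ hc'.1
  refine ⟨_, hM, fun w' f => ?_⟩
  have hM' := f.M hM
  rw [f.xi] at hM' ⊢
  rw [T_xi hM']
  simp [force_all, force_imp, ap_cmp, ap_prg]
  simp only [← Hom.eval]
  constructor
  · intro h w'' g n u hu hT
    obtain ⟨c, hc, hc'⟩ := ha w'' (g.comp f) n
    rw [hu.unique hc, ← hc'.iff] at hT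
    obtain ⟨v, hv, hv'⟩ := h w'' g n w'' (.id _) hT
    obtain ⟨c, hc, hc'⟩ := hb w'' (g.comp f) n v hT hv
    exact ⟨c, ⟨_, hv, hc⟩, hc'.iff.1 hv'⟩
  · intro h w'' g n w₃ k hn
    obtain ⟨u, hu, hu'⟩ := ha w₃ (k.comp (g.comp f)) (k n)
    obtain ⟨c, ⟨v, hv, hvc⟩, hT⟩ := h w₃ (k.comp g) (k n) u hu (hu'.iff.1 hn)
    obtain ⟨c', hc, hc'⟩ := hb w₃ (k.comp (g.comp f)) (k n) v hn hv
    exact ⟨v, hv, hc'.iff.2 (hvc.unique hc ▸ hT)⟩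

@[simp] theorem forall_hom_false : (∀ (w' : World Ξ) (_ : Hom w w'), False) ↔ False :=
  ⟨fun h => h w (.id w), False.elim⟩

/-- A conjunction, the second part of which has to be Meaningful only if the first part is True. -/
theorem Cd.and {n : ℕ} {φ ψ : Fm n} {ρ : Fin n → w.D} (hφ : Cd φ ρ)
    (hψ : ∀ (w' : World Ξ) (f : Hom w w'), force φ (fun i => f (ρ i)) → Cd ψ fun i => f (ρ i)) :
    Cd (φ.and ψ) ρ := by
  -- The conjunction as a universal statement over `d`: at `d = 0` it asserts `φ` outright, and at
  -- `d ≠ 0` it asserts `φ → ψ`. Each case is coded because equality with `0` is decidable, and `ψ`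
  -- is only used under `φ`.
  have h : Cd (.all (.imp (.or (.eq (var 0) .zero) (φ.ren fun i => i.succ.succ))
      (.ap (Tm.shift (var 0)) (var 0) (.or (.and (.eq (var 1) .zero) (φ.ren fun i => i.succ.succ.succ))
        (.and (.imp (.eq (var 1) .zero) .bot) (ψ.ren fun i => i.succ.succ.succ))))))
      (vecCons w.idp ρ) := by
    refine Cd.all_imp_ap (fun w' f d => ?_) (fun w' f d v hd hv => ?_)
    · rcases eq_or_apart d 0 with rfl | h
      · exact .of_true (by simp)
      · refine (Cd.congr fun w'' g => ?_).1 (hφ.map f)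
        have := h w'' g
        simp at this
        simp [force_ren, this]
    · rcases eq_or_apart d 0 with rfl | h
      · refine (Cd.congr fun w'' g => ?_).1 (hφ.map f)
        simp [force_ren]
      · have := h w' (.id w')
        simp at this
        simp [this, force_ren] at hd
        refine (Cd.congr fun w'' g => ?_).1 (hψ w' f hd)
        have := h w'' g
        simp at this
        simp [force_ren, this]
  refine (Cd.congr fun w' f => ?_).1 h
  simp [force_all, force_imp, force_ren]
  constructor
  · intro H
    have h1 := H w' (.id w') 0 w' (.id w')
    have h2 := H w' (.id w') (suc 0) w' (.id w')
    simp at h1 h2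
    exact ⟨h1, h2 h1⟩
  · intro h w'' g d w₃ k h'
    rcases zero_or_suc (k d) with hd | ⟨e, hd⟩
    · simp [hd]
      exact (k.comp g).mono h.1
    · simp [hd]
      exact (k.comp g).mono h.2

end World

/-! ### Closure properties of countable disjunctions -/

namespace World

variable {w w' : World Ξ}

/-! ### Formulas which are equivalent to a countable disjunction of Meaningful conditions -/

/-- `h` enumerates Meaningful conditions. -/
def Tot (h : w.D) : Prop :=
  ∀ (w' : World Ξ) (f : Hom w w') (r : w'.D), ∃ v, Ap (f h) r v ∧ M v

/-- One of the conditions enumerated by `h` is True. -/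
def On (h : w.D) : Prop := ∃ r v, Ap h r v ∧ T v

/-- The formula which expresses `Tot`. -/
def _root_.VSet.Fm.tot {n : ℕ} (t : Tm n) : Fm n := .all (.ap t.shift (var 0) (.M (var 0)))

/-- The formula which expresses `On`. -/
def _root_.VSet.Fm.on {n : ℕ} (t : Tm n) : Fm n := .ex (.ap t.shift (var 0) (.T (var 0)))

@[simp] theorem force_tot {n : ℕ} {t : Tm n} {ρ : Fin n → w.D} :
    force (.tot t) ρ ↔ Tot (t.eval ρ) := by
  simp [Fm.tot, Tot, force_all, Hom.eval]

@[simp] theorem force_on {n : ℕ} {t : Tm n} {ρ : Fin n → w.D} :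
    force (.on t) ρ ↔ On (t.eval ρ) := by
  simp [Fm.on, On]

theorem Tot.map {h : w.D} (H : Tot h) (f : Hom w w') : Tot (f h) :=
  fun w'' g r => H w'' (g.comp f) r

/-- `φ` is equivalent to the truth of one of the Meaningful conditions enumerated by `h`. -/
def Enum (h : w.D) {n : ℕ} (φ : Fm n) (ρ : Fin n → w.D) : Prop :=
  Tot h ∧ ∀ (w' : World Ξ) (f : Hom w w'), force φ (fun i => f (ρ i)) ↔ On (f h)

/-- The formula which expresses `Enum`. -/
def _root_.VSet.Fm.enum {n : ℕ} (φ : Fm n) : Fm (n + 1) :=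
  .and (.tot (var 0)) (.iff φ.shift (.on (var 0)))

@[simp] theorem force_enum {n : ℕ} {φ : Fm n} {h : w.D} {ρ : Fin n → w.D} :
    force φ.enum (vecCons h ρ) ↔ Enum h φ ρ := by
  simp [Fm.enum, Enum, force_iff]

theorem Enum.map {h : w.D} {n : ℕ} {φ : Fm n} {ρ : Fin n → w.D} (H : Enum h φ ρ)
    (f : Hom w w') : Enum (f h) φ fun i => f (ρ i) :=
  ⟨H.1.map f, fun w'' g => H.2 w'' (g.comp f)⟩

theorem Enum.iff {h : w.D} {n : ℕ} {φ : Fm n} {ρ : Fin n → w.D} (H : Enum h φ ρ) :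
    force φ ρ ↔ On h := H.2 w (.id w)

/-- `φ` is equivalent to a countable disjunction of Meaningful conditions. -/
def Rep {n : ℕ} (φ : Fm n) (ρ : Fin n → w.D) : Prop := ∃ h, Enum h φ ρ

theorem Rep.map {n : ℕ} {φ : Fm n} {ρ : Fin n → w.D} (h : Rep φ ρ)
    (f : Hom w w') : Rep φ fun i => f (ρ i) :=
  ⟨_, h.choose_spec.map f⟩

theorem Rep.congr {n m : ℕ} {φ : Fm n} {ψ : Fm m} {ρ : Fin n → w.D} {τ : Fin m → w.D}
    (h : ∀ (w' : World Ξ) (f : Hom w w'), force φ (fun i => f (ρ i)) ↔ force ψ fun i => f (τ i)) :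
    Rep φ ρ ↔ Rep ψ τ := by
  simp only [Rep, Enum, h]

theorem Rep.on {n : ℕ} {t : Tm n} {ρ : Fin n → w.D} (h : Tot (t.eval ρ)) : Rep (.on t) ρ :=
  ⟨_, h, fun w' f => by rw [force_on, f.eval]⟩

theorem Cd.rep {n : ℕ} {φ : Fm n} {ρ : Fin n → w.D} (h : Cd φ ρ) : Rep φ ρ := by
  obtain ⟨c, hc, hc'⟩ := h
  obtain ⟨e, he⟩ := exists_const c
  refine ⟨e, fun w' f r => ⟨_, he w' f r, f.M hc⟩, fun w' f => (hc' w' f).trans ?_⟩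
  exact ⟨fun h => ⟨0, _, he w' f 0, h⟩, fun ⟨r, v, h1, h2⟩ => h1.unique (he w' f r) ▸ h2⟩

theorem Rep.ap {n : ℕ} {e i : Tm n} {ψ : Fm (n + 1)} {ρ : Fin n → w.D} {v : w.D}
    (h : Ap (e.eval ρ) (i.eval ρ) v) (h' : Rep ψ (vecCons v ρ)) : Rep (.ap e i ψ) ρ := by
  refine (Rep.congr fun w' f => ?_).1 h'
  have := h.map f
  rw [f.eval, f.eval] at this
  rw [force_ap, f.map_cons]
  exact ⟨fun h => ⟨_, this, h⟩, fun ⟨v, h1, h2⟩ => h1.unique this ▸ h2⟩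

/-- `Cd φ` for all values of the variable `0`. -/
def CdAll {n : ℕ} (φ : Fm (n + 1)) (ρ : Fin n → w.D) : Prop :=
  ∀ (w' : World Ξ) (f : Hom w w') (d : w'.D), Cd φ (vecCons d fun i => f (ρ i))

/-- `Rep ψ` for all values of the variable `0` which satisfy `φ`. -/
def RepOn {n : ℕ} (φ ψ : Fm (n + 1)) (ρ : Fin n → w.D) : Prop :=
  ∀ (w' : World Ξ) (f : Hom w w') (d : w'.D), force φ (vecCons d fun i => f (ρ i)) →
    Rep ψ (vecCons d fun i => f (ρ i))

section

variable {n : ℕ} {φ ψ : Fm (n + 1)} {ρ : Fin n → w.D}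

theorem Rep.choose (hφ : CdAll φ ρ) (hψ : RepOn φ ψ ρ) : ∃ H, ∀ (w' : World Ξ) (f : Hom w w') (d : w'.D),
    force φ (vecCons d fun i => f (ρ i)) →
    ∃ h, Ap (f H) d h ∧ Enum h ψ (vecCons d fun i => f (ρ i)) := by
  have := ect_of_cd (ψ := ψ.enum) hφ .top fun w' f d hd _ => by simpa [Rep] using hψ w' f d hd
  obtain ⟨H, hH⟩ := this
  exact ⟨H, fun w' f d hd => by simpa using hH w' f d hd force_top⟩

/-- Uniform distribution of the guard over the disjuncts: `K ⟨d, s⟩` is a code of "`φ(d)` and the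
`s`-th disjunct of `ψ(d)`". The conjunction is the dependent one, since the enumeration for `ψ(d)`
is only available if `φ(d)` holds. -/
theorem Rep.exists_enum (hφ : CdAll φ ρ) (hψ : RepOn φ ψ ρ) : ∃ K : w.D, Tot K ∧ ∀ (w' : World Ξ) (f : Hom w w') (d : w'.D),
    force φ (vecCons d fun i => f (ρ i)) ∧ force ψ (vecCons d fun i => f (ρ i)) ↔
      ∃ s v, Ap (f K) (pair d s) v ∧ T v := by
  obtain ⟨H, hH⟩ := Rep.choose hφ hψ
  have h0 : ∀ (w' : World Ξ) (f : Hom w w') (d : w'.D), Cd (.and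
      (φ.subst (vecCons (var 0).left fun i => var i.succ.succ))
      (.ap (var 1) (var 0).left (.ap (var 0) (var 1).right (.T (var 0)))))
      (vecCons d fun i => f (vecCons H ρ i)) := by
    intro w' f d
    refine Cd.and ((Cd.congr fun w'' g => ?_).1 (hφ w' f (left d))) fun w'' g h => ?_
    · simp [force_subst]
    · simp only [force_subst, eval_cons, eval_left, eval_var, Hom.map_cons, Matrix.cons_val_zero,
        Matrix.cons_val_succ] at h
      obtain ⟨h, h1, h2⟩ := hH w'' (g.comp f) _ h
      obtain ⟨v, h3, h4⟩ := h2.1 w'' (.id _) (right (g d))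
      exact .ap (by simpa using h1) (.ap (by simpa using h3) (.T (by simpa using h4)))
  obtain ⟨K, hK⟩ := Cd.choose h0
  refine ⟨K, fun w' f r => (hK w' f r).imp fun c hc => ⟨hc.1, hc.2.1⟩, fun w' f d => ?_⟩
  constructor
  · rintro ⟨h1, h2⟩
    obtain ⟨h, h3, h4⟩ := hH w' f d h1
    obtain ⟨r, v, h5, h6⟩ := h4.iff.1 h2
    obtain ⟨c, h7, h8⟩ := hK w' f (pair d r)
    refine ⟨r, c, h7, h8.iff.1 ?_⟩
    simp [force_subst]
    exact ⟨h1, h, h3, v, h5, h6⟩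
  · rintro ⟨s, v, h1, h2⟩
    obtain ⟨c, h3, h4⟩ := hK w' f (pair d s)
    rw [h1.unique h3, ← h4.iff] at h2
    simp [force_subst] at h2
    obtain ⟨h5, h, h6, v, h7, h8⟩ := h2
    obtain ⟨h', h9, h10⟩ := hH w' f d h5
    exact ⟨h5, h10.iff.2 (h6.unique h9 ▸ ⟨_, _, h7, h8⟩)⟩

/-- A disjunction over `d` of disjunctions over `s` is a disjunction over the pairs `⟨d, s⟩`. -/
theorem Rep.ex_and (hφ : CdAll φ ρ) (hψ : RepOn φ ψ ρ) : Rep (.ex (.and φ ψ)) ρ := by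
  obtain ⟨K, hK, hK'⟩ := Rep.exists_enum hφ hψ
  refine ⟨K, hK, fun w' f => ?_⟩
  simp only [force_ex, force_and, hK']
  exact ⟨fun ⟨d, s, h⟩ => ⟨_, h⟩, fun ⟨r, h⟩ => ⟨left r, right r, by simpa using h⟩⟩

/-- Distributivity by Church's Thesis: the disjuncts are indexed by choice programs `e`, and the
disjunct at `e` says that `e` picks a True disjunct of `ψ(d)` whenever `φ(d)`. -/
theorem Rep.all_imp (hφ : CdAll φ ρ) (hψ : RepOn φ ψ ρ) : Rep (.all (.imp φ ψ)) ρ := by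
  obtain ⟨H, hH⟩ := Rep.choose hφ hψ
  -- The condition makes sense for every number `e`: that `e` is defined where needed is part of
  -- what it asserts.
  have h0 : ∀ (w' : World Ξ) (f : Hom w w') (e : w'.D), Cd (.all (.imp
      (φ.subst (vecCons (var 0) fun i => var i.succ.succ.succ)) (.ap (Tm.shift (var 0)) (var 0)
        (.ap (var 3) (var 1) (.ap (var 0) (var 1) (.T (var 0)))))))
      (vecCons e fun i => f (vecCons H ρ i)) := by
    intro w' f e
    refine Cd.all_imp_ap (fun w'' g d => ?_) (fun w'' g d v hd hv => ?_)
    · refine (Cd.congr fun w₃ k => ?_).1 (hφ w'' (g.comp f) d)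
      simp [force_subst]
    · simp [force_subst] at hd
      obtain ⟨h, h1, h2⟩ := hH w'' (g.comp f) _ hd
      obtain ⟨u, h3, h4⟩ := h2.1 w'' (.id _) v
      exact .ap (by simpa using h1) (.ap (by simpa using h3) (.T (by simpa using h4)))
  obtain ⟨K, hK⟩ := Cd.choose h0
  refine ⟨K, fun w' f r => (hK w' f r).imp fun c hc => ⟨hc.1, hc.2.1⟩, fun w' f => ?_⟩
  constructor
  · intro h
    simp only [force_all, force_imp] at h
    -- If the universal statement holds, the index of a True disjunct can be computed from `d`. This
    -- program is the required `e`.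
    have := ect_of_cd (φ := φ.ren (vecCons 0 fun i => i.succ.succ)) (χ := .top)
      (ψ := .ap (var 2) (var 1) (.ap (var 0) (var 1) (.T (var 0))))
      (ρ := vecCons (f H) fun i => f (ρ i))
      (fun w'' g d => (Cd.congr fun w₃ k => ?_).1 (hφ w'' (g.comp f) d)) .top
      (fun w'' g d hd _ => ?_)
    · obtain ⟨e, he⟩ := this
      obtain ⟨c, h1, h2⟩ := hK w' f e
      refine ⟨e, c, h1, h2.iff.1 ?_⟩
      simp [force_all, force_imp, force_subst]
      intro w'' g d w₃ k hd
      simpa using he w₃ (k.comp g) (k d) (by simpa [force_ren, VSet.map_cons] using hd) force_top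
    · simp [force_ren, VSet.map_cons]
    · simp [force_ren, VSet.map_cons] at hd ⊢
      have h1 := h w'' g d w'' (.id _)
      obtain ⟨h, h2, h3⟩ := hH w'' (g.comp f) d hd
      obtain ⟨r, v, h4, h5⟩ := h3.iff.1 (by simpa [hd] using h1)
      exact ⟨r, h, h2, v, h4, h5⟩
  · rintro ⟨e, c, h1, h2⟩
    obtain ⟨c', h3, h4⟩ := hK w' f e
    rw [h1.unique h3, ← h4.iff] at h2
    simp [force_all, force_imp, force_subst] at h2 ⊢
    intro w'' g d w₃ k hd
    obtain ⟨v, h5, h, h6, u, h7, h8⟩ := h2 w'' g d w₃ k hd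
    obtain ⟨h', h9, h10⟩ := hH w₃ (k.comp (g.comp f)) (k d) hd
    exact h10.iff.2 (h6.unique h9 ▸ ⟨_, _, h7, h8⟩)

end

section

variable {n : ℕ} {φ ψ : Fm n} {ρ : Fin n → w.D}

theorem Enum.cd_ap {h : w.D} (H : Enum h φ ρ) :
    CdAll (.ap (var 1) (var 0) (.T (var 0))) (vecCons h ρ) := fun w' f d => by
  obtain ⟨v, h1, h2⟩ := H.1 w' f d
  exact .ap (by simpa using h1) (.T (by simpa using h2))

/-- `(∃ r, T(h r)) → ψ` is `∀ r (T(h r) → ψ)`, a quantifier guarded by a single condition. -/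
theorem Rep.imp (hφ : Rep φ ρ)
    (hψ : ∀ (w' : World Ξ) (f : Hom w w'), force φ (fun i => f (ρ i)) → Rep ψ fun i => f (ρ i)) :
    Rep (φ.imp ψ) ρ := by
  obtain ⟨h, H⟩ := hφ
  refine (Rep.congr fun w' f => ?_).1 (Rep.all_imp (ψ := ψ.ren fun i => i.succ.succ) H.cd_ap
    fun w' f d hd => (Rep.congr fun w'' g => ?_).1 (hψ w' f ?_))
  · simp [force_all, force_imp, force_ren]
    constructor
    · intro h1 w'' g h2
      obtain ⟨r, v, h3, h4⟩ := (H.2 w'' (g.comp f)).1 h2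
      simpa using h1 w'' g r w'' (.id _) v h3 h4
    · intro h1 w'' g r w₃ k v h3 h4
      exact h1 w₃ (k.comp g) ((H.2 w₃ (k.comp (g.comp f))).2 ⟨_, _, h3, h4⟩)
  · simp [force_ren]
  · simp at hd
    obtain ⟨v, h1, h2⟩ := hd
    exact (H.2 w' f).2 ⟨_, _, h1, h2⟩

theorem Rep.and (hφ : Rep φ ρ)
    (hψ : ∀ (w' : World Ξ) (f : Hom w w'), force φ (fun i => f (ρ i)) → Rep ψ fun i => f (ρ i)) :
    Rep (φ.and ψ) ρ := by
  obtain ⟨h, H⟩ := hφ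
  refine (Rep.congr fun w' f => ?_).1 (Rep.ex_and (ψ := ψ.ren fun i => i.succ.succ) H.cd_ap
    fun w' f d hd => (Rep.congr fun w'' g => ?_).1 (hψ w' f ?_))
  · simp [force_ren, H.2 w' f, On]
  · simp [force_ren]
  · simp at hd
    obtain ⟨v, h1, h2⟩ := hd
    exact (H.2 w' f).2 ⟨_, _, h1, h2⟩

/-- A disjunction is an existential quantifier over `d`, where `d = 0` selects the first formula and
`d ≠ 0` the second. -/
theorem Rep.or (hφ : Rep φ ρ) (hψ : Rep ψ ρ) : Rep (φ.or ψ) ρ := by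
  refine (Rep.congr fun w' f => ?_).1 (Rep.ex_and (φ := .top) (ρ := ρ) (ψ := .or (.and (.eq (var 0)
    .zero) φ.shift) (.and (.imp (.eq (var 0) .zero) .bot) ψ.shift)) (fun w' f d => .of_true (by simp))
    fun w' f d _ => ?_)
  · simp
    constructor
    · rintro ⟨d, h | h⟩
      · exact .inl h.2
      · exact .inr h.2
    · rintro (h | h)
      · exact ⟨0, by simp [h]⟩
      · exact ⟨suc 0, by simp [h]⟩
  · rcases eq_or_apart d 0 with rfl | h
    · refine (Rep.congr fun w'' g => ?_).1 (hφ.map f)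
      simp
    · refine (Rep.congr fun w'' g => ?_).1 (hψ.map f)
      have := h w'' g
      simp at this
      simp [this]

end

end World

/-! ### Set theory: extensional equality and separation -/

namespace World

variable {w w' : World Ξ}

/-! ### The interpretation of set theory in a world -/

@[simp] theorem const_fin_one {α : Type*} (a : α) : (fun _ : Fin 1 => a) = ![a] :=
  funext fun i => by simp

/-- Truth of the interpretation of a formula of set theory. -/
def sat (E : Fm 2) : {n : ℕ} → SFm n → {w : World Ξ} → (Fin n → w.D) → Prop
  | _, .bot, _, _ => False
  | _, .eq i j, _, ρ => force E ![ρ i, ρ j]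
  | _, .and φ ψ, _, ρ => sat E φ ρ ∧ sat E ψ ρ
  | _, .or φ ψ, _, ρ => sat E φ ρ ∨ sat E ψ ρ
  | _, .imp φ ψ, w, ρ => ∀ (w' : World Ξ) (f : Hom w w'),
      sat E φ (fun i => f (ρ i)) → sat E ψ fun i => f (ρ i)
  | _, .all φ, w, ρ => ∀ (w' : World Ξ) (f : Hom w w') (d : w'.D), V d →
      sat E φ (vecCons d fun i => f (ρ i))
  | _, .ex φ, w, ρ => ∃ d : w.D, V d ∧ sat E φ (vecCons d ρ)
  | _, .ball j φ, w, ρ => ∀ (w' : World Ξ) (f : Hom w w') (d : w'.D), El (f (ρ j)) d →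
      sat E φ (vecCons d fun i => f (ρ i))
  | _, .bex j φ, w, ρ => ∃ d : w.D, El (ρ j) d ∧ sat E φ (vecCons d ρ)

variable {E : Fm 2}

theorem force_interp {n k : ℕ} (φ : SFm n) (τ : Fin n → Tm k) {w : World Ξ} (ρ : Fin k → w.D) :
    force (φ.interp E τ) ρ ↔ sat E φ fun i => (τ i).eval ρ := by
  induction φ generalizing k w with
  | bot => simp [SFm.interp, sat]
  | eq i j => simp [SFm.interp, sat, force_subst]
  | and φ ψ ih ih' => simp [SFm.interp, sat, ih, ih']
  | or φ ψ ih ih' => simp [SFm.interp, sat, ih, ih']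
  | imp φ ψ ih ih' => simp [SFm.interp, sat, ih, ih', force_imp, Hom.eval]
  | all φ ih =>
    simp only [SFm.interp, sat, ih, force_all, force_imp, Hom.eval, force_V, eval_cons, eval_var,
      eval_shift, Hom.map_cons, Matrix.cons_val_zero]
    exact ⟨fun h w' f d hd => h w' f d w' (.id _) hd, fun h w' f d w'' g hd =>
      h w'' (g.comp f) (g d) hd⟩
  | ex φ ih => simp [SFm.interp, sat, ih]
  | ball j φ ih =>
    simp only [SFm.interp, sat, ih, force_all, force_imp, Hom.eval, force_T, force_ap, eval_cons,
      eval_var, eval_shift, eval_left, eval_right, Hom.map_cons, Matrix.cons_val_zero]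
    constructor
    · rintro h w' f a ⟨n, c, h1, h2⟩
      obtain ⟨v, h3, h4⟩ := h w' f n w' (.id _) ⟨_, h1, by simpa using h2⟩
      have := h1.unique h3
      subst this
      simpa using h4
    · rintro h w' f n w'' g ⟨v, h1, h2⟩
      exact ⟨v, h1, h w'' (g.comp f) _ ⟨_, _, by simpa using h1, h2⟩⟩
  | bex j φ ih =>
    simp only [SFm.interp, sat, ih, force_ex, force_and, force_T, force_ap, eval_cons,
      eval_var, eval_shift, eval_left, eval_right, Matrix.cons_val_zero]
    constructor
    · rintro ⟨n, v, h1, h2, h3⟩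
      exact ⟨_, ⟨n, right v, by simpa using h1, h2⟩, h3⟩
    · rintro ⟨a, ⟨n, c, h1, h2⟩, h3⟩
      exact ⟨n, _, h1, by simpa using h2, by simpa using h3⟩

theorem force_interp_var {n : ℕ} {φ : SFm n} {w : World Ξ} {ρ : Fin n → w.D} :
    force (φ.interp E var) ρ ↔ sat E φ ρ := by
  simp [force_interp]

theorem sat_rename {n m : ℕ} (φ : SFm n) (r : Fin n → Fin m) {w : World Ξ} (ρ : Fin m → w.D) :
    sat E (φ.rename r) ρ ↔ sat E φ fun i => ρ (r i) := by
  induction φ generalizing m w with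
  | bot => rfl
  | eq i j => rfl
  | and φ ψ ih ih' => simp only [SFm.rename, sat, ih, ih']
  | or φ ψ ih ih' => simp only [SFm.rename, sat, ih, ih']
  | imp φ ψ ih ih' => simp only [SFm.rename, sat, ih, ih']
  | all φ ih => simp [SFm.rename, sat, ih, VSet.map_cons]
  | ex φ ih => simp [SFm.rename, sat, ih, VSet.map_cons]
  | ball j φ ih => simp [SFm.rename, sat, ih, VSet.map_cons]
  | bex j φ ih => simp [SFm.rename, sat, ih, VSet.map_cons]

theorem sat_close {n : ℕ} {φ : SFm n} (h : ∀ (w' : World Ξ) (_ : Hom w w') (ρ : Fin n → w'.D),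
    (∀ i, V (ρ i)) → sat E φ ρ) : sat E φ.close (![] : Fin 0 → w.D) := by
  induction n with
  | zero => exact h w (.id w) _ fun i => i.elim0
  | succ n ih =>
    refine ih fun w' f ρ hρ w'' g d hd => ?_
    exact h w'' (g.comp f) _ (Fin.cases hd fun i => g.V (hρ i))

/-! ### Extensional equality -/

/-- Every element of `x` is an element of `y`. -/
def Sub (E : Fm 2) (x y : w.D) : Prop := ∀ (w' : World Ξ) (f : Hom w w') (a : w'.D), El (f x) a →
  ∃ b, El (f y) b ∧ force E ![a, b]

/-- The formula `E` is extensional equality of v-sets. -/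
def ExtEq (E : Fm 2) (w : World Ξ) : Prop := ∀ (w' : World Ξ) (_ : Hom w w') (x y : w'.D),
  V x → V y → (force E ![x, y] ↔ Sub E x y ∧ Sub E y x)

theorem force_extEq : force (SFm.extEq.interp E ![]) (![] : Fin 0 → w.D) ↔ ExtEq E w := by
  rw [force_interp]
  simp [SFm.extEq, SFm.iff, SFm.mem, sat, ExtEq, Sub]
  constructor
  · intro h w' f x y hx hy
    obtain ⟨h1, h2⟩ := h w' f x hx w' (.id _) y hy
    exact ⟨fun h => h1 w' (.id _) h, fun h => h2 w' (.id _) h.1 h.2⟩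
  · intro h w' f x hx w'' g y hy
    have H := fun w₃ (k : Hom w'' w₃) => h w₃ (k.comp (g.comp f)) (k (g x)) (k y) (k.V (g.V hx)) (k.V hy)
    exact ⟨fun w₃ k h => (H w₃ k).1 h, fun w₃ k h1 h2 => (H w₃ k).2 ⟨h1, h2⟩⟩

theorem ExtEq.map (h : ExtEq E w) (f : Hom w w') : ExtEq E w' :=
  fun w'' g => h w'' (g.comp f)

theorem ExtEq.eq_iff (h : ExtEq E w) {x y : w.D} (hx : V x) (hy : V y) :
    force E ![x, y] ↔ Sub E x y ∧ Sub E y x := h w (.id w) x y hx hy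

theorem ExtEq.symm (h : ExtEq E w) {x y : w.D} (hx : V x) (hy : V y) (hxy : force E ![x, y]) :
    force E ![y, x] :=
  (h.eq_iff hy hx).2 ((h.eq_iff hx hy).1 hxy).symm

theorem ExtEq.refl (h : ExtEq E w) {x : w.D} (hx : V x) : force E ![x, x] := by
  have := V.induct (ρ := ![]) (E.subst ![var 0, var 0]) (fun w' f x hx IH => ?_) hx
  · simpa [force_subst] using this
  · simp [force_subst] at IH ⊢
    rw [(h.map f).eq_iff hx hx]
    have : Sub E x x := fun w'' g a ha => ⟨a, ha, IH w'' g a ha⟩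
    exact ⟨this, this⟩

theorem ExtEq.trans (h : ExtEq E w) {x y z : w.D} (hx : V x) (hy : V y) (hz : V z)
    (hxy : force E ![x, y]) (hyz : force E ![y, z]) : force E ![x, z] := by
  -- Only `x` is subject to induction. The other two v-sets are quantified inside because they
  -- change to elements of `y` and `z`.
  have := V.induct (ρ := ![]) (.all (.all (.imp (.and (.and (.V (var 1)) (.V (var 0)))
    (.and (E.subst ![var 2, var 1]) (E.subst ![var 1, var 0]))) (E.subst ![var 2, var 0]))))
    (fun w' f x hx IH => ?_) hx
  · simp [force_subst, force_imp, force_all] at this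
    simpa using this w (.id w) y w (.id w) z w (.id w) hy hz hxy hyz
  · simp [force_subst, force_imp, force_all] at IH ⊢
    intro w₁ f₁ y w₂ f₂ z w₃ f₃ hy hz hxy hyz
    have hx : V (f₃ (f₂ (f₁ x))) := f₃.V (f₂.V (f₁.V hx))
    replace h : ExtEq E w₃ := h.map (f₃.comp (f₂.comp (f₁.comp f)))
    replace IH := fun (w' : World Ξ) (g : Hom w₃ w') (a b c : w'.D) (ha : El (g (f₃ (f₂ (f₁ x)))) a)
      (hb : V b) (hc : V c) (h1 : force E ![a, b]) (h2 : force E ![b, c]) => by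
        simpa using IH w' (g.comp (f₃.comp (f₂.comp f₁))) a (by simpa using ha) w' (.id _) b w'
          (.id _) c w' (.id _) hb hc h1 h2
    generalize f₃ (f₂ (f₁ x)) = x, f₃ (f₂ y) = y, f₃ z = z at *
    rw [h.eq_iff hx hy] at hxy
    rw [h.eq_iff hy hz] at hyz
    rw [h.eq_iff hx hz]
    refine ⟨fun w' g a ha => ?_, fun w' g c hc => ?_⟩
    · obtain ⟨b, hb, hab⟩ := hxy.1 w' g a ha
      obtain ⟨c, hc, hbc⟩ := hyz.1 w' g b hb
      exact ⟨c, hc, IH w' g a b c ha ((g.V hy).of_el hb) ((g.V hz).of_el hc) hab hbc⟩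
    -- The hypothesis speaks of chains that start at an element of `x`, so this chain is reversed by
    -- symmetry and the result reversed back.
    · obtain ⟨b, hb, hcb⟩ := hyz.2 w' g c hc
      obtain ⟨a, ha, hba⟩ := hxy.2 w' g b hb
      have Ha := (g.V hx).of_el ha
      have Hb := (g.V hy).of_el hb
      have Hc := (g.V hz).of_el hc
      replace h := h.map g
      exact ⟨a, ha, h.symm Ha Hc (IH w' g a b c ha Hb Hc (h.symm Hb Ha hba) (h.symm Hc Hb hcb))⟩

/-- `E` is an equivalence relation on v-sets, and equal bounds have pairwise equal elements, which
are again v-sets. -/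
theorem ExtEq.sat_iff {n : ℕ} {φ : SFm n} (hφ : φ.Bounded) {w : World Ξ} (h : ExtEq E w)
    {ρ τ : Fin n → w.D} (hρ : ∀ i, V (ρ i)) (hτ : ∀ i, V (τ i)) (H : ∀ i, force E ![ρ i, τ i]) :
    sat E φ ρ ↔ sat E φ τ := by
  have hom : ∀ {n : ℕ} {w w' : World Ξ} {ρ τ : Fin n → w.D} (f : Hom w w'),
      (∀ i, force E ![ρ i, τ i]) → ∀ i, force E ![f (ρ i), f (τ i)] := fun f H i => by
    simpa using f.mono (H i)
  have cons : ∀ {n : ℕ} {w : World Ξ} {ρ τ : Fin n → w.D} {a b : w.D},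
      (∀ i, force E ![ρ i, τ i]) → force E ![a, b] →
      ∀ i : Fin (n + 1), force E ![vecCons a ρ i, vecCons b τ i] := fun H h => Fin.cases h H
  have hV : ∀ {n : ℕ} {w : World Ξ} {ρ : Fin n → w.D} {a : w.D},
      (∀ i, V (ρ i)) → V a → ∀ i : Fin (n + 1), V (vecCons a ρ i) := fun H h => Fin.cases h H
  induction hφ generalizing w with
  | bot => rfl
  | eq i j =>
    exact ⟨fun h' => h.trans (hτ i) (hρ i) (hτ j) (h.symm (hρ i) (hτ i) (H i))
      (h.trans (hρ i) (hρ j) (hτ j) h' (H j)), fun h' => h.trans (hρ i) (hτ i) (hρ j) (H i)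
      (h.trans (hτ i) (hτ j) (hρ j) h' (h.symm (hρ j) (hτ j) (H j)))⟩
  | and _ _ ih ih' => exact and_congr (ih h hρ hτ H) (ih' h hρ hτ H)
  | or _ _ ih ih' => exact or_congr (ih h hρ hτ H) (ih' h hρ hτ H)
  | imp _ _ ih ih' =>
    refine forall_congr' fun w' => forall_congr' fun f => imp_congr ?_ ?_
    · exact ih (h.map f) (fun i => f.V (hρ i)) (fun i => f.V (hτ i)) (hom f H)
    · exact ih' (h.map f) (fun i => f.V (hρ i)) (fun i => f.V (hτ i)) (hom f H)
  | ball j _ ih =>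
    have key := fun (w' : World Ξ) (f : Hom w w') (a b : w'.D) (ha : V a) (hb : V b)
      (hab : force E ![a, b]) => ih (h.map f) (hV (fun i => f.V (hρ i)) ha)
        (hV (fun i => f.V (hτ i)) hb) (cons (hom f H) hab)
    have hj := (h.eq_iff (hρ j) (hτ j)).1 (H j)
    constructor
    · intro h' w' f b hb
      obtain ⟨a, ha, hba⟩ := hj.2 w' f b hb
      have Ha := (f.V (hρ j)).of_el ha
      have Hb := (f.V (hτ j)).of_el hb
      exact (key w' f a b Ha Hb ((h.map f).symm Hb Ha hba)).1 (h' w' f a ha)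
    · intro h' w' f a ha
      obtain ⟨b, hb, hab⟩ := hj.1 w' f a ha
      exact (key w' f a b ((f.V (hρ j)).of_el ha) ((f.V (hτ j)).of_el hb) hab).2 (h' w' f b hb)
  | bex j _ ih =>
    have key := fun (a b : w.D) (ha : V a) (hb : V b)
      (hab : force E ![a, b]) => ih h (hV hρ ha) (hV hτ hb) (cons H hab)
    have hj := (h.eq_iff (hρ j) (hτ j)).1 (H j)
    constructor
    · rintro ⟨a, ha, h'⟩
      obtain ⟨b, hb, hab⟩ := hj.1 w (.id w) a ha
      exact ⟨b, hb, (key a b ((hρ j).of_el ha) ((hτ j).of_el hb) hab).1 h'⟩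
    · rintro ⟨b, hb, h'⟩
      obtain ⟨a, ha, hba⟩ := hj.2 w (.id w) b hb
      have Ha := (hρ j).of_el ha
      have Hb := (hτ j).of_el hb
      exact ⟨a, ha, (key a b Ha Hb (h.symm Hb Ha hba)).2 h'⟩

end World

namespace World

variable {w w' : World Ξ} {E : Fm 2}

/-! ### Bounded separation -/

/-- The interpretation of `φ` is equivalent to a countable disjunction of Meaningful conditions. -/
def SRep (E : Fm 2) {n : ℕ} (φ : SFm n) (ρ : Fin n → w.D) : Prop := Rep (φ.interp E var) ρ

theorem SRep.map {n : ℕ} {φ : SFm n} {ρ : Fin n → w.D} (h : SRep E φ ρ) (f : Hom w w') :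
    SRep E φ fun i => f (ρ i) := Rep.map h f

theorem SRep.congr {n m : ℕ} {φ : SFm n} {ψ : SFm m} {ρ : Fin n → w.D} {τ : Fin m → w.D}
    (h : ∀ (w' : World Ξ) (f : Hom w w'), sat E φ (fun i => f (ρ i)) ↔ sat E ψ fun i => f (τ i)) :
    SRep E φ ρ ↔ SRep E ψ τ :=
  Rep.congr fun w' f => by rw [force_interp_var, force_interp_var, h]

theorem rep_interp {n k : ℕ} {φ : SFm n} {σ : Fin n → Tm k} {ρ : Fin k → w.D} :
    Rep (φ.interp E σ) ρ ↔ SRep E φ fun i => (σ i).eval ρ :=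
  Rep.congr fun w' f => by
    rw [force_interp_var, force_interp]
    simp only [f.eval]

/-- All conditions of a v-set are Meaningful, so the guard of a quantifier bounded by it is a single
condition. -/
theorem V.cdAll {y : w.D} (hy : V y) {n : ℕ} {t : Tm n} {ρ : Fin n → w.D} (ht : t.eval ρ = y) :
    CdAll (.ap t.shift (var 0) (.T (var 0).right)) ρ := by
  intro w' f d
  obtain ⟨a, c, h1, h2, -⟩ := (f.V hy).unfold d
  exact .ap (v := pair a c) (by simpa [← f.eval, ht]) (.T (by simpa))

/-- Passes from elements to indices: at an index whose condition is True, the value yields an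
element to which the hypothesis applies. -/
theorem repOn_ap {n k : ℕ} {φ : SFm (n + 1)} {t : Tm k} {σ : Fin n → Tm k} {ρ : Fin k → w.D}
    (h : ∀ (w' : World Ξ) (f : Hom w w') (a : w'.D), El (f (t.eval ρ)) a →
      SRep E φ (vecCons a fun i => f ((σ i).eval ρ))) :
    RepOn (.ap t.shift (var 0) (.T (var 0).right))
      (.ap t.shift (var 0) (φ.interp E (vecCons (var 0).left fun i => (σ i).shift.shift))) ρ := by
  intro w' f d hd
  simp [← f.eval] at hd
  obtain ⟨v, h1, h2⟩ := hd
  refine .ap (v := v) (by simpa [← f.eval]) ?_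
  rw [rep_interp]
  simpa [← f.eval] using h w' f (left v) ⟨d, right v, by simpa using h1, h2⟩

theorem SRep.ball {n : ℕ} {φ : SFm (n + 1)} {j : Fin n} {ρ : Fin n → w.D} (hj : V (ρ j))
    (h : ∀ (w' : World Ξ) (f : Hom w w') (a : w'.D), El (f (ρ j)) a →
      SRep E φ (vecCons a fun i => f (ρ i))) : SRep E (.ball j φ) ρ :=
  Rep.all_imp (hj.cdAll (eval_var _ _)) (repOn_ap (σ := var) (by simpa only [eval_var] using h))

theorem SRep.bex {n : ℕ} {φ : SFm (n + 1)} {j : Fin n} {ρ : Fin n → w.D} (hj : V (ρ j))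
    (h : ∀ (w' : World Ξ) (f : Hom w w') (a : w'.D), El (f (ρ j)) a →
      SRep E φ (vecCons a fun i => f (ρ i))) : SRep E (.bex j φ) ρ := by
  refine (Rep.congr fun w' f => ?_).1 (Rep.ex_and (hj.cdAll (eval_var _ _))
    (repOn_ap (σ := var) (by simpa only [eval_var] using h)))
  simp only [SFm.interp, force_ex, force_and, force_ap]
  refine exists_congr fun n => ⟨fun ⟨⟨v, h1, h2⟩, v', h3, h4⟩ => ⟨v, h1, h2, h1.unique h3 ▸ h4⟩,
    fun ⟨v, h1, h2, h3⟩ => ⟨⟨v, h1, h2⟩, v, h1, h3⟩⟩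

/-- Extensional equality of v-sets is equivalent to a countable disjunction of Meaningful
conditions. -/
theorem ExtEq.rep (h : ExtEq E w) {x y : w.D} (hx : V x) (hy : V y) :
    SRep E (.eq 0 1) ![x, y] := by
  -- The second v-set is quantified inside, since unfolding equality replaces it by its elements.
  have := V.induct (ρ := ![]) (.all (.imp (.V (var 0)) (.ex (.enum (E.subst ![var 1, var 0])))))
    (fun w' f x hx IH => ?_) hx
  · simp [force_imp, force_all] at this
    obtain ⟨e, he⟩ := this w (.id w) y w (.id w) hy
    refine (Rep.congr fun w' f => ?_).1 ⟨e, he⟩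
    simp [force_subst, SFm.interp]
  · simp [force_imp, force_all] at IH ⊢
    intro w₁ f₁ y w₂ f₂ hy
    have hx : V (f₂ (f₁ x)) := f₂.V (f₁.V hx)
    replace h : ExtEq E w₂ := h.map (f₂.comp (f₁.comp f))
    replace IH := fun (w' : World Ξ) (g : Hom w₂ w') (a b : w'.D) (ha : El (g (f₂ (f₁ x))) a)
      (hb : V b) => IH w' (g.comp (f₂.comp f₁)) a (by simpa using ha) w' (.id _) b w'
          (.id _) hb
    generalize f₂ (f₁ x) = x, f₂ y = y at *
    replace IH : ∀ (w' : World Ξ) (g : Hom w₂ w') (a b : w'.D), El (g x) a → V b →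
        SRep E (.eq 0 1) ![a, b] := fun w' g a b ha hb => by
      obtain ⟨e, he⟩ := IH w' g a b ha hb
      refine (Rep.congr fun w' f => ?_).1 ⟨e, he⟩
      simp [force_subst, SFm.interp]
    suffices SRep E (.and (.ball 0 (.mem 0 2)) (.ball 1 (.mem 0 1))) ![x, y] by
      obtain ⟨e, he⟩ := this
      refine ⟨e, (he.1), fun w' f => (Iff.symm ?_).trans (he.2 w' f)⟩
      rw [force_interp_var, force_subst]
      simp [SFm.mem, sat]
      exact ((h.map f).eq_iff (f.V hx) (f.V hy)).symm
    refine Rep.and ?_ fun w' f _ => ?_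
    · refine SRep.ball hx fun w' f a ha => SRep.bex (f.V hy) fun w'' g b hb => ?_
      refine (SRep.congr fun w₃ k => ?_).1 (IH w'' (g.comp f) (g a) b (ha.map g)
        ((g.V (f.V hy)).of_el hb))
      simp [sat]
    -- The induction hypothesis covers `a = b` with `a` from `x`, whereas this half asks for `b =
    -- a`. Symmetry makes them equivalent.
    · refine SRep.ball (f.V hy) fun w' g b hb => SRep.bex (g.V (f.V hx)) fun w'' k a ha => ?_
      have Hb := k.V ((g.V (f.V hy)).of_el hb)
      have Ha := (k.V (g.V (f.V hx))).of_el ha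
      refine (SRep.congr fun w₃ l => ?_).1 (IH w'' (k.comp (g.comp f)) a (k b) ha Hb)
      simp [sat]
      have := h.map (l.comp (k.comp (g.comp f)))
      exact ⟨this.symm (l.V Ha) (l.V Hb), this.symm (l.V Hb) (l.V Ha)⟩

/-- Equations are covered by `ExtEq.rep`. Bounded quantifiers stay within v-sets, since elements of
v-sets are v-sets. -/
theorem ExtEq.srep {n : ℕ} {φ : SFm n} (hφ : φ.Bounded) {w : World Ξ} (h : ExtEq E w)
    {ρ : Fin n → w.D} (hρ : ∀ i, V (ρ i)) : SRep E φ ρ := by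
  induction hφ generalizing w with
  | bot => exact (Cd.of_false fun w' f => not_force_bot).rep
  | eq i j =>
    refine (SRep.congr fun w' f => ?_).1 (h.rep (hρ i) (hρ j))
    simp [sat]
  | and _ _ ih ih' => exact Rep.and (ih h hρ) fun w' f _ => (ih' h hρ).map f
  | or _ _ ih ih' => exact Rep.or (ih h hρ) (ih' h hρ)
  | imp _ _ ih ih' => exact Rep.imp (ih h hρ) fun w' f _ => (ih' h hρ).map f
  | ball j _ ih =>
    exact .ball (hρ j) fun w' f a ha => ih (h.map f)
      (Fin.cases ((f.V (hρ j)).of_el ha) fun i => f.V (hρ i))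
  | bex j _ ih =>
    exact .bex (hρ j) fun w' f a ha => ih (h.map f)
      (Fin.cases ((f.V (hρ j)).of_el ha) fun i => f.V (hρ i))

/-- The v-set of the conditional elements of `y` which satisfy `φ`. -/
theorem ExtEq.exists_sep {n : ℕ} {φ : SFm (n + 1)} (hφ : φ.Bounded) (h : ExtEq E w)
    {ρ : Fin n → w.D} (hρ : ∀ i, V (ρ i)) (j : Fin n) :
    ∃ z, V z ∧ ∀ (w' : World Ξ) (f : Hom w w') (a : w'.D),
      El (f z) a ↔ El (f (ρ j)) a ∧ sat E φ (vecCons a fun i => f (ρ i)) := by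
  obtain ⟨K, hK, hK'⟩ := Rep.exists_enum (ρ := ρ) ((hρ j).cdAll (t := var j) (eval_var _ _))
    (repOn_ap (E := E) (φ := φ) (σ := var) fun w' f a ha => (h.map f).srep hφ (by
      rw [eval_var] at ha
      simp only [eval_var]
      exact Fin.cases ((f.V (hρ j)).of_el ha) fun i => f.V (hρ i)))
  have key : ∀ (w' : World Ξ) (f : Hom w w') (d a c : w'.D), Ap (f (ρ j)) d (pair a c) →
      (T c ∧ sat E φ (vecCons a fun i => f (ρ i)) ↔ ∃ s v, Ap (f K) (pair d s) v ∧ T v) := by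
    intro w' f d a c hd
    rw [← hK' w' f d]
    simp [force_interp]
    constructor
    · exact fun h => ⟨⟨_, hd, by simpa using h.1⟩, _, hd, by simpa using h.2⟩
    · rintro ⟨⟨v, h1, h2⟩, v', h3, h4⟩
      obtain rfl := hd.unique h1
      obtain rfl := hd.unique h3
      exact ⟨by simpa using h2, by simpa using h4⟩
  -- The program of `z`: at `⟨d, s⟩` it returns the `d`-th conditional element of `y` (here `ρ j`),
  -- paired with the condition `K ⟨d, s⟩`. The tag `2` is the left projection.
  have ap_z : ∀ (w' : World Ξ) (f : Hom w w') (d s a c v : w'.D), Ap (f (ρ j)) d (pair a c) →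
      Ap (f K) (pair d s) v → Ap (f (prg (cmp (pair (nm 2) 0) (cmp (ρ j) (pair (nm 2) 0))) K))
        (pair d s) (pair a v) := by
    intro w' f d s a c v h1 h2
    simp [ap_prg, ap_cmp, ap_left]
    exact ⟨⟨_, h1, by simp⟩, h2⟩
  refine ⟨prg (cmp (pair (nm 2) 0) (cmp (ρ j) (pair (nm 2) 0))) K, ?_, ?_⟩
  · refine V_intro fun w' f r => ?_
    obtain ⟨d, s, rfl⟩ := exists_pair r
    obtain ⟨a, c, h1, h2, h3⟩ := (f.V (hρ j)).unfold d
    obtain ⟨v, h4, h5⟩ := hK w' f (pair d s)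
    refine ⟨_, ap_z w' f d s a c v h1 h4, by simpa, fun hv => ?_⟩
    simp at hv ⊢
    exact h3 ((key w' f d a c h1).2 ⟨s, v, h4, hv⟩).1
  · intro w' f a
    constructor
    · rintro ⟨r, v, h1, h2⟩
      obtain ⟨d, s, rfl⟩ := exists_pair r
      obtain ⟨a', c, h3, -⟩ := (f.V (hρ j)).unfold d
      obtain ⟨v', h4, -⟩ := hK w' f (pair d s)
      have := h1.unique (ap_z w' f d s a' c v' h3 h4)
      rw [pair_inj] at this
      obtain ⟨rfl, rfl⟩ := this
      obtain ⟨hc, hs⟩ := (key w' f d a c h3).2 ⟨s, v, h4, h2⟩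
      exact ⟨⟨d, c, h3, hc⟩, hs⟩
    · rintro ⟨⟨d, c, h1, hc⟩, hs⟩
      obtain ⟨s, v, h2, h3⟩ := (key w' f d a c h1).1 ⟨hc, hs⟩
      exact ⟨_, v, ap_z w' f d s a c v h1 h2, h3⟩

/-- Bounded separation. -/
theorem ExtEq.separation {n : ℕ} {φ : SFm (n + 2)} (hφ : φ.Bounded) (h : ExtEq E w) :
    force (φ.separation.interp E ![]) (![] : Fin 0 → w.D) := by
  rw [force_interp, SFm.separation, Subsingleton.elim (fun i : Fin 0 => _) ![]]
  refine sat_close fun w₀ f₀ p hp w' f y hy => ?_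
  replace h := h.map (f.comp f₀)
  obtain ⟨q, hq⟩ : ∃ q : Fin n → w'.D, q = fun i => f (p i) := ⟨_, rfl⟩
  have hp : ∀ i, V (q i) := fun i => hq ▸ f.V (hp i)
  rw [← hq]
  obtain ⟨z, hz, H⟩ := h.exists_sep hφ (ρ := vecCons y q) (Fin.cases hy hp) 0
  refine ⟨z, hz, fun w'' g x hx => ?_⟩
  have hom : ∀ (w₃ : World Ξ) (k : Hom w'' w₃) (a : w₃.D), El (k (g z)) a ↔
      El (k (g y)) a ∧ sat E φ (vecCons a (vecCons (k (g y)) fun i => k (g (q i)))) := by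
    intro w₃ k a
    rw [← VSet.map_cons fun d => k (g d)]
    exact H w₃ (k.comp g) a
  -- Membership of `x` only provides a conditional element `a` equal to `x`, so `φ` has to be
  -- carried over between `x` and `a`.
  have key : ∀ (w₃ : World Ξ) (k : Hom w'' w₃) (a : w₃.D), V a → force E ![k x, a] →
      (sat E φ (vecCons (k x) (vecCons (k (g y)) fun i => k (g (q i)))) ↔
        sat E φ (vecCons a (vecCons (k (g y)) fun i => k (g (q i))))) := by
    intro w₃ k a ha hxa
    rw [← VSet.map_cons fun d => k (g d)]
    refine (h.map (k.comp g)).sat_iff hφ (Fin.cases (k.V hx) fun i => k.V (g.V ?_))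
      (Fin.cases ha fun i => k.V (g.V ?_)) (Fin.cases hxa fun i => (h.map (k.comp g)).refl (k.V (g.V ?_)))
    all_goals exact Fin.cases hy hp i
  simp [SFm.iff, SFm.mem, sat, sat_rename, VSet.map_cons]
  refine ⟨fun w₃ k => ?_, fun w₃ k => ?_⟩
  · rintro a ha hxa
    obtain ⟨h1, h2⟩ := (hom w₃ k a).1 ha
    exact ⟨⟨a, h1, hxa⟩, (key w₃ k a ((k.V (g.V hy)).of_el h1) hxa).2 h2⟩
  · rintro a ha hxa h1
    exact ⟨a, (hom w₃ k a).2 ⟨ha, (key w₃ k a ((k.V (g.V hy)).of_el ha) hxa).1 h1⟩, hxa⟩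

end World

/-! ### Bisimilarity as extensional equality -/

namespace World

variable {w w' : World Ξ}

/-! ### Existence of extensional equality -/

/-- The relation which is enumerated by `B`. -/
def Rl (B x y : w.D) : Prop := ∃ h, Ap B (pair x y) h ∧ On h

/-- Every element of `x` is related by `B` to some element of `y`. -/
def Sim (B x y : w.D) : Prop := ∀ (w' : World Ξ) (f : Hom w w') (a : w'.D), El (f x) a →
  ∃ b, El (f y) b ∧ Rl (f B) a b

/-- `B` enumerates a bisimulation. -/
def Good (B : w.D) : Prop :=
  (∀ (w' : World Ξ) (f : Hom w w') (q : w'.D), ∃ h, Ap (f B) q h ∧ Tot h) ∧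
  ∀ (w' : World Ξ) (f : Hom w w') (x y : w'.D), Rl (f B) x y → Rl (f B) y x ∧ Sim (f B) x y

theorem Good.map {B : w.D} (h : Good B) (f : Hom w w') : Good (f B) :=
  ⟨fun w'' g => h.1 w'' (g.comp f), fun w'' g => h.2 w'' (g.comp f)⟩

/-- The formula which expresses `El`. -/
def _root_.VSet.Fm.el {n : ℕ} (x a : Tm n) : Fm n :=
  .ex (.ap x.shift (var 0) (.and (.T (var 0).right) (.eq (var 0).left a.shift.shift)))

/-- The formula which expresses `Rl`. -/
def _root_.VSet.Fm.rl {n : ℕ} (B x y : Tm n) : Fm n := .ap B (x.pair y) (.on (var 0))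

/-- The formula which expresses `Sim`. -/
def _root_.VSet.Fm.sim {n : ℕ} (B x y : Tm n) : Fm n :=
  .all (.imp (.el x.shift (var 0)) (.ex (.and (.el y.shift.shift (var 0))
    (.rl B.shift.shift (var 1) (var 0)))))

/-- The formula which expresses `Good`. -/
def _root_.VSet.Fm.good {n : ℕ} (B : Tm n) : Fm n :=
  .and (.all (.ap B.shift (var 0) (.tot (var 0))))
    (.all (.all (.imp (.rl B.shift.shift (var 1) (var 0))
      (.and (.rl B.shift.shift (var 0) (var 1)) (.sim B.shift.shift (var 1) (var 0))))))

@[simp] theorem force_el {n : ℕ} {x a : Tm n} {ρ : Fin n → w.D} :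
    force (.el x a) ρ ↔ El (x.eval ρ) (a.eval ρ) := by
  simp [Fm.el]
  constructor
  · rintro ⟨n, v, h1, h2, h3⟩
    exact ⟨n, right v, by simpa [← h3] using h1, h2⟩
  · rintro ⟨n, c, h1, h2⟩
    exact ⟨n, _, h1, by simpa using h2, by simp⟩

@[simp] theorem force_rl {n : ℕ} {B x y : Tm n} {ρ : Fin n → w.D} :
    force (.rl B x y) ρ ↔ Rl (B.eval ρ) (x.eval ρ) (y.eval ρ) := by
  simp [Fm.rl, Rl]

@[simp] theorem force_sim {n : ℕ} {B x y : Tm n} {ρ : Fin n → w.D} :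
    force (.sim B x y) ρ ↔ Sim (B.eval ρ) (x.eval ρ) (y.eval ρ) := by
  simp [Fm.sim, Sim, force_all, force_imp, Hom.eval]
  exact ⟨fun h w' f a ha => by simpa using h w' f a w' (.id _) ha,
    fun h w' f a w'' g ha => h w'' (g.comp f) (g a) ha⟩

@[simp] theorem force_good {n : ℕ} {B : Tm n} {ρ : Fin n → w.D} :
    force (.good B) ρ ↔ Good (B.eval ρ) := by
  simp [Fm.good, Good, force_all, force_imp, ← Hom.eval]
  intro _
  exact ⟨fun h w' f x y hxy => by simpa using h w' f x w' (.id _) y w' (.id _) hxy,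
    fun h w' f x w'' g y w₃ k hxy => h w₃ (k.comp (g.comp f)) (k (g x)) (k y) hxy⟩

/-- Extensional equality: there is a bisimulation which relates `x` and `y`. -/
def _root_.VSet.Fm.bisim : Fm 2 := .ex (.and (.good (var 0)) (.rl (var 0) (var 1) (var 2)))

theorem force_bisim {x y : w.D} : force .bisim ![x, y] ↔ ∃ B, Good B ∧ Rl B x y := by
  simp [Fm.bisim]

theorem Good.rep {B : w.D} (h : Good B) {n : ℕ} {s t u : Tm n} {ρ : Fin n → w.D}
    (hs : s.eval ρ = B) : Rep (.rl s t u) ρ := by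
  obtain ⟨e, h1, h2⟩ := h.1 w (.id w) (pair (t.eval ρ) (u.eval ρ))
  exact .ap (v := e) (by simpa [hs] using h1) (.on (by simpa using h2))

/-- Comprehension for relations coded by numbers: a relation defined by countable disjunctions of
conditions is `Rl H` for a single total program `H`. -/
theorem Rep.choose_all {n : ℕ} {φ : Fm (n + 1)} {ρ : Fin n → w.D}
    (h : ∀ (w' : World Ξ) (f : Hom w w') (d : w'.D), Rep φ (vecCons d fun i => f (ρ i))) :
    ∃ H, (∀ (w' : World Ξ) (f : Hom w w') (q : w'.D), ∃ h, Ap (f H) q h ∧ Tot h) ∧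
      ∀ (w' : World Ξ) (f : Hom w w') (x y : w'.D),
        Rl (f H) x y ↔ force φ (vecCons (pair x y) fun i => f (ρ i)) := by
  obtain ⟨H, hH⟩ := Rep.choose (φ := .top) (ψ := φ) (ρ := ρ)
    (fun w' f d => .of_true (by simp)) fun w' f d _ => h w' f d
  refine ⟨H, fun w' f d => (hH w' f d (by simp)).imp fun h H => ⟨H.1, H.2.1⟩, fun w' f x y => ?_⟩
  obtain ⟨h, h1, h2⟩ := hH w' f (pair x y) (by simp)
  rw [h2.iff]
  exact ⟨fun ⟨h', h3, h4⟩ => h1.unique h3 ▸ h4, fun h' => ⟨h, h1, h'⟩⟩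

/-- Different elements of `x` come with different bisimulations. The conditions of `x` are
Meaningful, so Church's Thesis yields a program `e` computing one from the index of the element. The
union of these is again an enumerated bisimulation. -/
theorem exists_sim {x y : w.D} (hx : V x) (h : Sub .bisim x y) : ∃ B, Good B ∧ Sim B x y := by
  have hc : CdAll (.ap (Tm.shift (var 0)) (var 0) (.T (var 0).right)) ![x, y] :=
    hx.cdAll (by simp)
  have := ect_of_cd (χ := .top) (ψ := .and (.good (var 0)) (.ap (var 2) (var 1)
    (.ex (.and (.el (var 5) (var 0)) (.rl (var 2) (var 1).left (var 0)))))) hc .top ?_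
  · obtain ⟨e, he⟩ := this
    simp at he
    have hE : ∀ (w' : World Ξ) (f : Hom w w') (n a c : w'.D), Ap (f x) n (pair a c) → T c →
        ∃ B, Ap (f e) n B ∧ Good B ∧ ∃ b, El (f y) b ∧ Rl B a b := by
      intro w' f n a c hn hT
      obtain ⟨B, h1, h2, v, h3, h4⟩ := he w' f n _ hn (by simpa using hT)
      obtain rfl := hn.unique h3
      exact ⟨B, h1, h2, by simpa using h4⟩
    -- The union `C`: a pair is related if for some index `n` with a True condition of `x`, the
    -- bisimulation `e n` relates it.
    have := Rep.choose_all (φ := .ex (.and (.ap (var 3) (var 0) (.T (var 0).right))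
      (.ap (var 2) (var 0) (.rl (var 0) (var 2).left (var 2).right)))) (ρ := ![e, x, y])
      fun w' f q => Rep.ex_and ?_ ?_
    · obtain ⟨C, hC, hC'⟩ := this
      simp at hC'
      refine ⟨C, ⟨hC, fun w' f u v => ?_⟩, fun w' f a ha => ?_⟩
      · rw [hC', hC']
        rintro ⟨n, ⟨p, hp, hT⟩, B, hB, hB'⟩
        obtain ⟨B', h1, h2, -⟩ := hE w' f n (left p) (right p) (by simpa using hp) hT
        obtain rfl := hB.unique h1
        have := h2.2 w' (.id _) u v (by simpa using hB')
        simp at this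
        refine ⟨⟨n, ⟨p, hp, hT⟩, B, hB, this.1⟩, fun w'' g a ha => ?_⟩
        obtain ⟨b, h3, h4⟩ := this.2 w'' g a ha
        refine ⟨b, h3, (hC' w'' (g.comp f) a b).2 ⟨g n, ⟨g p, ?_, ?_⟩, g B, ?_, h4⟩⟩
        · simpa using hp.map g
        · simpa using g.T hT
        · simpa using hB.map g
      · obtain ⟨n, c, hn, hT⟩ := ha
        obtain ⟨B, h1, h2, b, h3, h4⟩ := hE w' f n a c hn hT
        exact ⟨b, h3, (hC' w' f a b).2 ⟨n, ⟨_, hn, by simpa⟩, B, h1, h4⟩⟩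
    · intro w'' g d
      refine (Cd.congr fun w₃ k => ?_).1 (hc w'' (g.comp f) d)
      simp
    · intro w'' g d hd
      simp at hd
      obtain ⟨p, hp, hT⟩ := hd
      obtain ⟨B, h1, h2, -⟩ := hE w'' (g.comp f) d (left p) (right p) (by simpa using hp) hT
      exact .ap (v := B) (by simpa using h1) (h2.rep (by simp))
  · intro w' f d hd _
    simp at hd ⊢
    obtain ⟨p, hp, hT⟩ := hd
    obtain ⟨b, h1, h2⟩ := h w' f (left p) ⟨d, right p, by simpa using hp, hT⟩
    obtain ⟨B, h3, h4⟩ := force_bisim.1 h2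
    exact ⟨B, h3, p, hp, b, h1, h4⟩

/-- A bisimulation relating `x` and `y` also relates their elements, in both directions by its
symmetry. Conversely, bisimulations matching the elements of `x` and `y` in either direction are
extended by the pair itself. -/
theorem extEq_bisim (w : World Ξ) : ExtEq .bisim w := by
  intro w _ x y hx hy
  constructor
  · intro h
    obtain ⟨B, hB, hxy⟩ := force_bisim.1 h
    have H : ∀ {x y : w.D}, Rl B x y → Sub .bisim x y := fun {x y} h w' f a ha => by
      have := (hB.2 w (.id w) x y h).2 w' f a ha
      obtain ⟨b, h1, h2⟩ := this
      exact ⟨b, h1, force_bisim.2 ⟨_, hB.map f, h2⟩⟩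
    exact ⟨H hxy, H (hB.2 w (.id w) x y hxy).1⟩
  · rintro ⟨hxy, hyx⟩
    obtain ⟨B, hB, hB'⟩ := exists_sim hx hxy
    obtain ⟨C, hC, hC'⟩ := exists_sim hy hyx
    -- The relation consisting of `B`, `C` and the pairs `(x, y)` and `(y, x)`. The new pairs are
    -- allowed since equality of numbers is decidable, and their elements are matched by `B` and `C`
    -- respectively.
    have := Rep.choose_all (φ := .or (.or (.eq (var 0) (.pair (var 1) (var 2)))
      (.eq (var 0) (.pair (var 2) (var 1)))) (.or (.rl (var 3) (var 0).left (var 0).right)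
      (.rl (var 4) (var 0).left (var 0).right))) (ρ := ![x, y, B, C])
      fun w' f q => Rep.or (.or Cd.eq.rep Cd.eq.rep)
        (.or ((hB.map f).rep (by simp)) ((hC.map f).rep (by simp)))
    obtain ⟨K, hK, hK'⟩ := this
    simp at hK'
    refine force_bisim.2 ⟨K, ⟨hK, fun w' f u v h => ?_⟩, ?_⟩
    · have hKB : ∀ {w'' : World Ξ} (g : Hom w' w'') {a b : w''.D}, Rl (g (f B)) a b →
          Rl (g (f K)) a b := fun g _ _ h => (hK' _ (g.comp f) _ _).2 (.inr (.inl h))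
      have hKC : ∀ {w'' : World Ξ} (g : Hom w' w'') {a b : w''.D}, Rl (g (f C)) a b →
          Rl (g (f K)) a b := fun g _ _ h => (hK' _ (g.comp f) _ _).2 (.inr (.inr h))
      rw [hK'] at h ⊢
      rcases h with (⟨rfl, rfl⟩ | ⟨rfl, rfl⟩) | h | h
      · exact ⟨by simp, fun w'' g a ha => (hB' w'' (g.comp f) a ha).imp fun b h =>
          ⟨h.1, hKB g h.2⟩⟩
      · exact ⟨by simp, fun w'' g a ha => (hC' w'' (g.comp f) a ha).imp fun b h =>
          ⟨h.1, hKC g h.2⟩⟩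
      · have := hB.2 w' f u v h
        exact ⟨.inr (.inl this.1), fun w'' g a ha => (this.2 w'' g a ha).imp fun b h =>
          ⟨h.1, hKB g h.2⟩⟩
      · have := hC.2 w' f u v h
        exact ⟨.inr (.inr this.1), fun w'' g a ha => (this.2 w'' g a ha).imp fun b h =>
          ⟨h.1, hKC g h.2⟩⟩
    · have := (hK' w (.id w) x y).2 (by simp)
      simpa using this

end World

end VSet

theorem mainTheorem9 (Ξ : VSet.PR 2) :
    (∃ E : VSet.Fm 2, VSet.Thm Ξ (VSet.SFm.extEq.interp E ![])) ∧
      ∀ (E : VSet.Fm 2) (n : ℕ) (φ : VSet.SFm (n + 2)), φ.Bounded →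
        VSet.Thm Ξ (VSet.Fm.imp (VSet.SFm.extEq.interp E ![]) (φ.separation.interp E ![])) := by
  refine ⟨⟨.bisim, VSet.World.thm_of_force fun w => VSet.World.force_extEq.2
    (VSet.World.extEq_bisim w)⟩, fun E n φ hφ => VSet.World.thm_of_force fun w =>
    VSet.World.force_imp.2 fun w' f h => ?_⟩
  rw [VSet.World.Hom.map_nil] at h ⊢
  exact (VSet.World.force_extEq.1 h).separation hφ
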